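/- Let $(Z,d)$ be a compact metric space. For $\kappa\ge 1$ and $k\in\mathbb N=\{0,1,2,\dots\}$, a \emph{$\kappa$-approximation of $Z$ on scale $k$} is (the incidence graph of) a finite covering $G_k$ of $Z$ by subsets $v\subset Z$ such that for every $v\in G_k$ there is a point $z_v\in Z$ with $B(z_v,\kappa^{-1}2^{-k})\subset v\subset B(z_v,\kappa 2^{-k})$, and $B(z_v,\kappa^{-1}2^{-k})\cap B(z_w,\kappa^{-1}2^{-k})=\emptyset$ for $v\ne w$. A \emph{$\kappa$-approximation of $Z$} is a sequence $(G_k)_{k\in\mathbb N}$ of $\kappa$-approximations on scales $k$. For $p\ge1$ and a family $\mathcal F$ of (continuous) curves in $Z$, put $$\mathrm{Mod}_p(\mathcal F,G_k)=\inf_\rho\sum_{v\in G_k}\rho(v)^p ,$$ where the infimum is over all $\rho:G_k\to[0,\infty)$ with $\sum_{v\cap\gamma\neq\emptyset}\rho(v)\ge1$ for every $\gamma\in\mathcal F$. For $A,B\subset Z$ let $\mathrm{Mod}_p(A,B,G_k)$ be the modulus of the family of curves joining $A$ to $B$. For disjoint non-degenerate continua $A,B\subset Z$ let $\Delta(A,B)=\operatorname{dist}(A,B)/\min\{\operatorname{diam}A,\operatorname{diam}B\}$.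 A compact, arcwise connected, doubling metric space $Z$ satisfies the \emph{Combinatorial Loewner Property} if there is a $p>1$ such that for every $\kappa\ge1$ and every $\kappa$-approximation $(G_k)$ of $Z$ there exist positive increasing functions $\phi,\psi$ on $(0,\infty)$ with $\lim_{t\to0}\psi(t)=0$ such that $$\phi(\Delta(A,B)^{-1})\le \mathrm{Mod}_p(A,B,G_k)\le\psi(\Delta(A,B)^{-1})$$ for all disjoint non-degenerate continua $A,B\subset Z$ and all $k\in\mathbb N$ with $2^{-k}\le\min\{\operatorname{diam}A,\operatorname{diam}B\}$. Let $\mathbb S\subset[0,1]^2$ be the square Sierpinski carpet, obtained from the unit square by dividing it into nine equal subsquares, removing the open middle one, and repeating this inductively on the remaining squares. Let $\mathbb M=\bigcap_{i=1}^3\pi_i^{-1}(\mathbb S)\subset\mathbb R^3$ be the cubical Menger sponge, where $\pi_i:\mathbb R^3\to\mathbb R^2$ forgets the $i$-th coordinate. Equip both with the induced Euclidean metric. \textbf{Theorem.} $\mathbb S$ and $\mathbb M$ are compact, arcwise connected and doubling, and both satisfy the Combinatorial Loewner Property. -/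

import Mathlib

open scoped NNReal Topology

namespace CombLoewner

section Modulus

variable {Z : Type*} [MetricSpace Z]

/-- `G`, a finite set of subsets of `Z`, is (the vertex set of) a `κ`-approximation of `Z` on
scale `k`: a finite covering of `Z` by roughly round sets of size about `2 ^ (-k)`. A vertex of
the incidence graph is identified with the subset of `Z` that it stands for; two vertices are
joined by an edge iff the subsets meet, so that the graph is determined by `G`. -/
structure IsApproximationAt (κ : ℝ) (k : ℕ) (G : Finset (Set Z)) : Prop where
  covers : ⋃ v ∈ G, v = Set.univ
  exists_centers : ∃ z : {v : Set Z // v ∈ G} → Z,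
    (∀ v, Metric.ball (z v) (κ⁻¹ * ((2 : ℝ) ^ k)⁻¹) ⊆ v.1 ∧
      v.1 ⊆ Metric.ball (z v) (κ * ((2 : ℝ) ^ k)⁻¹)) ∧
    (∀ v w, v ≠ w → Disjoint (Metric.ball (z v) (κ⁻¹ * ((2 : ℝ) ^ k)⁻¹))
      (Metric.ball (z w) (κ⁻¹ * ((2 : ℝ) ^ k)⁻¹)))

/-- A `κ`-approximation of `Z`: a `κ`-approximation on each scale `k = 0, 1, 2, …`. -/
def IsApproximation (κ : ℝ) (G : ℕ → Finset (Set Z)) : Prop :=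
  ∀ k, IsApproximationAt κ k (G k)

open Classical in
/-- The `ρ`-length of a subset `γ` of `Z`: the sum of `ρ v` over the `v ∈ G` that meet `γ`. -/
noncomputable def rhoLength (G : Finset (Set Z)) (ρ : Set Z → ℝ≥0) (γ : Set Z) : ℝ≥0 :=
  ∑ v ∈ G with (v ∩ γ).Nonempty, ρ v

/-- The `p`-mass of `ρ`. -/
noncomputable def pMass (p : ℝ) (G : Finset (Set Z)) (ρ : Set Z → ℝ≥0) : ℝ :=
  ∑ v ∈ G, (ρ v : ℝ) ^ p

/-- `ρ` is admissible for a family of curves if every curve has `ρ`-length at least `1`.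
Only the values of `ρ` on `G` matter. -/
def IsAdmissible (G : Finset (Set Z)) (F : Set C(unitInterval, Z)) (ρ : Set Z → ℝ≥0) : Prop :=
  ∀ γ ∈ F, 1 ≤ rhoLength G ρ (Set.range γ)

/-- The `G`-combinatorial `p`-modulus of a family of curves, for `p ≥ 1`. The set of masses is
bounded below by `0`; it is non-empty when `G` covers `Z`, because `ρ = 1` is then admissible.
For the empty family `ρ = 0` is admissible and the modulus is `0`. -/
noncomputable def modulus (p : ℝ) (G : Finset (Set Z)) (F : Set C(unitInterval, Z)) : ℝ :=
  sInf {m : ℝ | ∃ ρ : Set Z → ℝ≥0, IsAdmissible G F ρ ∧ m = pMass p G ρ}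

/-- The family of curves joining `A` to `B`. -/
def joiningCurves (A B : Set Z) : Set C(unitInterval, Z) :=
  {γ | γ 0 ∈ A ∧ γ 1 ∈ B}

/-- A non-degenerate continuum in `Z`; `IsConnected` includes non-emptiness. -/
def IsNondegenerateContinuum (A : Set Z) : Prop :=
  IsCompact A ∧ IsConnected A ∧ A.Nontrivial

/-- The distance between two subsets, `inf {dist a b | a ∈ A, b ∈ B}`. -/
noncomputable def setDist (A B : Set Z) : ℝ :=
  sInf (Set.image2 dist A B)

/-- The relative distance of two disjoint non-degenerate continua. -/
noncomputable def relativeDistance (A B : Set Z) : ℝ :=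
  setDist A B / min (Metric.diam A) (Metric.diam B)

/-- The two-sided modulus bound in the Combinatorial `p`-Loewner Property, for a given
approximation `G`. -/
def SatisfiesLoewnerBounds (p : ℝ) (G : ℕ → Finset (Set Z)) : Prop :=
  ∃ φ ψ : ℝ → ℝ,
    (∀ t, 0 < t → 0 < φ t) ∧ (∀ t, 0 < t → 0 < ψ t) ∧
    StrictMonoOn φ (Set.Ioi 0) ∧ StrictMonoOn ψ (Set.Ioi 0) ∧
    Filter.Tendsto ψ (𝓝[>] 0) (𝓝 0) ∧
    ∀ A B : Set Z, IsNondegenerateContinuum A → IsNondegenerateContinuum B → Disjoint A B →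
      ∀ k : ℕ, ((2 : ℝ) ^ k)⁻¹ ≤ min (Metric.diam A) (Metric.diam B) →
        φ (relativeDistance A B)⁻¹ ≤ modulus p (G k) (joiningCurves A B) ∧
        modulus p (G k) (joiningCurves A B) ≤ ψ (relativeDistance A B)⁻¹

end Modulus

/-- Every ball is covered by at most `n` balls of half the radius, with `n` uniform. -/
def IsDoublingSpace (Z : Type*) [MetricSpace Z] : Prop :=
  ∃ n : ℕ, ∀ (x : Z) (r : ℝ), 0 < r →
    ∃ c : Finset Z, c.card ≤ n ∧ Metric.ball x r ⊆ ⋃ y ∈ c, Metric.ball y (r / 2)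

/-- The Combinatorial `p`-Loewner Property of a compact, arcwise connected, doubling metric
space (these three properties are part of the definition). The modulus bounds are required for
every `κ ≥ 1` and every `κ`-approximation of `Z`; the functions in them may depend on these. -/
structure CombinatorialPLoewnerProperty (p : ℝ) (Z : Type*) [MetricSpace Z] : Prop where
  one_lt : 1 < p
  compact : CompactSpace Z
  pathConnected : PathConnectedSpace Z
  doubling : IsDoublingSpace Z
  bounds : ∀ κ : ℝ, 1 ≤ κ → ∀ G : ℕ → Finset (Set Z), IsApproximation κ G →
    SatisfiesLoewnerBounds p G

/-- The Combinatorial Loewner Property. -/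
def CombinatorialLoewnerProperty (Z : Type*) [MetricSpace Z] : Prop :=
  ∃ p : ℝ, CombinatorialPLoewnerProperty p Z

/-- The open middle square of the square
`[a / 3 ^ n, (a + 1) / 3 ^ n] × [b / 3 ^ n, (b + 1) / 3 ^ n]`. -/
def middleSquare (n : ℕ) (a b : ℤ) : Set (EuclideanSpace ℝ (Fin 2)) :=
  {x | x 0 ∈ Set.Ioo ((3 * a + 1 : ℝ) / 3 ^ (n + 1)) ((3 * a + 2 : ℝ) / 3 ^ (n + 1)) ∧
    x 1 ∈ Set.Ioo ((3 * b + 1 : ℝ) / 3 ^ (n + 1)) ((3 * b + 2 : ℝ) / 3 ^ (n + 1))}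

/-- The set left after `n` steps of the construction of the carpet: start with the unit square,
and at each step remove the open middle ninth of each square of side `3 ^ (-n)`. (For a square
whose interior has been removed before, or that lies outside the unit square, this removes
nothing.) -/
def carpetStage : ℕ → Set (EuclideanSpace ℝ (Fin 2))
  | 0 => {x | ∀ i, x i ∈ Set.Icc (0 : ℝ) 1}
  | n + 1 => carpetStage n \ ⋃ (a : ℤ) (b : ℤ), middleSquare n a b

/-- The square Sierpinski carpet. -/
def sierpinskiCarpet : Set (EuclideanSpace ℝ (Fin 2)) :=
  ⋂ n, carpetStage n

/-- The map `ℝ³ → ℝ²` that forgets the `i`-th coordinate. -/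
noncomputable def forgetCoord (i : Fin 3) (x : EuclideanSpace ℝ (Fin 3)) :
    EuclideanSpace ℝ (Fin 2) :=
  WithLp.toLp 2 fun j => x (i.succAbove j)

/-- The cubical Menger sponge. -/
def mengerSponge : Set (EuclideanSpace ℝ (Fin 3)) :=
  ⋂ i : Fin 3, forgetCoord i ⁻¹' sierpinskiCarpet

end CombLoewner

/-! Carpet and sponge are the cases `n = 2, 3` of `sponge n`. The coordinates carry the Euclidean
copy to the sup metric with bounded distortion, and the vertices of a `κ`-approximation on scale `k`
overlap boundedly often with the triadic cells of side comparable to `2 ^ (-k)`. Since weights can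
be moved between families with bounded overlap (`weightMass_transferWeight_le`), moduli may be
estimated on triadic cells.

Let `M p l = crossModulus n p l` be the modulus, on cells of side `3 ^ (-l)`, of the sets that join
opposite faces of the cube. Everything rests on the reflections of the cube: `fold j` folds all
cells of level `j` onto the unit cube and maps the sponge to itself. A path that leaves the
neighborhood of a cell is folded to a crossing, so a weight on large cells times a folded weight on
small ones is admissible; hence `M p (k + l) ≤ c * M p k * M p l` (`crossModulus_add_le`).
Conversely, the union of the images of a crossing under all symmetries of the cube is connected,
because a crossing meets enough mirrors. Its unfolded copies in neighboring cells fit together, so a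
short crossing yields a short connected set passing through all cells near a given one
(`exists_unfoldedSet`).

That set need not meet two given continua `E` and `F`. The lemma `linkable_add` repairs this by
induction on scales. A connected `E` of the size of a cell visits about `3 ^ s` subcells, `s` levels
down, with disjoint neighborhoods, so around one of them the mass is smaller by a factor of about `3
^ (-s)`; there `E` is linked to the unfolded set by the induction hypothesis. The loss in going down
`s` levels is a constant times `M p s`, so the induction closes once `M p s` is small against `3 ^
s`. For `n = k + 1` and `p ≥ 1 + k * log 2 / log 3` a constant weight gives `M p s ≤ (3 / 2) ^ (k *
s)`, and `(3 / 2) ^ k < 3` for `k = 1, 2`. This is the only place where the dimension matters.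

Linking gives the reverse inequality `M p k * M p l ≤ c * M p (k + l)` (`crossModulus_mul_le`). Let
`q` be the supremum of the exponents, in a bounded range, at which `M p m` stays above a threshold.
Quasi-multiplicativity in both directions then bounds `M q l` above and below, uniformly in `l`
(`exists_criticalExponent`). Parallel lines over a product of Cantor sets show that `M p m ≥ 1` at
`p = 1 + k * log 2 / log 3`, so `q > 1`.

At `q`, linking and unfolding give the lower Loewner bound (`exists_le_mul_mass`), and product
weights around the smaller continuum give the upper one (`exists_joinAdmissible`). Averaging such
weights over `N` disjoint annuli multiplies the mass by `N ^ (1 - q)`, which makes the modulus of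
distant continua small (`exists_joinAdmissible_of_far`). The functions `φ`, `ψ` are read off from
these bounds by `exists_loewner_functions`. -/

namespace CombLoewner

/-! ### Weights on finite families and their transfer between families with bounded overlap. -/

section Weights

variable {ι κ V : Type*}

open Classical in
/-- The length of `γ` with respect to the weight `ρ` on the finite family `C q`, `q ∈ X`. -/
noncomputable def weightLength (X : Finset ι) (C : ι → Set V) (ρ : ι → ℝ≥0) (γ : Set V) : ℝ≥0 :=
  ∑ q ∈ X with (C q ∩ γ).Nonempty, ρ q

theorem weightLength_mono {X : Finset ι} {C : ι → Set V} {ρ : ι → ℝ≥0} {γ γ' : Set V}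
    (h : γ ⊆ γ') : weightLength X C ρ γ ≤ weightLength X C ρ γ' := by
  classical
  refine Finset.sum_le_sum_of_subset fun q hq => ?_
  rw [Finset.mem_filter] at hq ⊢
  exact ⟨hq.1, hq.2.mono (Set.inter_subset_inter_right _ h)⟩

theorem weightLength_union_le (X : Finset ι) (C : ι → Set V) (ρ : ι → ℝ≥0) (γ γ' : Set V) :
    weightLength X C ρ (γ ∪ γ') ≤ weightLength X C ρ γ + weightLength X C ρ γ' := by
  classical
  unfold weightLength
  refine le_trans (Finset.sum_le_sum_of_subset (t := (X.filter fun q => (C q ∩ γ).Nonempty) ∪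
    X.filter fun q => (C q ∩ γ').Nonempty) fun q hq => ?_) ?_
  · simp only [Finset.mem_filter, Finset.mem_union, Set.inter_union_distrib_left,
      Set.union_nonempty] at hq ⊢
    tauto
  · rw [← Finset.sum_union_inter]
    exact le_self_add

theorem weightLength_biUnion_le (X : Finset ι) (C : ι → Set V) (ρ : ι → ℝ≥0) (J : Finset κ)
    (γ : κ → Set V) :
    weightLength X C ρ (⋃ j ∈ J, γ j) ≤ ∑ j ∈ J, weightLength X C ρ (γ j) := by
  classical
  induction J using Finset.induction_on with
  | empty => simp [weightLength]
  | insert a s ha ih =>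
    rw [Finset.set_biUnion_insert, Finset.sum_insert ha]
    exact (weightLength_union_le _ _ _ _ _).trans (by gcongr)

/-- The `p`-mass of a weight. -/
noncomputable def weightMass (p : ℝ) (X : Finset ι) (ρ : ι → ℝ≥0) : ℝ≥0 := ∑ q ∈ X, ρ q ^ p

theorem sum_rpow_le_card_mul {p : ℝ} (hp : 1 ≤ p) (s : Finset ι) (f : ι → ℝ≥0) {N : ℕ}
    (hN : s.card ≤ N) : (∑ i ∈ s, f i) ^ p ≤ (N : ℝ≥0) ^ (p - 1) * ∑ i ∈ s, f i ^ p := by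
  refine (NNReal.rpow_sum_le_const_mul_sum_rpow s f hp).trans ?_
  have : (0 : ℝ) ≤ p - 1 := by linarith
  gcongr

open Classical in
/-- The weight at `i` is the sum of the weights at the related `j`. -/
noncomputable def transferWeight (Y : Finset κ) (r : ι → κ → Prop) (ρ : κ → ℝ≥0) (i : ι) : ℝ≥0 :=
  ∑ j ∈ Y with r i j, ρ j

-- Hölder's inequality on at most `N` terms costs `N ^ (p - 1)`, and after exchanging the sums every
-- `ρ j ^ p` is counted at most `N` times.
open Classical in
theorem weightMass_transferWeight_le {p : ℝ} (hp : 1 ≤ p) {X : Finset ι} {Y : Finset κ}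
    {r : ι → κ → Prop} {N : ℕ} (h₁ : ∀ i ∈ X, (Y.filter fun j => r i j).card ≤ N)
    (h₂ : ∀ j ∈ Y, (X.filter fun i => r i j).card ≤ N) (ρ : κ → ℝ≥0) :
    weightMass p X (transferWeight Y r ρ) ≤ (N : ℝ≥0) ^ p * weightMass p Y ρ := by
  unfold weightMass transferWeight
  -- Splitting `N ^ p` as `N ^ (p - 1) * N` needs `N ≠ 0`; for `N = 0` all transferred weights
  -- vanish.
  rcases Nat.eq_zero_or_pos N with rfl | hN
  · refine le_trans (le_of_eq (Finset.sum_eq_zero fun i hi => ?_)) bot_le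
    have := h₁ i hi
    rw [Nat.le_zero, Finset.card_eq_zero] at this
    rw [this, Finset.sum_empty, NNReal.zero_rpow (by linarith)]
  calc ∑ i ∈ X, (∑ j ∈ Y with r i j, ρ j) ^ p
      ≤ ∑ i ∈ X, (N : ℝ≥0) ^ (p - 1) * ∑ j ∈ Y with r i j, ρ j ^ p :=
        Finset.sum_le_sum fun i hi => sum_rpow_le_card_mul hp _ _ (h₁ i hi)
    _ = (N : ℝ≥0) ^ (p - 1) * ∑ j ∈ Y, ∑ i ∈ X with r i j, ρ j ^ p := by
        rw [← Finset.mul_sum]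
        congr 1
        simp only [Finset.sum_filter]
        exact Finset.sum_comm
    _ ≤ (N : ℝ≥0) ^ (p - 1) * ∑ j ∈ Y, (N : ℝ≥0) * ρ j ^ p := by
        gcongr with j hj
        rw [Finset.sum_const, nsmul_eq_mul]
        gcongr
        exact h₂ j hj
    _ = (N : ℝ≥0) ^ p * ∑ j ∈ Y, ρ j ^ p := by
        rw [← Finset.mul_sum, ← mul_assoc]
        congr 1
        have h0 : (N : ℝ≥0) ≠ 0 := by positivity
        nth_rewrite 2 [← NNReal.rpow_one (N : ℝ≥0)]
        rw [← NNReal.rpow_add h0]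
        ring_nf

open Classical in
theorem sum_le_sum_transferWeight {H : Finset ι} {Y H' : Finset κ} {r : ι → κ → Prop}
    (ρ : κ → ℝ≥0) (hH' : H' ⊆ Y) (h : ∀ j ∈ H', ∃ i ∈ H, r i j) :
    ∑ j ∈ H', ρ j ≤ ∑ i ∈ H, transferWeight Y r ρ i := by
  calc ∑ j ∈ H', ρ j ≤ ∑ j ∈ H', ∑ i ∈ H with r i j, ρ j := by
        refine Finset.sum_le_sum fun j hj => ?_
        obtain ⟨i, hi, hr⟩ := h j hj
        exact Finset.single_le_sum (f := fun _ => ρ j) (fun _ _ => bot_le)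
          (Finset.mem_filter.2 ⟨hi, hr⟩)
    _ = ∑ i ∈ H, ∑ j ∈ H' with r i j, ρ j := by
        simp only [Finset.sum_filter]
        exact Finset.sum_comm
    _ ≤ ∑ i ∈ H, transferWeight Y r ρ i := by
        refine Finset.sum_le_sum fun i _ => Finset.sum_le_sum_of_subset ?_
        exact Finset.filter_subset_filter _ hH'

/-- Carries admissibility from one family to another: the weight of each set hit by `γ'` is counted
in some set hit by `γ`. The two curves may live in different spaces, which is needed for folding. -/
theorem weightLength_le_transferWeight {V' : Type*} {X : Finset ι} {Y : Finset κ} {C : ι → Set V}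
    {D : κ → Set V'} {r : ι → κ → Prop} (ρ : κ → ℝ≥0) {γ : Set V} {γ' : Set V'}
    (h : ∀ j ∈ Y, (D j ∩ γ').Nonempty → ∃ i ∈ X, (C i ∩ γ).Nonempty ∧ r i j) :
    weightLength Y D ρ γ' ≤ weightLength X C (transferWeight Y r ρ) γ := by
  classical
  refine sum_le_sum_transferWeight ρ (Finset.filter_subset _ _) fun j hj => ?_
  rw [Finset.mem_filter] at hj
  obtain ⟨i, hi, hi', hr⟩ := h j hj.1 hj.2
  exact ⟨i, Finset.mem_filter.2 ⟨hi, hi'⟩, hr⟩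

end Weights

/-! ### Ternary digits of reals and integers. -/

section Digits

/-- The reals with a ternary digit `1` in position `k`, in the open sense. -/
def middleThirds (k : ℕ) : Set ℝ :=
  {t | ∃ a : ℤ, (3 * a + 1 : ℝ) < 3 ^ (k + 1) * t ∧ 3 ^ (k + 1) * t < 3 * a + 2}

theorem isOpen_middleThirds (k : ℕ) : IsOpen (middleThirds k) := by
  have : middleThirds k = ⋃ a : ℤ, (fun t : ℝ => 3 ^ (k + 1) * t) ⁻¹'
      Set.Ioo (3 * a + 1 : ℝ) (3 * a + 2) := by
    ext t
    simp only [middleThirds, Set.mem_iUnion, Set.mem_preimage, Set.mem_Ioo, Set.mem_ofPred_eq]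
  rw [this]
  exact isOpen_iUnion fun a => isOpen_Ioo.preimage (by fun_prop)

theorem mem_middleThirds_add (k j : ℕ) (t : ℝ) :
    t ∈ middleThirds (j + k) ↔ 3 ^ j * t ∈ middleThirds k := by
  simp only [middleThirds, Set.mem_ofPred_eq]
  have : (3 : ℝ) ^ (j + k + 1) * t = 3 ^ (k + 1) * (3 ^ j * t) := by ring
  rw [this]

theorem add_int_mem_middleThirds {k : ℕ} {t : ℝ} (c : ℤ) (h : t ∈ middleThirds k) :
    t + c ∈ middleThirds k := by
  obtain ⟨a, h₁, h₂⟩ := h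
  refine ⟨a + 3 ^ k * c, ?_, ?_⟩ <;> push_cast <;> ring_nf at h₁ h₂ ⊢ <;> linarith

theorem neg_mem_middleThirds {k : ℕ} {t : ℝ} (h : t ∈ middleThirds k) : -t ∈ middleThirds k := by
  obtain ⟨a, h₁, h₂⟩ := h
  refine ⟨-a - 1, ?_, ?_⟩ <;> push_cast <;> linarith

theorem add_int_mem_middleThirds_iff {k : ℕ} {t : ℝ} (c : ℤ) :
    t + c ∈ middleThirds k ↔ t ∈ middleThirds k := by
  refine ⟨fun h => ?_, add_int_mem_middleThirds c⟩
  simpa using add_int_mem_middleThirds (-c) h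

theorem int_sub_mem_middleThirds_iff {k : ℕ} {t : ℝ} (c : ℤ) :
    c - t ∈ middleThirds k ↔ t ∈ middleThirds k := by
  rw [sub_eq_neg_add, add_int_mem_middleThirds_iff]
  exact ⟨fun h => by simpa using neg_mem_middleThirds h, neg_mem_middleThirds⟩

/-- In base three `1 / 4` is `0.020202…`; in terms of integers, `3 ^ (k + 1)` is `3` or `9` modulo
`12`. -/
theorem quarter_notMem_middleThirds (k : ℕ) : (1 / 4 : ℝ) ∉ middleThirds k := by
  rintro ⟨a, h₁, h₂⟩
  have key : ∃ b : ℤ, (3 : ℤ) ^ (k + 1) = 12 * b + 3 ∨ (3 : ℤ) ^ (k + 1) = 12 * b + 9 := by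
    clear h₁ h₂
    induction k with
    | zero => exact ⟨0, by simp⟩
    | succ k ih =>
      obtain ⟨b, h | h⟩ := ih
      · exact ⟨3 * b, by rw [pow_succ, h]; omega⟩
      · exact ⟨3 * b + 2, by rw [pow_succ, h]; omega⟩
  have h₁' : 4 * (3 * a + 1) < (3 : ℤ) ^ (k + 1) := by
    have : (4 * (3 * a + 1) : ℝ) < 3 ^ (k + 1) := by linarith
    exact_mod_cast this
  have h₂' : (3 : ℤ) ^ (k + 1) < 4 * (3 * a + 2) := by
    have : (3 : ℝ) ^ (k + 1) < 4 * (3 * a + 2) := by linarith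
    exact_mod_cast this
  omega

/-- The `k`-th ternary digit of an integer, counted from the lowest one. -/
def digit (k : ℕ) (a : ℤ) : ℤ := a / 3 ^ k % 3

/-- Adding `1` turns a tail of digits `2` into digits `0`, raises one digit, from `0` to `1` or from
`1` to `2`, and leaves the higher ones alone. So only one position can gain or lose a digit `1`.
This allows choosing, of two adjacent addresses, the one with fewer digits `1`. -/
theorem digit_succ_nested (a : ℤ) :
    (∀ k, digit k a = 1 → digit k (a + 1) = 1) ∨ (∀ k, digit k (a + 1) = 1 → digit k a = 1) := by
  -- For `a = -1` the carry never ends; all its digits are `2`.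
  by_cases ha : a + 1 = 0
  · left
    obtain rfl : a = -1 := by omega
    intro k hk
    exfalso
    unfold digit at hk
    have : (-1 : ℤ) / 3 ^ k = -1 := by
      rw [Int.ediv_eq_iff_of_pos (by positivity)]
      have : (1 : ℤ) ≤ 3 ^ k := one_le_pow₀ (by norm_num)
      constructor <;> linarith
    rw [this] at hk
    omega
  -- the carry goes up to position `e`
  obtain ⟨e, c, hc, hec⟩ : ∃ (e : ℕ) (c : ℤ), ¬ (3 : ℤ) ∣ c ∧ a + 1 = 3 ^ e * c := by
    have hfin : FiniteMultiplicity (3 : ℤ) (a + 1) :=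
      Int.finiteMultiplicity_iff.2 ⟨by norm_num, ha⟩
    obtain ⟨c, h₁, h₂⟩ := hfin.exists_eq_pow_mul_and_not_dvd
    exact ⟨_, c, h₂, h₁⟩
  have hlow : ∀ k, k < e → digit k (a + 1) = 0 ∧ digit k a = 2 := by
    intro k hk
    obtain ⟨d, rfl⟩ : ∃ d, e = k + 1 + d := ⟨e - (k + 1), by omega⟩
    have h1 : a + 1 = 3 ^ k * (3 * (3 ^ d * c)) := by rw [hec]; ring
    have h3 : (0 : ℤ) < 3 ^ k := by positivity
    have h2 : a / 3 ^ k = 3 * (3 ^ d * c) - 1 := by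
      rw [Int.ediv_eq_iff_of_pos h3]
      constructor <;> nlinarith
    unfold digit
    rw [h2, h1, Int.mul_ediv_cancel_left _ h3.ne']
    omega
  have hhigh : ∀ k, e < k → digit k (a + 1) = digit k a := by
    intro k hk
    obtain ⟨d, rfl⟩ : ∃ d, k = e + 1 + d := ⟨k - (e + 1), by omega⟩
    have h3 : (0 : ℤ) < 3 ^ (e + 1 + d) := by positivity
    have : a / 3 ^ (e + 1 + d) = (a + 1) / 3 ^ (e + 1 + d) := by
      rw [Int.ediv_eq_iff_of_pos h3]
      have hm := Int.emod_add_mul_ediv (a + 1) (3 ^ (e + 1 + d))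
      have hp := Int.emod_nonneg (a + 1) h3.ne'
      have hl := Int.emod_lt_of_pos (a + 1) h3
      have hne : (a + 1) % 3 ^ (e + 1 + d) ≠ 0 := by
        intro h0
        apply hc
        have hd := Int.dvd_of_emod_eq_zero h0
        rw [hec, add_assoc, pow_add] at hd
        have := Int.dvd_of_mul_dvd_mul_left (by positivity) hd
        exact (dvd_pow_self 3 (by omega)).trans this
      have : 0 < (a + 1) % 3 ^ (e + 1 + d) := by omega
      constructor <;> nlinarith
    unfold digit
    rw [this]
  have hmid : digit e (a + 1) = c % 3 ∧ digit e a = (c - 1) % 3 := by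
    have h3 : (0 : ℤ) < 3 ^ e := by positivity
    have h2 : a / 3 ^ e = c - 1 := by
      rw [Int.ediv_eq_iff_of_pos h3]
      constructor <;> nlinarith
    unfold digit
    rw [h2, hec, Int.mul_ediv_cancel_left _ h3.ne']
    exact ⟨rfl, rfl⟩
  by_cases h : digit e a = 1
  · right
    intro k hk
    rcases lt_trichotomy k e with h' | rfl | h'
    · have := hlow k h'; omega
    · exact h
    · rw [← hhigh k h']; exact hk
  · left
    intro k hk
    rcases lt_trichotomy k e with h' | rfl | h'
    · have := hlow k h'; omega
    · exact absurd hk h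
    · rw [hhigh k h']; exact hk

/-- On level `k + 1 + j`, position `k` after the ternary point is the digit `j` counted from the
bottom of the address. Closed bounds are enough because the middle thirds are open. -/
theorem digit_eq_one_of_mem {a : ℤ} {t : ℝ} {j k : ℕ} (h₁ : a ≤ 3 ^ (k + 1 + j) * t)
    (h₂ : 3 ^ (k + 1 + j) * t ≤ a + 1) (ht : t ∈ middleThirds k) : digit j a = 1 := by
  obtain ⟨b, hb₁, hb₂⟩ := ht
  have h3 : (0 : ℝ) < 3 ^ j := by positivity
  rw [pow_add, mul_right_comm] at h₁ h₂
  have e₁ : (3 * b + 1) * 3 ^ j < a + 1 := by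
    have : ((3 * b + 1) * 3 ^ j : ℝ) < a + 1 := by nlinarith
    exact_mod_cast this
  have e₂ : a < (3 * b + 2) * 3 ^ j := by
    have : (a : ℝ) < (3 * b + 2) * 3 ^ j := by nlinarith
    exact_mod_cast this
  have : a / 3 ^ j = 3 * b + 1 := by
    rw [Int.ediv_eq_iff_of_pos (by positivity)]
    constructor <;> nlinarith
  unfold digit; rw [this]; omega

theorem mem_of_digit_eq_one {a : ℤ} {t : ℝ} {j k : ℕ} (h₁ : a < 3 ^ (k + 1 + j) * t)
    (h₂ : 3 ^ (k + 1 + j) * t < a + 1) (hd : digit j a = 1) : t ∈ middleThirds k := by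
  unfold digit at hd
  have h3 : (0 : ℤ) < 3 ^ j := by positivity
  obtain ⟨b, hb⟩ : ∃ b, a / 3 ^ j = 3 * b + 1 := ⟨a / 3 ^ j / 3, by omega⟩
  rw [Int.ediv_eq_iff_of_pos h3] at hb
  rw [pow_add, mul_right_comm] at h₁ h₂
  have h3' : (0 : ℝ) < 3 ^ j := by positivity
  have e₁ : ((3 * b + 1) * 3 ^ j : ℝ) ≤ a := by exact_mod_cast hb.1
  have e₂ : (a + 1 : ℝ) ≤ (3 * b + 2) * 3 ^ j := by
    have : a + 1 ≤ (3 * b + 2) * 3 ^ j := by nlinarith [hb.2]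
    exact_mod_cast this
  exact ⟨b, by nlinarith, by nlinarith⟩

/-- A grid point can be an endpoint of a middle third, so one adjacent interval with digit `1`
proves nothing; with digit `1` on both sides the point is interior. -/
theorem mem_of_digit_eq_one_both {c : ℤ} {t : ℝ} {j k : ℕ} (h : 3 ^ (k + 1 + j) * t = c)
    (hd : digit j (c - 1) = 1) (hd' : digit j c = 1) : t ∈ middleThirds k := by
  unfold digit at hd hd'
  have h3 : (0 : ℤ) < 3 ^ j := by positivity
  obtain ⟨b, hb⟩ : ∃ b, (c - 1) / 3 ^ j = 3 * b + 1 := ⟨(c - 1) / 3 ^ j / 3, by omega⟩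
  have hle : (c - 1) / 3 ^ j ≤ c / 3 ^ j := Int.ediv_le_ediv h3 (by omega)
  have hle' : c / 3 ^ j ≤ (c - 1) / 3 ^ j + 1 := by
    have : c / 3 ^ j ≤ (c - 1 + 3 ^ j * 1) / 3 ^ j := Int.ediv_le_ediv h3 (by omega)
    rwa [Int.add_mul_ediv_left _ _ h3.ne'] at this
  have hb' : c / 3 ^ j = 3 * b + 1 := by omega
  rw [Int.ediv_eq_iff_of_pos h3] at hb hb'
  rw [pow_add, mul_right_comm] at h
  have h3' : (0 : ℝ) < 3 ^ j := by positivity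
  have e₁ : ((3 * b + 1) * 3 ^ j : ℝ) < c := by
    have : (3 * b + 1) * 3 ^ j < c := by nlinarith [hb.1]
    exact_mod_cast this
  have e₂ : (c : ℝ) < (3 * b + 2) * 3 ^ j := by
    have : c < (3 * b + 2) * 3 ^ j := by nlinarith [hb'.2]
    exact_mod_cast this
  exact ⟨b, by nlinarith, by nlinarith⟩

/-- The floor works unless `3 ^ m * t` is an integer. Then `t` borders two intervals, and the one
whose digits `1` are also digits `1` of the other is taken, so that each of them is a genuine digit
of `t`. At `t = 0` and `t = 1` the choice is forced, and the address has no digit `1`. -/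
theorem exists_interval_digits {t : ℝ} (h₀ : 0 ≤ t) (h₁ : t ≤ 1) (m : ℕ) :
    ∃ a : ℤ, 0 ≤ a ∧ a < 3 ^ m ∧ a ≤ 3 ^ m * t ∧ 3 ^ m * t ≤ a + 1 ∧
      ∀ j k, m = k + 1 + j → digit j a = 1 → t ∈ middleThirds k := by
  have h3 : (0 : ℝ) < 3 ^ m := by positivity
  have hz : (1 : ℤ) ≤ 3 ^ m := one_le_pow₀ (by norm_num)
  have hfl := Int.floor_le (3 ^ m * t)
  have hlt := Int.lt_floor_add_one (3 ^ m * t)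
  have hf0 : 0 ≤ ⌊3 ^ m * t⌋ := Int.floor_nonneg.2 (by positivity)
  have hf1 : ⌊3 ^ m * t⌋ ≤ 3 ^ m := by
    have : (⌊3 ^ m * t⌋ : ℝ) ≤ 3 ^ m := by nlinarith
    exact_mod_cast this
  generalize hc : ⌊3 ^ m * t⌋ = c at *
  by_cases hne : (c : ℝ) = 3 ^ m * t
  · have hboth : ∀ j k, m = k + 1 + j → digit j (c - 1) = 1 → digit j c = 1 →
        t ∈ middleThirds k := by
      rintro j k rfl h h'
      exact mem_of_digit_eq_one_both hne.symm h h'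
    have hn := digit_succ_nested (c - 1)
    rw [sub_add_cancel] at hn
    have hsmall : ∀ j, digit j (0 : ℤ) ≠ 1 := by intro j; simp [digit]
    rcases eq_or_lt_of_le hf0 with h0 | h0
    · subst h0
      exact ⟨0, le_rfl, by omega, by simpa using hfl, by rw [← hne]; simp, fun j k _ hd => absurd hd (hsmall j)⟩
    rcases eq_or_lt_of_le hf1 with hm | hm
    · refine ⟨c - 1, by omega, by omega, by push_cast; linarith, by push_cast; linarith, ?_⟩
      rintro j k rfl hd
      exfalso
      have : (c - 1) / 3 ^ j = 3 ^ (k + 1) - 1 := by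
        rw [Int.ediv_eq_iff_of_pos (by positivity), hm]
        have : (1 : ℤ) ≤ 3 ^ j := one_le_pow₀ (by norm_num)
        constructor <;> ring_nf <;> omega
      unfold digit at hd
      rw [this, pow_succ] at hd
      omega
    · rcases hn with hn | hn
      · exact ⟨c - 1, by omega, by omega, by push_cast; linarith, by push_cast; linarith,
          fun j k hm hd => hboth j k hm hd (hn j hd)⟩
      · exact ⟨c, by omega, by omega, by linarith, by linarith,
          fun j k hm hd => hboth j k hm (hn j hd) hd⟩
  · have hlt' : (c : ℝ) < 3 ^ m * t := lt_of_le_of_ne hfl hne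
    refine ⟨c, hf0, ?_, hfl, hlt.le, ?_⟩
    · have : (c : ℝ) < 3 ^ m := by nlinarith
      exact_mod_cast this
    · rintro j k rfl hd
      exact mem_of_digit_eq_one hlt' hlt hd

end Digits

/-! ### The sponge, its cells and their addresses. -/

section Sponge

/-- The `n`-dimensional sponge: no two coordinates of a point have a ternary digit `1` in the same
position. For `n = 2` this is the carpet, for `n = 3` the Menger sponge. -/
def sponge (n : ℕ) : Set (Fin n → ℝ) :=
  {x | (∀ i, x i ∈ Set.Icc (0 : ℝ) 1) ∧
    ∀ i j, i ≠ j → ∀ k, ¬(x i ∈ middleThirds k ∧ x j ∈ middleThirds k)}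

variable {n : ℕ}

theorem isClosed_sponge : IsClosed (sponge n) := by
  have : sponge n = (⋂ i, (fun x : Fin n → ℝ => x i) ⁻¹' Set.Icc 0 1) ∩
      ⋂ (i) (j) (_ : i ≠ j) (k), ((fun x : Fin n → ℝ => x i) ⁻¹' middleThirds k ∩
        (fun x : Fin n → ℝ => x j) ⁻¹' middleThirds k)ᶜ := by
    ext x
    simp only [sponge, Set.mem_ofPred_eq, Set.mem_inter_iff, Set.mem_iInter, Set.mem_preimage,
      Set.mem_compl_iff]
  rw [this]
  refine IsClosed.inter (isClosed_iInter fun i => isClosed_Icc.preimage (continuous_apply i)) ?_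
  refine isClosed_iInter fun i => isClosed_iInter fun j => isClosed_iInter fun _ =>
    isClosed_iInter fun k => ?_
  exact (((isOpen_middleThirds k).preimage (continuous_apply i)).inter
    ((isOpen_middleThirds k).preimage (continuous_apply j))).isClosed_compl

theorem isCompact_sponge : IsCompact (sponge n) :=
  (isCompact_univ_pi fun _ => isCompact_Icc).of_isClosed_subset isClosed_sponge
    fun _ hx i _ => hx.1 i

/-- The addresses of the cubes of side `3 ^ (-m)` in the construction of the sponge. -/
def IsCell (m : ℕ) (q : Fin n → ℤ) : Prop :=
  (∀ i, 0 ≤ q i ∧ q i < 3 ^ m) ∧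
    ∀ i j, i ≠ j → ∀ k < m, ¬(digit k (q i) = 1 ∧ digit k (q j) = 1)

open Classical in
variable (n) in
/-- The finite set of addresses of the cubes of side `3 ^ (-m)`. -/
noncomputable def cells (m : ℕ) : Finset (Fin n → ℤ) :=
  (Fintype.piFinset fun _ => Finset.Ico 0 (3 ^ m)).filter (IsCell m)

theorem mem_cells {m : ℕ} {q : Fin n → ℤ} : q ∈ cells n m ↔ IsCell m q := by
  simp only [cells, Finset.mem_filter, Fintype.mem_piFinset, Finset.mem_Ico, and_iff_right_iff_imp]
  exact fun h => h.1

theorem card_cells_le (m : ℕ) : (cells n m).card ≤ 3 ^ (m * n) := by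
  classical
  refine (Finset.card_filter_le _ _).trans ?_
  have : ((3 : ℤ) ^ m).toNat = 3 ^ m := by
    rw [show (3 : ℤ) ^ m = ((3 ^ m : ℕ) : ℤ) by push_cast; rfl, Int.toNat_natCast]
  simp [Fintype.card_piFinset, pow_mul, this]

/-- The closed cube of side `3 ^ (-m)` with address `q`. -/
def box (m : ℕ) (q : Fin n → ℤ) : Set (Fin n → ℝ) :=
  {x | ∀ i, (q i : ℝ) ≤ 3 ^ m * x i ∧ 3 ^ m * x i ≤ q i + 1}

theorem isClosed_box (m : ℕ) (q : Fin n → ℤ) : IsClosed (box m q) := by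
  have : box m q = ⋂ i, (fun x : Fin n → ℝ => 3 ^ m * x i) ⁻¹' Set.Icc (q i : ℝ) (q i + 1) := by
    ext x; simp [box]
  rw [this]
  exact isClosed_iInter fun i => isClosed_Icc.preimage (by fun_prop)

/-- The addresses `q` and `q'` differ by at most `r` in each coordinate. -/
def Near (r : ℤ) (q q' : Fin n → ℤ) : Prop := ∀ i, |q i - q' i| ≤ r

theorem Near.symm {r : ℤ} {q q' : Fin n → ℤ} (h : Near r q q') : Near r q' q :=
  fun i => by rw [abs_sub_comm]; exact h i

theorem Near.trans {r s : ℤ} {q q' q'' : Fin n → ℤ} (h : Near r q q') (h' : Near s q' q'') :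
    Near (r + s) q q'' :=
  fun i => by have := abs_sub_le (q i) (q' i) (q'' i); linarith [h i, h' i]

theorem Near.mono {r s : ℤ} {q q' : Fin n → ℤ} (h : Near r q q') (hrs : r ≤ s) : Near s q q' :=
  fun i => (h i).trans hrs

theorem near_self {r : ℤ} (hr : 0 ≤ r) (q : Fin n → ℤ) : Near r q q := fun i => by simpa using hr

theorem near_of_mem_box {m : ℕ} {q q' : Fin n → ℤ} {x y : Fin n → ℝ} (hx : x ∈ box m q)
    (hy : y ∈ box m q') {r : ℤ} (h : ∀ i, 3 ^ m * |x i - y i| < r) : Near r q q' := by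
  intro i
  have h1 := hx i
  have h2 := hy i
  have h3 := h i
  have hp : (0 : ℝ) < 3 ^ m := by positivity
  have h4 : |3 ^ m * x i - 3 ^ m * y i| < r := by
    rw [← mul_sub, abs_mul, abs_of_pos hp]; exact h3
  rw [abs_lt] at h4
  have a1 : ((q i - q' i : ℤ) : ℝ) < ((r + 1 : ℤ) : ℝ) := by push_cast; linarith
  have a2 : ((q' i - q i : ℤ) : ℝ) < ((r + 1 : ℤ) : ℝ) := by push_cast; linarith
  have a1' : q i - q' i < r + 1 := by exact_mod_cast a1
  have a2' : q' i - q i < r + 1 := by exact_mod_cast a2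
  rw [abs_le]
  constructor <;> omega

theorem near_one_of_mem_box {m : ℕ} {q q' : Fin n → ℤ} {x : Fin n → ℝ} (hx : x ∈ box m q)
    (hx' : x ∈ box m q') : Near 1 q q' :=
  near_of_mem_box hx hx' fun i => by simp

theorem abs_sub_le_of_mem_box {m : ℕ} {q q' : Fin n → ℤ} {r : ℤ} (h : Near r q q')
    {x y : Fin n → ℝ} (hx : x ∈ box m q) (hy : y ∈ box m q') (i : Fin n) :
    3 ^ m * |x i - y i| ≤ r + 1 := by
  have hp : (0 : ℝ) < 3 ^ m := by positivity
  have h1 := hx i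
  have h2 := hy i
  have h3 : |(q i : ℝ) - q' i| ≤ r := by exact_mod_cast h i
  rw [← abs_of_pos hp, ← abs_mul, mul_sub, abs_le]
  rw [abs_le] at h3
  constructor <;> linarith

open Classical in
theorem card_near_le (s : Finset (Fin n → ℤ)) (q : Fin n → ℤ) (r : ℕ) :
    (s.filter fun q' => Near r q' q).card ≤ (2 * r + 1) ^ n := by
  have : (s.filter fun q' => Near r q' q) ⊆
      Fintype.piFinset fun i => Finset.Icc (q i - r) (q i + r) := by
    intro q' hq'
    rw [Finset.mem_filter] at hq'
    rw [Fintype.mem_piFinset]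
    intro i
    have := abs_le.1 (hq'.2 i)
    rw [Finset.mem_Icc]
    constructor <;> omega
  refine (Finset.card_le_card this).trans ?_
  rw [Fintype.card_piFinset]
  have : ∀ i, (Finset.Icc (q i - r) (q i + r)).card = 2 * r + 1 := by
    intro i; rw [Int.card_Icc]; omega
  simp [this]

/-- Chooses in each coordinate an address without superfluous digits `1`; a forbidden pair of digits
would then be a forbidden pair for the point itself. -/
theorem exists_mem_box {x : Fin n → ℝ} (hx : x ∈ sponge n) (m : ℕ) :
    ∃ q ∈ cells n m, x ∈ box m q := by
  choose a h₁ h₂ h₃ h₄ h₅ using fun i => exists_interval_digits (hx.1 i).1 (hx.1 i).2 m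
  refine ⟨a, mem_cells.2 ⟨fun i => ⟨h₁ i, h₂ i⟩, fun i j hij k hk hd => ?_⟩,
    fun i => ⟨h₃ i, h₄ i⟩⟩
  have hm : m = (m - 1 - k) + 1 + k := by omega
  exact hx.2 i j hij (m - 1 - k) ⟨h₅ i k _ hm hd.1, h₅ j k _ hm hd.2⟩

/-- A cube whose interior contains a point of the sponge is one of the cubes of the construction. -/
theorem mem_cells_of_interior {m : ℕ} {q : Fin n → ℤ} {x : Fin n → ℝ} (hx : x ∈ sponge n)
    (h : ∀ i, (q i : ℝ) < 3 ^ m * x i ∧ 3 ^ m * x i < q i + 1) : q ∈ cells n m := by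
  have hp : (0 : ℝ) < 3 ^ m := by positivity
  refine mem_cells.2 ⟨fun i => ⟨?_, ?_⟩, fun i j hij k hk hd => ?_⟩
  · have h1 := h i
    have h2 := (hx.1 i).1
    have : ((-1 : ℤ) : ℝ) < q i := by push_cast; nlinarith
    have : -1 < q i := by exact_mod_cast this
    omega
  · have h1 := h i
    have h2 := (hx.1 i).2
    have : (q i : ℝ) < 3 ^ m := by nlinarith
    exact_mod_cast this
  · obtain ⟨l, rfl⟩ : ∃ l, m = l + 1 + k := ⟨m - 1 - k, by omega⟩
    exact hx.2 i j hij l ⟨mem_of_digit_eq_one (h i).1 (h i).2 hd.1,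
      mem_of_digit_eq_one (h j).1 (h j).2 hd.2⟩

/-- The first `m` ternary positions are governed by the address, the later ones by the rescaled
coordinates. -/
theorem sponge_of_cell {m : ℕ} {q : Fin n → ℤ} {x : Fin n → ℝ} (hq : q ∈ cells n m)
    (hx : x ∈ box m q)
    (h : ∀ i j, i ≠ j → ∀ k, ¬(3 ^ m * x i ∈ middleThirds k ∧ 3 ^ m * x j ∈ middleThirds k)) :
    x ∈ sponge n := by
  have hp : (0 : ℝ) < 3 ^ m := by positivity
  rw [mem_cells] at hq
  refine ⟨fun i => ?_, fun i j hij k => ?_⟩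
  · have h1 := hx i
    have h2 : (0 : ℝ) ≤ q i := by exact_mod_cast (hq.1 i).1
    have h3 : (q i + 1 : ℝ) ≤ 3 ^ m := by exact_mod_cast (hq.1 i).2
    constructor
    · by_contra hneg
      push Not at hneg
      nlinarith
    · by_contra hneg
      push Not at hneg
      nlinarith
  · rcases lt_or_ge k m with hk | hk
    · obtain ⟨l, rfl⟩ : ∃ l, m = k + 1 + l := ⟨m - 1 - k, by omega⟩
      rintro ⟨hi, hj⟩
      exact hq.2 i j hij l (by omega) ⟨digit_eq_one_of_mem (hx i).1 (hx i).2 hi,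
        digit_eq_one_of_mem (hx j).1 (hx j).2 hj⟩
    · obtain ⟨l, rfl⟩ : ∃ l, k = m + l := ⟨k - m, by omega⟩
      rw [mem_middleThirds_add, mem_middleThirds_add]
      exact h i j hij l

/-- An interior point of the cube with address `q`, with no ternary digit `1` beyond `q`. -/
noncomputable def innerPoint (m : ℕ) (q : Fin n → ℤ) : Fin n → ℝ :=
  fun i => (q i + 1 / 4) / 3 ^ m

theorem mul_innerPoint (m : ℕ) (q : Fin n → ℤ) (i : Fin n) :
    3 ^ m * innerPoint m q i = q i + 1 / 4 := by
  unfold innerPoint; field_simp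

theorem innerPoint_interior (m : ℕ) (q : Fin n → ℤ) (i : Fin n) :
    (q i : ℝ) < 3 ^ m * innerPoint m q i ∧ 3 ^ m * innerPoint m q i < q i + 1 := by
  rw [mul_innerPoint]; constructor <;> linarith

theorem innerPoint_mem_box (m : ℕ) (q : Fin n → ℤ) : innerPoint m q ∈ box m q :=
  fun i => ⟨(innerPoint_interior m q i).1.le, (innerPoint_interior m q i).2.le⟩

theorem innerPoint_mem {m : ℕ} {q : Fin n → ℤ} (hq : q ∈ cells n m) :
    innerPoint m q ∈ sponge n := by
  refine sponge_of_cell hq (innerPoint_mem_box m q) fun i j _ k h => ?_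
  rw [mul_innerPoint, add_comm, add_int_mem_middleThirds_iff] at h
  exact quarter_notMem_middleThirds k h.1

end Sponge

/-! ### Folding cells onto the unit cube, on points and on addresses. -/

section Folding

variable {n : ℕ}

/-- The triangle wave: the distance to the nearest even integer. -/
noncomputable def triangleWave (t : ℝ) : ℝ := Real.arccos (Real.cos (Real.pi * t)) / Real.pi

theorem continuous_triangleWave : Continuous triangleWave :=
  (Real.continuous_arccos.comp (Real.continuous_cos.comp (by fun_prop))).div_const _

theorem triangleWave_eq {t : ℝ} {c : ℤ} (h₁ : c ≤ t) (h₂ : t ≤ c + 1) :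
    triangleWave t = if Even c then t - c else c + 1 - t := by
  have hpi := Real.pi_pos
  unfold triangleWave
  split_ifs with hc
  · obtain ⟨d, rfl⟩ := hc
    have : Real.cos (Real.pi * t) = Real.cos (Real.pi * (t - (d + d : ℤ))) := by
      rw [show Real.pi * (t - (d + d : ℤ)) = Real.pi * t - d * (2 * Real.pi) by push_cast; ring,
        Real.cos_sub_int_mul_two_pi]
    rw [this, Real.arccos_cos (by nlinarith) (by nlinarith)]
    field_simp
  · obtain ⟨d, rfl⟩ := Int.not_even_iff_odd.1 hc
    have : Real.cos (Real.pi * t) = Real.cos (Real.pi * ((2 * d + 1 : ℤ) + 1 - t)) := by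
      rw [show Real.pi * ((2 * d + 1 : ℤ) + 1 - t) = ((d + 1 : ℤ) : ℝ) * (2 * Real.pi) - Real.pi * t
        by push_cast; ring, Real.cos_int_mul_two_pi_sub]
    rw [this, Real.arccos_cos (by nlinarith) (by nlinarith)]
    field_simp

theorem triangleWave_mem_Icc (t : ℝ) : triangleWave t ∈ Set.Icc (0 : ℝ) 1 := by
  have h1 := Int.floor_le t
  have h2 := (Int.lt_floor_add_one t).le
  rw [triangleWave_eq h1 h2]
  split_ifs <;> constructor <;> linarith

/-- On each unit interval the wave is an integer translation or a reflection `c - t`, and both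
preserve the middle thirds. This is why folding respects the sponge. -/
theorem triangleWave_mem_middleThirds {t : ℝ} {k : ℕ} :
    triangleWave t ∈ middleThirds k ↔ t ∈ middleThirds k := by
  have h1 := Int.floor_le t
  have h2 := (Int.lt_floor_add_one t).le
  rw [triangleWave_eq h1 h2]
  split_ifs
  · have := add_int_mem_middleThirds_iff (k := k) (t := t) (-⌊t⌋)
    rwa [Int.cast_neg, ← sub_eq_add_neg] at this
  · have := int_sub_mem_middleThirds_iff (k := k) (t := t) (⌊t⌋ + 1)
    rwa [Int.cast_add, Int.cast_one] at this

/-- The map that folds all cubes of side `3 ^ (-j)` onto the unit cube. -/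
noncomputable def fold (j : ℕ) (x : Fin n → ℝ) : Fin n → ℝ := fun i => triangleWave (3 ^ j * x i)

theorem continuous_fold (j : ℕ) : Continuous (fold (n := n) j) :=
  continuous_pi fun i => continuous_triangleWave.comp (by fun_prop)

theorem fold_mem {j : ℕ} {x : Fin n → ℝ} (hx : x ∈ sponge n) : fold j x ∈ sponge n := by
  refine ⟨fun i => triangleWave_mem_Icc _, fun i i' hi k => ?_⟩
  simp only [fold, triangleWave_mem_middleThirds, ← mem_middleThirds_add]
  exact hx.2 i i' hi _

/-- The section of `fold j` over the cube with address `q`. -/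
noncomputable def unfold (j : ℕ) (q : Fin n → ℤ) (y : Fin n → ℝ) : Fin n → ℝ :=
  fun i => (q i + if Even (q i) then y i else 1 - y i) / 3 ^ j

theorem mul_unfold (j : ℕ) (q : Fin n → ℤ) (y : Fin n → ℝ) (i : Fin n) :
    3 ^ j * unfold j q y i = q i + if Even (q i) then y i else 1 - y i := by
  unfold CombLoewner.unfold; field_simp

theorem continuous_unfold (j : ℕ) (q : Fin n → ℤ) : Continuous (unfold j q) := by
  refine continuous_pi fun i => ?_
  unfold CombLoewner.unfold
  split_ifs <;> fun_prop

theorem unfold_mem_box {j : ℕ} {q : Fin n → ℤ} {y : Fin n → ℝ}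
    (hy : ∀ i, y i ∈ Set.Icc (0 : ℝ) 1) : unfold j q y ∈ box j q := by
  intro i
  have := hy i
  rw [mul_unfold]
  split_ifs <;> constructor <;> linarith [this.1, this.2]

theorem fold_unfold {j : ℕ} {q : Fin n → ℤ} {y : Fin n → ℝ}
    (hy : ∀ i, y i ∈ Set.Icc (0 : ℝ) 1) : fold j (unfold j q y) = y := by
  funext i
  have h := unfold_mem_box (j := j) (q := q) hy i
  unfold fold
  rw [triangleWave_eq h.1 h.2, mul_unfold]
  split_ifs <;> ring

theorem unfold_fold {j : ℕ} {q : Fin n → ℤ} {x : Fin n → ℝ} (hx : x ∈ box j q) :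
    unfold j q (fold j x) = x := by
  funext i
  have h := hx i
  have hp : (0 : ℝ) < 3 ^ j := by positivity
  unfold CombLoewner.unfold fold
  rw [triangleWave_eq h.1 h.2, div_eq_iff hp.ne']
  split_ifs <;> ring

theorem unfold_mem {j : ℕ} {q : Fin n → ℤ} {y : Fin n → ℝ} (hq : q ∈ cells n j)
    (hy : y ∈ sponge n) : unfold j q y ∈ sponge n := by
  refine sponge_of_cell hq (unfold_mem_box hy.1) fun i i' hi k => ?_
  rw [← triangleWave_mem_middleThirds (t := 3 ^ j * unfold j q y i),
    ← triangleWave_mem_middleThirds (t := 3 ^ j * unfold j q y i')]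
  have := fold_unfold (j := j) (q := q) hy.1
  rw [show triangleWave (3 ^ j * unfold j q y i) = y i from congrFun this i,
    show triangleWave (3 ^ j * unfold j q y i') = y i' from congrFun this i']
  exact hy.2 i i' hi k

/-- The address of the cube that contains the cube with address `R`, `l` levels up. -/
def ancestor (l : ℕ) (R : Fin n → ℤ) : Fin n → ℤ := fun i => R i / 3 ^ l

/-- The image of the address `R` under the folding map that is injective on its ancestor. -/
def foldAddr (l : ℕ) (R : Fin n → ℤ) : Fin n → ℤ :=
  fun i => if Even (R i / 3 ^ l) then R i % 3 ^ l else 3 ^ l - 1 - R i % 3 ^ l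

/-- The address with ancestor `q` that is folded to `t`. -/
def unfoldAddr (l : ℕ) (q t : Fin n → ℤ) : Fin n → ℤ :=
  fun i => 3 ^ l * q i + if Even (q i) then t i else 3 ^ l - 1 - t i

theorem unfoldAddr_foldAddr (l : ℕ) (R : Fin n → ℤ) :
    unfoldAddr l (ancestor l R) (foldAddr l R) = R := by
  funext i
  have := Int.emod_add_mul_ediv (R i) (3 ^ l)
  simp only [unfoldAddr, foldAddr, ancestor]
  split_ifs <;> linarith

theorem ancestor_unfoldAddr {l : ℕ} {q t : Fin n → ℤ} (ht : ∀ i, 0 ≤ t i ∧ t i < 3 ^ l) :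
    ancestor l (unfoldAddr l q t) = q := by
  funext i
  have h3 : (0 : ℤ) < 3 ^ l := by positivity
  have := ht i
  simp only [unfoldAddr, ancestor]
  rw [Int.ediv_eq_iff_of_pos h3]
  split_ifs <;> constructor <;> linarith

theorem foldAddr_unfoldAddr {l : ℕ} {q t : Fin n → ℤ} (ht : ∀ i, 0 ≤ t i ∧ t i < 3 ^ l) :
    foldAddr l (unfoldAddr l q t) = t := by
  funext i
  have h1 := ancestor_unfoldAddr (q := q) ht
  have h2 := congrFun (unfoldAddr_foldAddr l (unfoldAddr l q t)) i
  rw [h1] at h2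
  unfold unfoldAddr at h2 ⊢
  split_ifs at h2 <;> linarith

theorem ancestor_ancestor (l l' : ℕ) (R : Fin n → ℤ) :
    ancestor l' (ancestor l R) = ancestor (l' + l) R := by
  funext i
  simp only [ancestor]
  rw [Int.ediv_ediv_of_nonneg (by positivity), pow_add, mul_comm]

theorem Near.ancestor {l : ℕ} {r : ℤ} {q q' : Fin n → ℤ} (h : Near r q q') (hr : r ≤ 3 ^ l) :
    Near 1 (ancestor l q) (ancestor l q') := by
  intro i
  have h3 : (0 : ℤ) < 3 ^ l := by positivity
  have h1 := abs_le.1 (h i)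
  simp only [CombLoewner.ancestor]
  have a1 : q i / 3 ^ l ≤ q' i / 3 ^ l + 1 := by
    have : q i / 3 ^ l ≤ (q' i + 3 ^ l * 1) / 3 ^ l := Int.ediv_le_ediv h3 (by linarith)
    rwa [Int.add_mul_ediv_left _ _ h3.ne'] at this
  have a2 : q' i / 3 ^ l ≤ q i / 3 ^ l + 1 := by
    have : q' i / 3 ^ l ≤ (q i + 3 ^ l * 1) / 3 ^ l := Int.ediv_le_ediv h3 (by linarith)
    rwa [Int.add_mul_ediv_left _ _ h3.ne'] at this
  rw [abs_le]; constructor <;> omega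

theorem lt_ancestor (j l : ℕ) {R : Fin n → ℤ} {x : Fin n → ℝ} {i : Fin n}
    (h : (R i : ℝ) < 3 ^ (j + l) * x i ∧ 3 ^ (j + l) * x i < R i + 1) :
    (ancestor l R i : ℝ) < 3 ^ j * x i ∧ 3 ^ j * x i < ancestor l R i + 1 := by
  have h3 : (0 : ℤ) < 3 ^ l := by positivity
  have h3' : (0 : ℝ) < 3 ^ l := by positivity
  have e := (Int.ediv_eq_iff_of_pos (x := R i) (y := R i / 3 ^ l) h3).1 rfl
  rw [pow_add, mul_right_comm] at h
  have e1 : (((R i / 3 ^ l : ℤ) : ℝ) * 3 ^ l) ≤ R i := by exact_mod_cast e.1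
  have e2 : (R i : ℝ) + 1 ≤ ((R i / 3 ^ l : ℤ) : ℝ) * 3 ^ l + 3 ^ l := by exact_mod_cast e.2
  simp only [ancestor]
  constructor <;> nlinarith

theorem box_subset_box_ancestor (j l : ℕ) (R : Fin n → ℤ) :
    box (j + l) R ⊆ box j (ancestor l R) := by
  intro x hx i
  have h := hx i
  have h3 : (0 : ℤ) < 3 ^ l := by positivity
  have h3' : (0 : ℝ) < 3 ^ l := by positivity
  have e := (Int.ediv_eq_iff_of_pos (x := R i) (y := R i / 3 ^ l) h3).1 rfl
  rw [pow_add, mul_right_comm] at h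
  have e1 : (((R i / 3 ^ l : ℤ) : ℝ) * 3 ^ l) ≤ R i := by exact_mod_cast e.1
  have e2 : (R i : ℝ) + 1 ≤ ((R i / 3 ^ l : ℤ) : ℝ) * 3 ^ l + 3 ^ l := by exact_mod_cast e.2
  simp only [ancestor]
  constructor <;> nlinarith

theorem mem_box_unfoldAddr {j l : ℕ} {q t : Fin n → ℤ} {x : Fin n → ℝ} (hx : x ∈ box j q) :
    x ∈ box (j + l) (unfoldAddr l q t) ↔ fold j x ∈ box l t := by
  have h3 : (0 : ℝ) < 3 ^ l := by positivity
  refine forall_congr' fun i => ?_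
  have h := hx i
  unfold fold unfoldAddr
  rw [triangleWave_eq h.1 h.2, pow_add, mul_comm ((3 : ℝ) ^ j), mul_assoc]
  split_ifs <;> push_cast <;>
    exact ⟨fun h => by constructor <;> nlinarith [h.1, h.2],
      fun h => by constructor <;> nlinarith [h.1, h.2]⟩

/-- The open version is needed because `mem_cells_of_interior` recognizes cells only by interior
points. -/
theorem interior_unfoldAddr {j l : ℕ} {q t : Fin n → ℤ} {x : Fin n → ℝ} (hx : x ∈ box j q)
    (i : Fin n) : ((unfoldAddr l q t i : ℝ) < 3 ^ (j + l) * x i ∧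
      3 ^ (j + l) * x i < unfoldAddr l q t i + 1) ↔
      ((t i : ℝ) < 3 ^ l * fold j x i ∧ 3 ^ l * fold j x i < t i + 1) := by
  have h3 : (0 : ℝ) < 3 ^ l := by positivity
  have h := hx i
  unfold fold unfoldAddr
  rw [triangleWave_eq h.1 h.2, pow_add, mul_comm ((3 : ℝ) ^ j), mul_assoc]
  split_ifs <;> push_cast <;>
    exact ⟨fun h => by constructor <;> nlinarith [h.1, h.2],
      fun h => by constructor <;> nlinarith [h.1, h.2]⟩

/-- No digits have to be computed: `innerPoint` lies in the sponge and in the interior of the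
ancestor. The next two lemmas use the same device. -/
theorem ancestor_mem {j l : ℕ} {R : Fin n → ℤ} (hR : R ∈ cells n (j + l)) :
    ancestor l R ∈ cells n j :=
  mem_cells_of_interior (innerPoint_mem hR) fun i => lt_ancestor j l (innerPoint_interior _ R i)

theorem foldAddr_mem {j l : ℕ} {R : Fin n → ℤ} (hR : R ∈ cells n (j + l)) :
    foldAddr l R ∈ cells n l := by
  have hb := box_subset_box_ancestor j l R (innerPoint_mem_box _ R)
  refine mem_cells_of_interior (fold_mem (j := j) (innerPoint_mem hR)) fun i => ?_
  rw [← interior_unfoldAddr hb, unfoldAddr_foldAddr]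
  exact innerPoint_interior _ R i

theorem unfoldAddr_mem {j l : ℕ} {q t : Fin n → ℤ} (hq : q ∈ cells n j) (ht : t ∈ cells n l) :
    unfoldAddr l q t ∈ cells n (j + l) := by
  have hy := innerPoint_mem ht
  refine mem_cells_of_interior (unfold_mem hq hy) fun i => ?_
  rw [interior_unfoldAddr (unfold_mem_box hy.1), fold_unfold hy.1]
  exact innerPoint_interior _ t i

theorem fold_mem_box {j l : ℕ} {R : Fin n → ℤ} {x : Fin n → ℝ} (hx : x ∈ box (j + l) R) :
    fold j x ∈ box l (foldAddr l R) := by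
  rw [← mem_box_unfoldAddr (box_subset_box_ancestor j l R hx), unfoldAddr_foldAddr]
  exact hx

/-- Ancestor and folded address together determine a cell, and all pairs occur. -/
theorem sum_cells_add (j l : ℕ) (f : (Fin n → ℤ) → ℝ≥0) :
    ∑ R ∈ cells n (j + l), f R = ∑ q ∈ cells n j, ∑ t ∈ cells n l, f (unfoldAddr l q t) := by
  rw [← Finset.sum_product']
  refine Finset.sum_nbij' (fun R => (ancestor l R, foldAddr l R))
    (fun z => unfoldAddr l z.1 z.2) ?_ ?_ ?_ ?_ ?_
  · exact fun R hR => Finset.mem_product.2 ⟨ancestor_mem hR, foldAddr_mem hR⟩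
  · rintro ⟨q, t⟩ h
    rw [Finset.mem_product] at h
    exact unfoldAddr_mem h.1 h.2
  · exact fun R _ => unfoldAddr_foldAddr l R
  · rintro ⟨q, t⟩ h
    rw [Finset.mem_product] at h
    have ht := (mem_cells.1 h.2).1
    exact Prod.ext (ancestor_unfoldAddr ht) (foldAddr_unfoldAddr ht)
  · intro R _
    rw [unfoldAddr_foldAddr]

end Folding

/-! ### The symmetries of the cube and the symmetric hull of a crossing. -/

section Symmetries

variable {n : ℕ}

/-- The symmetry of the unit cube that permutes the coordinates and reflects some of them. -/
def cubeSymm (w : Equiv.Perm (Fin n) × (Fin n → Bool)) (x : Fin n → ℝ) : Fin n → ℝ :=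
  fun i => if w.2 i then 1 - x (w.1 i) else x (w.1 i)

/-- The action of a symmetry of the unit cube on addresses. -/
def addrSymm (m : ℕ) (w : Equiv.Perm (Fin n) × (Fin n → Bool)) (q : Fin n → ℤ) : Fin n → ℤ :=
  fun i => if w.2 i then 3 ^ m - 1 - q (w.1 i) else q (w.1 i)

theorem continuous_cubeSymm (w : Equiv.Perm (Fin n) × (Fin n → Bool)) :
    Continuous (cubeSymm w) := by
  refine continuous_pi fun i => ?_
  unfold cubeSymm
  split_ifs <;> fun_prop

theorem cubeSymm_mem {w : Equiv.Perm (Fin n) × (Fin n → Bool)} {x : Fin n → ℝ}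
    (hx : x ∈ sponge n) : cubeSymm w x ∈ sponge n := by
  have key : ∀ i k, cubeSymm w x i ∈ middleThirds k ↔ x (w.1 i) ∈ middleThirds k := by
    intro i k
    unfold cubeSymm
    split_ifs
    · simpa using int_sub_mem_middleThirds_iff (k := k) (t := x (w.1 i)) 1
    · rfl
  refine ⟨fun i => ?_, fun i j hij k => ?_⟩
  · have := hx.1 (w.1 i)
    unfold cubeSymm
    split_ifs
    · constructor <;> linarith [this.1, this.2]
    · exact this
  · rw [key, key]
    exact hx.2 _ _ (fun h => hij (w.1.injective h)) k

/-- The inverse of a symmetry of the unit cube. -/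
def invSymm (w : Equiv.Perm (Fin n) × (Fin n → Bool)) : Equiv.Perm (Fin n) × (Fin n → Bool) :=
  (w.1.symm, fun i => w.2 (w.1.symm i))

theorem invSymm_cubeSymm (w : Equiv.Perm (Fin n) × (Fin n → Bool)) (x : Fin n → ℝ) :
    cubeSymm (invSymm w) (cubeSymm w x) = x := by
  funext i
  simp only [cubeSymm, invSymm, Equiv.apply_symm_apply]
  split_ifs <;> ring

theorem addrSymm_invSymm (m : ℕ) (w : Equiv.Perm (Fin n) × (Fin n → Bool)) (q : Fin n → ℤ) :
    addrSymm m w (addrSymm m (invSymm w) q) = q := by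
  funext i
  simp only [addrSymm, invSymm, Equiv.symm_apply_apply]
  split_ifs <;> ring

theorem invSymm_addrSymm (m : ℕ) (w : Equiv.Perm (Fin n) × (Fin n → Bool)) (q : Fin n → ℤ) :
    addrSymm m (invSymm w) (addrSymm m w q) = q := by
  funext i
  simp only [addrSymm, invSymm, Equiv.apply_symm_apply]
  split_ifs <;> ring

theorem cubeSymm_mem_box {m : ℕ} {w : Equiv.Perm (Fin n) × (Fin n → Bool)} {x : Fin n → ℝ}
    {q : Fin n → ℤ} (hx : x ∈ box m q) : cubeSymm w x ∈ box m (addrSymm m w q) := by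
  intro i
  have h := hx (w.1 i)
  unfold cubeSymm addrSymm
  split_ifs
  · push_cast; constructor <;> linarith
  · exact h

theorem addrSymm_mem {m : ℕ} {w : Equiv.Perm (Fin n) × (Fin n → Bool)} {q : Fin n → ℤ}
    (hq : q ∈ cells n m) : addrSymm m w q ∈ cells n m := by
  refine mem_cells_of_interior (cubeSymm_mem (w := w) (innerPoint_mem hq)) fun i => ?_
  have h := innerPoint_interior m q (w.1 i)
  unfold cubeSymm addrSymm
  split_ifs
  · push_cast; constructor <;> linarith
  · exact h

/-- The symmetries act through the indices, hence the reversed order of the permutations. -/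
theorem cubeSymm_comp (v w : Equiv.Perm (Fin n) × (Fin n → Bool)) (x : Fin n → ℝ) :
    cubeSymm v (cubeSymm w x) =
      cubeSymm (w.1 * v.1, fun i => xor (v.2 i) (w.2 (v.1 i))) x := by
  funext i
  simp only [cubeSymm, Equiv.Perm.mul_apply]
  by_cases hv : v.2 i <;> by_cases hw : w.2 (v.1 i) <;> simp [hv, hw]

/-- A path-connected subset of the sponge that joins two opposite faces of the unit cube. -/
structure Crosses (θ : Set (Fin n → ℝ)) : Prop where
  isPathConnected : IsPathConnected θ
  subset : θ ⊆ sponge n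
  exists_faces : ∃ i, (∃ x ∈ θ, x i = 0) ∧ ∃ x ∈ θ, x i = 1

/-- A path-connected subset of the sponge that meets all faces of the unit cube. -/
structure MeetsAllFaces (S : Set (Fin n → ℝ)) : Prop where
  isPathConnected : IsPathConnected S
  subset : S ⊆ sponge n
  faces : ∀ i, (∃ x ∈ S, x i = 0) ∧ ∃ x ∈ S, x i = 1

/-- The union of the images of a set under all symmetries of the unit cube. -/
def symmHull (θ : Set (Fin n → ℝ)) : Set (Fin n → ℝ) := ⋃ w, cubeSymm w '' θ

theorem mem_symmHull {θ : Set (Fin n → ℝ)} {x : Fin n → ℝ} (hx : x ∈ θ)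
    (w : Equiv.Perm (Fin n) × (Fin n → Bool)) : cubeSymm w x ∈ symmHull θ :=
  Set.mem_iUnion.2 ⟨w, x, hx, rfl⟩

theorem cubeSymm_mem_symmHull {θ : Set (Fin n → ℝ)} {x : Fin n → ℝ} (hx : x ∈ symmHull θ)
    (w : Equiv.Perm (Fin n) × (Fin n → Bool)) : cubeSymm w x ∈ symmHull θ := by
  obtain ⟨v, y, hy, rfl⟩ := Set.mem_iUnion.1 hx
  rw [cubeSymm_comp]
  exact mem_symmHull hy _

theorem subset_symmHull (θ : Set (Fin n → ℝ)) : θ ⊆ symmHull θ := fun x hx => by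
  have : cubeSymm (1, fun _ => false) x = x := by funext i; simp [cubeSymm]
  rw [← this]
  exact mem_symmHull hx _

/-- A path-connected set that joins two opposite faces meets the mirrors of enough reflections of
the cube for its symmetric hull to be path connected. -/
theorem Crosses.joinedIn_cubeSymm {θ : Set (Fin n → ℝ)} (hθ : Crosses θ)
    (w : Equiv.Perm (Fin n) × (Fin n → Bool)) :
    ∀ x ∈ θ, JoinedIn (symmHull θ) x (cubeSymm w x) := by
  obtain ⟨i, ⟨x₀, hx₀, h0⟩, ⟨x₁, hx₁, h1⟩⟩ := hθ.exists_faces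
  have hconn : IsPreconnected θ := hθ.isPathConnected.isConnected.isPreconnected
  let P : Equiv.Perm (Fin n) × (Fin n → Bool) → Prop :=
    fun w => ∀ x ∈ θ, JoinedIn (symmHull θ) x (cubeSymm w x)
  have hmap : ∀ {x y} (w), JoinedIn (symmHull θ) x y →
      JoinedIn (symmHull θ) (cubeSymm w x) (cubeSymm w y) := by
    intro x y w h
    have := h.map_continuousOn (continuous_cubeSymm w).continuousOn
    refine this.mono ?_
    rintro _ ⟨z, hz, rfl⟩
    exact cubeSymm_mem_symmHull hz w
  have hcomp : ∀ v w, P v → P w → P (w.1 * v.1, fun i => xor (v.2 i) (w.2 (v.1 i))) := by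
    intro v w hv hw x hx
    rw [← cubeSymm_comp]
    exact (hv x hx).trans (hmap v (hw x hx))
  have hjoin : ∀ x ∈ θ, ∀ y ∈ θ, JoinedIn (symmHull θ) x y := fun x hx y hy =>
    (hθ.isPathConnected.joinedIn x hx y hy).mono (subset_symmHull θ)
  -- If `w` fixes a point `a` of `θ`, a path runs from `x` to `a` in `θ` and on from `a` to the
  -- image of `x` in the image of `θ`.
  have hfix : ∀ w, (∃ a ∈ θ, cubeSymm w a = a) → P w := by
    rintro w ⟨a, ha, hfix⟩ x hx
    have h1 := hjoin x hx a ha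
    have h2 := hmap w (hjoin a ha x hx)
    rw [hfix] at h2
    exact h1.trans h2
  obtain ⟨x₂, hx₂, h2⟩ : ∃ x ∈ θ, x i = 1 / 2 := by
    obtain ⟨x, hx, h⟩ := hconn.intermediate_value hx₀ hx₁ (f := fun x : Fin n → ℝ => x i)
      (continuous_apply i).continuousOn
      (show (1 / 2 : ℝ) ∈ Set.Icc (x₀ i) (x₁ i) by rw [h0, h1]; norm_num)
    exact ⟨x, hx, h⟩
  have hflip : P (1, fun l => decide (l = i)) := by
    refine hfix _ ⟨x₂, hx₂, ?_⟩
    funext l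
    simp only [cubeSymm, Equiv.Perm.one_apply, decide_eq_true_eq]
    split_ifs with h
    · subst h; rw [h2]; norm_num
    · rfl
  have hcongr : ∀ {v w}, P v → v = w → P w := fun h e => e ▸ h
  -- The difference `|x i - 1 / 2| - |x j - 1 / 2|` is at most `0` where `x i = 1 / 2` and at least
  -- `0` where `x i = 0`. So `θ` meets one of the two diagonal mirrors `x i = x j` and `x i = 1 - x
  -- j`. Conjugating the reflection in direction `i` by the symmetry obtained gives the one in
  -- direction `j`.
  have hswap : ∀ j, j ≠ i → P (Equiv.swap i j, fun _ => false) ∧ P (1, fun l => decide (l = j)) := by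
    intro j hj
    have hij : i ≠ j := hj.symm
    have : ∃ x ∈ θ, x i = x j ∨ x i = 1 - x j := by
      have hc : Continuous fun x : Fin n → ℝ => |x i - 1 / 2| - |x j - 1 / 2| := by fun_prop
      obtain ⟨x, hx, h⟩ := hconn.intermediate_value hx₂ hx₀ hc.continuousOn
        (show (0 : ℝ) ∈ _ from ⟨by simp only [h2]; simp, by
          have hb := (hθ.subset hx₀).1 j
          simp only [h0]
          have : |x₀ j - 1 / 2| ≤ 1 / 2 := abs_le.2 ⟨by linarith [hb.1], by linarith [hb.2]⟩
          have h' : |(0 : ℝ) - 1 / 2| = 1 / 2 := by norm_num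
          rw [h']; linarith⟩)
      refine ⟨x, hx, ?_⟩
      have h' : |x i - 1 / 2| = |x j - 1 / 2| := by simpa [sub_eq_zero] using h
      rcases abs_eq_abs.1 h' with h' | h'
      · left; linarith
      · right; linarith
    obtain ⟨x, hx, h | h⟩ := this
    · have hs : P (Equiv.swap i j, fun _ => false) := by
        refine hfix _ ⟨x, hx, ?_⟩
        funext l
        simp only [cubeSymm]
        rcases eq_or_ne l i with rfl | hl
        · simp [h]
        rcases eq_or_ne l j with rfl | hl'
        · simp [h]
        · simp [Equiv.swap_apply_of_ne_of_ne hl hl']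
      refine ⟨hs, hcongr (hcomp _ _ hs (hcomp _ _ hflip hs)) ?_⟩
      refine Prod.ext ?_ ?_
      · simp
      · funext l
        rcases eq_or_ne l i with rfl | hl
        · simp [hij, hj]
        rcases eq_or_ne l j with rfl | hl'
        · simp
        · simp [Equiv.swap_apply_of_ne_of_ne hl hl', hl, hl']
    · have hs : P (Equiv.swap i j, fun l => decide (l = i ∨ l = j)) := by
        refine hfix _ ⟨x, hx, ?_⟩
        funext l
        simp only [cubeSymm]
        rcases eq_or_ne l i with rfl | hl
        · simp [h]
        rcases eq_or_ne l j with rfl | hl'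
        · simp [h]
        · simp [Equiv.swap_apply_of_ne_of_ne hl hl', hl, hl']
      have hfj : P (1, fun l => decide (l = j)) := by
        refine hcongr (hcomp _ _ hs (hcomp _ _ hflip hs)) (Prod.ext ?_ ?_)
        · simp
        · funext l
          rcases eq_or_ne l i with rfl | hl
          · simp [hij, hj]
          rcases eq_or_ne l j with rfl | hl'
          · simp [hj]
          · simp [Equiv.swap_apply_of_ne_of_ne hl hl', hl, hl']
      refine ⟨hcongr (hcomp _ _ hflip (hcomp _ _ hfj hs)) (Prod.ext (by simp) ?_), hfj⟩
      funext l
      rcases eq_or_ne l i with rfl | hl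
      · simp [hij]
      rcases eq_or_ne l j with rfl | hl'
      · simp [hj]
      · simp [hl, hl']
  -- The reflections and the transpositions that move `i` generate the whole group.
  have hflips : ∀ s : Finset (Fin n), P (1, fun l => decide (l ∈ s)) := by
    intro s
    induction s using Finset.induction_on with
    | empty =>
      refine hfix _ ⟨x₀, hx₀, ?_⟩
      funext l; simp [cubeSymm]
    | insert a s ha ih =>
      have hfa : P (1, fun l => decide (l = a)) := by
        rcases eq_or_ne a i with rfl | h
        · exact hflip
        · exact (hswap a h).2
      refine hcongr (hcomp _ _ hfa ih) (Prod.ext (by simp) ?_)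
      funext l
      rcases eq_or_ne l a with rfl | hl
      · simp [ha]
      · by_cases h : l ∈ s <;> simp [hl, h]
  have hstar : ∀ j, P (Equiv.swap i j, fun _ => false) := by
    intro j
    rcases eq_or_ne j i with rfl | h
    · refine hcongr (hflips ∅) (Prod.ext (Equiv.swap_self j).symm (by simp))
    · exact (hswap j h).1
  have hswaps : ∀ a b, a ≠ b → P (Equiv.swap a b, fun _ => false) := by
    intro a b hab
    rcases eq_or_ne a i with rfl | ha
    · exact hstar b
    rcases eq_or_ne b i with rfl | hb
    · rw [Equiv.swap_comm]; exact hstar a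
    refine hcongr (hcomp _ _ (hstar a) (hcomp _ _ (hstar b) (hstar a))) (Prod.ext ?_ (by simp))
    simp only
    rw [Equiv.swap_comm i b, Equiv.swap_mul_swap_mul_swap hb hab.symm]
  have hperm : ∀ σ : Equiv.Perm (Fin n), P (σ, fun _ => false) := by
    intro σ
    induction σ using Equiv.Perm.swap_induction_on with
    | one => exact hcongr (hflips ∅) (Prod.ext rfl (by simp))
    | swap_mul σ a b hab ih =>
      exact hcongr (hcomp _ _ ih (hswaps a b hab)) (Prod.ext rfl (by simp))
  refine hcongr (hcomp _ _ (hflips (Finset.univ.filter fun l => w.2 l = true)) (hperm w.1)) ?_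
  refine Prod.ext (by simp) ?_
  funext l
  simp

/-- Every image of `θ` is joined to `θ` inside the hull, and transpositions carry the faces met by
`θ` to those of all other directions. -/
theorem Crosses.symmHull {θ : Set (Fin n → ℝ)} (hθ : Crosses θ) :
    MeetsAllFaces (symmHull θ) := by
  obtain ⟨i, ⟨x₀, hx₀, h0⟩, ⟨x₁, hx₁, h1⟩⟩ := hθ.exists_faces
  refine ⟨⟨x₀, subset_symmHull θ hx₀, fun {y} hy => ?_⟩, ?_, fun j => ?_⟩
  · obtain ⟨w, x, hx, rfl⟩ := Set.mem_iUnion.1 hy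
    exact ((hθ.isPathConnected.joinedIn x₀ hx₀ x hx).mono (subset_symmHull θ)).trans
      (hθ.joinedIn_cubeSymm w x hx)
  · intro y hy
    obtain ⟨w, x, hx, rfl⟩ := Set.mem_iUnion.1 hy
    exact cubeSymm_mem (hθ.subset hx)
  · exact ⟨⟨_, mem_symmHull hx₀ (Equiv.swap i j, fun _ => false), by simp [cubeSymm, h0]⟩,
      ⟨_, mem_symmHull hx₁ (Equiv.swap i j, fun _ => false), by simp [cubeSymm, h1]⟩⟩

end Symmetries

/-! ### Chains of adjacent cells. -/

section Chains

variable {n : ℕ}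

/-- The cubes with addresses `u` and `v` have a common face. -/
def FaceAdjacent (u v : Fin n → ℤ) : Prop := ∃ i, |u i - v i| = 1 ∧ ∀ j, j ≠ i → u j = v j

theorem mem_cells_of_digits {m : ℕ} {q u : Fin n → ℤ} (hq : q ∈ cells n m)
    (hu : ∀ i, 0 ≤ u i ∧ u i < 3 ^ m) (h : ∀ i k, digit k (u i) = 1 → digit k (q i) = 1) :
    u ∈ cells n m := by
  rw [mem_cells] at hq ⊢
  exact ⟨hu, fun i j hij k hk hd => hq.2 i j hij k hk ⟨h i k hd.1, h j k hd.2⟩⟩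

/-- Two cubes of the construction that touch are joined by a chain of cubes with common faces. -/
theorem Near.face_induction {m : ℕ} {q q' : Fin n → ℤ} (hq : q ∈ cells n m) (hq' : q' ∈ cells n m)
    (h : Near 1 q q') {P : (Fin n → ℤ) → Prop} (hP : P q)
    (step : ∀ u v, u ∈ cells n m → v ∈ cells n m → (∀ i, u i = q i ∨ u i = q' i) →
      (∀ i, v i = q i ∨ v i = q' i) → FaceAdjacent u v → P u → P v) : P q' := by
  -- In each coordinate `r i` is the one of `q i`, `q' i` whose digits `1` are shared by both.
  -- Passing to `r` creates no forbidden pair, so the chain changes `q` into `r` and then `r` into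
  -- `q'`, one coordinate at a time.
  have hr : ∀ i, ∃ r : ℤ, (r = q i ∨ r = q' i) ∧ (∀ k, digit k r = 1 → digit k (q i) = 1) ∧
      ∀ k, digit k r = 1 → digit k (q' i) = 1 := by
    intro i
    have := abs_le.1 (h i)
    have hcase : q' i = q i ∨ q' i = q i + 1 ∨ q i = q' i + 1 := by omega
    rcases hcase with e | e | e
    · exact ⟨q i, Or.inl rfl, fun k => id, by rw [e]; exact fun k => id⟩
    · rcases digit_succ_nested (q i) with hn | hn
      · exact ⟨q i, Or.inl rfl, fun k => id, by rw [e]; exact hn⟩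
      · exact ⟨q' i, Or.inr rfl, by rw [e]; exact hn, fun k => id⟩
    · rcases digit_succ_nested (q' i) with hn | hn
      · exact ⟨q' i, Or.inr rfl, by rw [e]; exact hn, fun k => id⟩
      · exact ⟨q i, Or.inl rfl, fun k => id, by rw [e]; exact hn⟩
  choose r hr₁ hr₂ hr₃ using hr
  let mix (p : Fin n → ℤ) (A : Finset (Fin n)) : Fin n → ℤ := fun i => if i ∈ A then r i else p i
  have hmixr : ∀ p A, (p = q ∨ p = q') → ∀ i, mix p A i = q i ∨ mix p A i = q' i := by
    intro p A hp i
    simp only [mix]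
    split_ifs
    · exact hr₁ i
    · rcases hp with rfl | rfl
      · exact Or.inl rfl
      · exact Or.inr rfl
  have hmix : ∀ p A, (p = q ∨ p = q') → mix p A ∈ cells n m := by
    intro p A hp
    have hpc : p ∈ cells n m := by rcases hp with rfl | rfl <;> assumption
    refine mem_cells_of_digits hpc (fun i => ?_) fun i k hd => ?_
    · rcases hmixr p A hp i with e | e <;> rw [e]
      · exact (mem_cells.1 hq).1 i
      · exact (mem_cells.1 hq').1 i
    · simp only [mix] at hd
      split_ifs at hd
      · rcases hp with rfl | rfl
        · exact hr₂ i k hd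
        · exact hr₃ i k hd
      · exact hd
  have hadj : ∀ p A a, (p = q ∨ p = q') → a ∉ A →
      mix p A = mix p (insert a A) ∨ FaceAdjacent (mix p A) (mix p (insert a A)) := by
    intro p A a hp ha
    have hother : ∀ j, j ≠ a → mix p A j = mix p (insert a A) j := by
      intro j hj; simp [mix, hj]
    by_cases he : mix p A a = mix p (insert a A) a
    · left
      funext j
      rcases eq_or_ne j a with rfl | hj
      · exact he
      · exact hother j hj
    · right
      refine ⟨a, ?_, hother⟩
      have h1 := hmixr p A hp a
      have h2 := hmixr p (insert a A) hp a
      have h3 := abs_le.1 (h a)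
      rw [abs_eq (by norm_num)]
      rcases h1 with h1 | h1 <;> rcases h2 with h2 | h2 <;> rw [h1, h2] at he ⊢ <;> omega
  have h1 : ∀ A, P (mix q A) := by
    intro A
    induction A using Finset.induction_on with
    | empty => simpa [mix] using hP
    | insert a A ha ih =>
      rcases hadj q A a (Or.inl rfl) ha with e | e
      · rw [← e]; exact ih
      · exact step _ _ (hmix _ _ (Or.inl rfl)) (hmix _ _ (Or.inl rfl)) (hmixr _ _ (Or.inl rfl))
          (hmixr _ _ (Or.inl rfl)) e ih
  have h2 : ∀ A, P (mix q' A) → P q' := by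
    intro A
    induction A using Finset.induction_on with
    | empty => intro h; simpa [mix] using h
    | insert a A ha ih =>
      intro hA
      apply ih
      rcases hadj q' A a (Or.inr rfl) ha with e | ⟨i, e, e'⟩
      · rw [e]; exact hA
      · refine step _ _ (hmix _ _ (Or.inr rfl)) (hmix _ _ (Or.inr rfl)) (hmixr _ _ (Or.inr rfl))
          (hmixr _ _ (Or.inr rfl)) ⟨i, ?_, fun j hj => (e' j hj).symm⟩ hA
        rwa [abs_sub_comm]
  refine h2 Finset.univ ?_
  have := h1 Finset.univ
  simpa [mix] using this

/-- Induction over the cubes that meet a connected set, from touching cube to touching cube. -/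
theorem box_induction {m : ℕ} {E : Set (Fin n → ℝ)} (hE : IsPreconnected E)
    {𝒰 : Finset (Fin n → ℤ)} (hcov : ∀ x ∈ E, ∃ U ∈ 𝒰, x ∈ box m U)
    (hmeet : ∀ U ∈ 𝒰, (E ∩ box m U).Nonempty) {P : (Fin n → ℤ) → Prop} {U₀ : Fin n → ℤ}
    (hU₀ : U₀ ∈ 𝒰) (hP : P U₀) (step : ∀ U ∈ 𝒰, ∀ U' ∈ 𝒰, Near 1 U U' → P U → P U') :
    ∀ U ∈ 𝒰, P U := by
  classical
  by_contra! hcon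
  obtain ⟨U₁, hU₁, hP₁⟩ := hcon
  have hclosed : ∀ s : Finset (Fin n → ℤ), IsClosed (⋃ U ∈ s, box m U) := fun s =>
    s.finite_toSet.isClosed_biUnion fun U _ => isClosed_box m U
  -- The cells with `P` and those without form two closed sets that cover `E`; by connectedness they
  -- have a common point in `E`, which lies in two touching cells.
  obtain ⟨x, hx, hxA, hxB⟩ := isPreconnected_closed_iff.1 hE _ _ (hclosed (𝒰.filter P))
    (hclosed (𝒰.filter fun U => ¬P U)) (by
      intro x hx
      obtain ⟨U, hU, hxU⟩ := hcov x hx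
      by_cases h : P U
      · left
        exact Set.mem_biUnion (Finset.mem_filter.2 ⟨hU, h⟩) hxU
      · right
        exact Set.mem_biUnion (Finset.mem_filter.2 ⟨hU, h⟩) hxU)
    (by
      obtain ⟨x, hx, hxU⟩ := hmeet U₀ hU₀
      exact ⟨x, hx, Set.mem_biUnion (Finset.mem_filter.2 ⟨hU₀, hP⟩) hxU⟩)
    (by
      obtain ⟨x, hx, hxU⟩ := hmeet U₁ hU₁
      exact ⟨x, hx, Set.mem_biUnion (Finset.mem_filter.2 ⟨hU₁, hP₁⟩) hxU⟩)
  obtain ⟨U, hU, hxU⟩ := Set.mem_iUnion₂.1 hxA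
  obtain ⟨U', hU', hxU'⟩ := Set.mem_iUnion₂.1 hxB
  rw [Finset.mem_filter] at hU hU'
  exact hU'.2 (step U hU.1 U' hU'.1 (near_one_of_mem_box hxU hxU') hU.2)

/-- The unfoldings into two adjacent cells are mirror images in the common face, so they agree at
any point of `S` that goes to this face. The parity of the address decides whether it comes from the
face `0` or the face `1`. -/
theorem FaceAdjacent.exists_unfold_eq {u v : Fin n → ℤ} (h : FaceAdjacent u v) (j : ℕ)
    {S : Set (Fin n → ℝ)} (hS : MeetsAllFaces S) : ∃ y ∈ S, unfold j u y = unfold j v y := by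
  obtain ⟨i, hi, hij⟩ := h
  have hex : ∃ y ∈ S, (u i + if Even (u i) then y i else 1 - y i) =
      (v i + if Even (v i) then y i else 1 - y i) := by
    obtain ⟨⟨y₀, hy₀, h0⟩, ⟨y₁, hy₁, h1⟩⟩ := hS.faces i
    rcases (abs_eq (by norm_num)).1 hi with e | e
    · have e' : u i = v i + 1 := by omega
      by_cases hv : Even (v i)
      · exact ⟨y₁, hy₁, by rw [e']; simp [hv, h1]⟩
      · exact ⟨y₀, hy₀, by rw [e']; simp [hv, h0]⟩
    · have e' : v i = u i + 1 := by omega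
      by_cases hu : Even (u i)
      · exact ⟨y₁, hy₁, by rw [e']; simp [hu, h1]⟩
      · exact ⟨y₀, hy₀, by rw [e']; simp [hu, h0]⟩
  obtain ⟨y, hy, he⟩ := hex
  refine ⟨y, hy, funext fun l => ?_⟩
  unfold CombLoewner.unfold
  rcases eq_or_ne l i with rfl | hl
  · rw [he]
  · rw [hij l hl]

end Chains

/-! ### Path connectedness of the sponge. -/

section PathConnected

variable {n : ℕ}

theorem int_div_notMem_middleThirds {t : ℝ} (c : ℤ) (h : 3 * t = c) (k : ℕ) :
    t ∉ middleThirds k := by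
  rintro ⟨a, h₁, h₂⟩
  rw [pow_succ, mul_assoc, h] at h₁ h₂
  have h₁' : 3 * a + 1 < 3 ^ k * c := by exact_mod_cast h₁
  have h₂' : 3 ^ k * c < 3 * a + 2 := by exact_mod_cast h₂
  omega

/-- Coordinates are changed one at a time; the others stay at `0` or `2 / 3`, which lie in no middle
third, so no forbidden pair arises on the way. -/
theorem joinedIn_sponge_corner {v : Fin n → ℝ} (hv : ∀ i, v i = 0 ∨ v i = 2 / 3) :
    JoinedIn (sponge n) 0 v := by
  have hmem : ∀ (i : Fin n) (x : Fin n → ℝ), x i ∈ Set.Icc (0 : ℝ) 1 →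
      (∀ j, j ≠ i → x j = 0 ∨ x j = 2 / 3) → x ∈ sponge n := by
    intro i x hxi hx
    have hnot : ∀ j, j ≠ i → ∀ k, x j ∉ middleThirds k := by
      intro j hj k
      rcases hx j hj with h | h
      · exact int_div_notMem_middleThirds 0 (by rw [h]; simp) k
      · exact int_div_notMem_middleThirds 2 (by rw [h]; norm_num) k
    refine ⟨fun j => ?_, fun a b hab k h => ?_⟩
    · rcases eq_or_ne j i with rfl | hj
      · exact hxi
      · rcases hx j hj with h | h <;> rw [h] <;> norm_num
    · rcases eq_or_ne a i with rfl | ha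
      · exact hnot b hab.symm k h.2
      · exact hnot a ha k h.1
  have key : ∀ A : Finset (Fin n), JoinedIn (sponge n) 0 (fun i => if i ∈ A then v i else 0) := by
    intro A
    induction A using Finset.induction_on with
    | empty =>
      simp only [Finset.notMem_empty, if_false]
      refine JoinedIn.refl ⟨fun i => by simp, fun a b _ k h => ?_⟩
      exact int_div_notMem_middleThirds 0 (by simp) k h.1
    | insert a A ha ih =>
      refine ih.trans (JoinedIn.of_segment_subset ?_)
      intro x hx
      obtain ⟨s, t, hs, ht, hst, rfl⟩ := hx
      refine hmem a _ ?_ fun j hj => ?_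
      · have : 0 ≤ v a ∧ v a ≤ 1 := by rcases hv a with h | h <;> rw [h] <;> norm_num
        simp only [Pi.add_apply, Pi.smul_apply, smul_eq_mul, ha, if_false, mul_zero, zero_add,
          Finset.mem_insert_self, if_true]
        constructor <;> nlinarith
      · simp only [Pi.add_apply, Pi.smul_apply, Finset.mem_insert, hj, false_or, smul_eq_mul,
          ← add_mul, hst, one_mul]
        split_ifs
        · exact hv j
        · exact Or.inl rfl
  simpa using key Finset.univ

theorem dist_unfold (j : ℕ) (q : Fin n → ℤ) (y z : Fin n → ℝ) :
    dist (unfold j q y) (unfold j q z) ≤ dist y z / 3 ^ j := by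
  rw [dist_pi_le_iff (by positivity)]
  intro i
  have hp : (0 : ℝ) < 3 ^ j := by positivity
  have h := dist_le_pi_dist y z i
  unfold CombLoewner.unfold
  rw [Real.dist_eq] at h ⊢
  rw [← sub_div, abs_div, abs_of_pos hp]
  gcongr
  refine le_trans (le_of_eq ?_) h
  split_ifs
  · congr 1; ring
  · rw [abs_sub_comm]; congr 1; ring

theorem dist_le_one {x y : Fin n → ℝ} (hx : x ∈ sponge n) (hy : y ∈ sponge n) : dist x y ≤ 1 := by
  rw [dist_pi_le_iff (by norm_num)]
  intro i
  rw [Real.dist_eq, abs_le]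
  have h1 := hx.1 i
  have h2 := hy.1 i
  constructor <;> linarith [h1.1, h1.2, h2.1, h2.2]

theorem zero_mem_sponge : (0 : Fin n → ℝ) ∈ sponge n :=
  ⟨fun i => by simp, fun _ _ _ k h => int_div_notMem_middleThirds 0 (by simp) k h.1⟩

/-- Approximations of a path from `0` to `y`, from `0` to corners of smaller and smaller cubes. -/
noncomputable def cornerPath (c : (Fin n → ℝ) → Fin n → ℤ)
    (P : ∀ y, Path (0 : Fin n → ℝ) (unfold 1 (c y) 0)) :
    ℕ → (Fin n → ℝ) → Σ v, Path (0 : Fin n → ℝ) v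
  | 0, _ => ⟨0, Path.refl 0⟩
  | j + 1, y => ⟨_, (P y).trans
      ((cornerPath c P j (fold 1 y)).2.map (continuous_unfold 1 (c y)))⟩

/-- The path goes to a corner of the cell of level `1` that contains `x`, then follows in this cell
a copy, scaled by `1 / 3`, of the path to `fold 1 x`. Iterating gives paths that converge uniformly,
with errors at most `(1 / 3) ^ j`. -/
theorem joinedIn_sponge_zero {x : Fin n → ℝ} (hx : x ∈ sponge n) : JoinedIn (sponge n) 0 x := by
  have hex : ∀ y : Fin n → ℝ, ∃ c ∈ cells n 1, y ∈ sponge n → y ∈ box 1 c := by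
    intro y
    by_cases hy : y ∈ sponge n
    · obtain ⟨c, hc, h⟩ := exists_mem_box hy 1
      exact ⟨c, hc, fun _ => h⟩
    · obtain ⟨c, hc, -⟩ := exists_mem_box hx 1
      exact ⟨c, hc, fun h => absurd h hy⟩
  choose c hc hcx using hex
  -- In a coordinate with address `1` the cell is reflected, so the origin goes to its upper end;
  -- only the values `0` and `2 / 3` occur.
  have hcorner : ∀ y, JoinedIn (sponge n) 0 (unfold 1 (c y) 0) := by
    intro y
    refine joinedIn_sponge_corner fun i => ?_
    have h := (mem_cells.1 (hc y)).1 i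
    unfold CombLoewner.unfold
    have h' : c y i = 0 ∨ c y i = 1 ∨ c y i = 2 := by omega
    rcases h' with h' | h' | h' <;> rw [h']
    · left; simp
    · right; norm_num
    · right; norm_num
  let P : ∀ y, Path (0 : Fin n → ℝ) (unfold 1 (c y) 0) := fun y => (hcorner y).somePath
  have hP : ∀ y t, P y t ∈ sponge n := fun y t => (hcorner y).somePath_mem t
  let g := cornerPath c P
  have hmem : ∀ j y t, (g j y).2 t ∈ sponge n := by
    intro j
    induction j with
    | zero => exact fun y t => zero_mem_sponge
    | succ j ih =>
      intro y t
      change ((P y).trans ((g j (fold 1 y)).2.map (continuous_unfold 1 (c y)))) t ∈ _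
      rw [Path.trans_apply]
      split_ifs
      · exact hP _ _
      · exact unfold_mem (hc y) (ih _ _)
  have hdist : ∀ j y t, dist ((g j y).2 t) ((g (j + 1) y).2 t) ≤ (1 / 3) ^ j := by
    intro j
    induction j with
    | zero =>
      intro y t
      rw [pow_zero]
      exact dist_le_one (hmem _ _ _) (hmem _ _ _)
    | succ j ih =>
      intro y t
      change dist (((P y).trans ((g j (fold 1 y)).2.map (continuous_unfold 1 (c y)))) t)
        (((P y).trans ((g (j + 1) (fold 1 y)).2.map (continuous_unfold 1 (c y)))) t) ≤ _
      rw [Path.trans_apply, Path.trans_apply]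
      split_ifs
      · rw [dist_self]; positivity
      · refine (dist_unfold 1 (c y) _ _).trans ?_
        rw [pow_one, pow_succ, ← div_eq_mul_one_div]
        gcongr
        exact ih _ _
  have hend : ∀ j, ∀ y ∈ sponge n, dist (g j y).1 y ≤ (1 / 3) ^ j := by
    intro j
    induction j with
    | zero => intro y hy; rw [pow_zero]; exact dist_le_one zero_mem_sponge hy
    | succ j ih =>
      intro y hy
      have h := dist_unfold 1 (c y) (g j (fold 1 y)).1 (fold 1 y)
      rw [unfold_fold (hcx y hy)] at h
      refine h.trans ?_
      rw [pow_one, pow_succ, ← div_eq_mul_one_div]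
      gcongr
      exact ih _ (fold_mem hy)
  have hcau : CauchySeq fun j => ((g j x).2 : C(unitInterval, Fin n → ℝ)) := by
    refine cauchySeq_of_le_geometric (1 / 3) 1 (by norm_num) fun j => ?_
    rw [one_mul, ContinuousMap.dist_le (by positivity)]
    exact fun t => hdist j x t
  obtain ⟨F, hF⟩ := cauchySeq_tendsto_of_complete hcau
  have hFt : ∀ t, Filter.Tendsto (fun j => (g j x).2 t) Filter.atTop (𝓝 (F t)) := fun t =>
    ((continuous_eval_const t).tendsto F).comp hF
  have hF0 : F 0 = 0 := by
    refine tendsto_nhds_unique (hFt 0) ?_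
    simp
  have hF1 : F 1 = x := by
    refine tendsto_nhds_unique (hFt 1) ?_
    simp only [Path.target]
    rw [tendsto_iff_dist_tendsto_zero]
    exact squeeze_zero (fun _ => dist_nonneg) (fun j => hend j x hx)
      (tendsto_pow_atTop_nhds_zero_of_lt_one (by norm_num) (by norm_num))
  exact ⟨⟨F, hF0, hF1⟩, fun t =>
    isClosed_sponge.mem_of_tendsto (hFt t) (Filter.Eventually.of_forall fun j => hmem j x t)⟩

theorem isPathConnected_sponge : IsPathConnected (sponge n) :=
  ⟨0, zero_mem_sponge, fun {_} hy => joinedIn_sponge_zero hy⟩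

end PathConnected

/-! ### The modulus of crossings on triadic cells. -/

section CrossModulus

variable {n : ℕ}

/-- A weight on the cubes of side `3 ^ (-l)` that gives length at least `1` to all sets that join
opposite faces of the unit cube. -/
def CrossAdmissible (l : ℕ) (ρ : (Fin n → ℤ) → ℝ≥0) : Prop :=
  ∀ θ : Set (Fin n → ℝ), Crosses θ → 1 ≤ weightLength (cells n l) (box l) ρ θ

variable (n) in
/-- The modulus of the family of sets that join opposite faces of the unit cube. -/
noncomputable def crossModulus (p : ℝ) (l : ℕ) : ℝ≥0 :=
  sInf {m | ∃ ρ : (Fin n → ℤ) → ℝ≥0, CrossAdmissible l ρ ∧ m = weightMass p (cells n l) ρ}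

theorem crossModulus_le {p : ℝ} {l : ℕ} {ρ : (Fin n → ℤ) → ℝ≥0} (h : CrossAdmissible l ρ) :
    crossModulus n p l ≤ weightMass p (cells n l) ρ :=
  csInf_le' ⟨ρ, h, rfl⟩

theorem one_mem_sponge : (1 : Fin n → ℝ) ∈ sponge n :=
  ⟨fun i => by simp, fun _ _ _ k h => int_div_notMem_middleThirds 3 (by simp) k h.1⟩

theorem crosses_sponge (hn : 0 < n) : Crosses (sponge n) :=
  ⟨isPathConnected_sponge, subset_rfl, ⟨0, hn⟩, ⟨0, zero_mem_sponge, rfl⟩, ⟨1, one_mem_sponge, rfl⟩⟩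

theorem weightLength_pos_mem {ι V : Type*} {X : Finset ι} {C : ι → Set V} {ρ : ι → ℝ≥0}
    {γ : Set V} {q : ι} (hq : q ∈ X) (h : (C q ∩ γ).Nonempty) : ρ q ≤ weightLength X C ρ γ := by
  classical
  exact Finset.single_le_sum (f := ρ) (fun _ _ => bot_le) (Finset.mem_filter.2 ⟨hq, h⟩)

theorem crossAdmissible_one (l : ℕ) : CrossAdmissible (n := n) l 1 := by
  intro θ hθ
  obtain ⟨i, ⟨x, hx, -⟩, -⟩ := hθ.exists_faces
  obtain ⟨q, hq, hxq⟩ := exists_mem_box (hθ.subset hx) l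
  exact weightLength_pos_mem (ρ := 1) hq ⟨x, hxq, hx⟩

theorem exists_crossAdmissible_lt {p : ℝ} {l : ℕ} {c : ℝ≥0} (h : crossModulus n p l < c) :
    ∃ ρ : (Fin n → ℤ) → ℝ≥0, CrossAdmissible l ρ ∧ weightMass p (cells n l) ρ < c := by
  obtain ⟨m, ⟨ρ, hρ, rfl⟩, hm⟩ := exists_lt_of_csInf_lt
    (s := {m | ∃ ρ : (Fin n → ℤ) → ℝ≥0, CrossAdmissible l ρ ∧ m = weightMass p (cells n l) ρ})
    ⟨_, 1, crossAdmissible_one l, rfl⟩ h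
  exact ⟨ρ, hρ, hm⟩

/-- Every weight has a short crossing, compared with its mass. -/
theorem exists_short_crossing (hn : 0 < n) {p : ℝ} (hp : 1 ≤ p) (l : ℕ)
    (ρ : (Fin n → ℤ) → ℝ≥0) : ∃ θ : Set (Fin n → ℝ), Crosses θ ∧
      weightLength (cells n l) (box l) ρ θ ^ p * crossModulus n p l ≤
        weightMass p (cells n l) ρ := by
  classical
  let s : Set ℝ≥0 := weightLength (cells n l) (box l) ρ '' {θ | Crosses θ}
  -- A length is a sum over a subset of a finite set, so the shortest crossing exists. Dividing the
  -- weight by its length makes it admissible.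
  have hfin : s.Finite := by
    refine ((cells n l).powerset.image fun t => ∑ q ∈ t, ρ q).finite_toSet.subset ?_
    rintro _ ⟨θ, -, rfl⟩
    rw [Finset.mem_coe, Finset.mem_image]
    exact ⟨_, Finset.mem_powerset.2 (Finset.filter_subset _ _), rfl⟩
  obtain ⟨_, ⟨θ, hθ, rfl⟩, hmin⟩ := Set.exists_min_image s id hfin
    ⟨_, _, crosses_sponge hn, rfl⟩
  refine ⟨θ, hθ, ?_⟩
  set L := weightLength (cells n l) (box l) ρ θ with hL
  rcases eq_or_ne L 0 with h0 | h0
  · rw [h0, NNReal.zero_rpow (by linarith), zero_mul]; exact bot_le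
  have hadm : CrossAdmissible l fun q => L⁻¹ * ρ q := by
    intro θ' hθ'
    have h1 : L ≤ weightLength (cells n l) (box l) ρ θ' := hmin _ ⟨θ', hθ', rfl⟩
    have h2 : weightLength (cells n l) (box l) (fun q => L⁻¹ * ρ q) θ' =
        L⁻¹ * weightLength (cells n l) (box l) ρ θ' := by
      unfold weightLength; rw [Finset.mul_sum]
    rw [h2, ← inv_mul_cancel₀ h0]
    gcongr
  have h1 := crossModulus_le (p := p) hadm
  have h2 : weightMass p (cells n l) (fun q => L⁻¹ * ρ q) =
      (L ^ p)⁻¹ * weightMass p (cells n l) ρ := by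
    unfold weightMass
    rw [Finset.mul_sum]
    refine Finset.sum_congr rfl fun q _ => ?_
    rw [NNReal.mul_rpow, NNReal.inv_rpow]
  have h3 : L ^ p ≠ 0 := by
    rw [Ne, NNReal.rpow_eq_zero_iff]; tauto
  calc L ^ p * crossModulus n p l ≤ L ^ p * ((L ^ p)⁻¹ * weightMass p (cells n l) ρ) := by
        gcongr; exact h1.trans h2.le
    _ = weightMass p (cells n l) ρ := by rw [mul_inv_cancel_left₀ h3]

end CrossModulus

/-! ### Unfolding a short crossing into a neighborhood of a cell. -/

section Unfolding

variable {n : ℕ}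

theorem weightLength_le_of_subset {ι V : Type*} {X Y : Finset ι} {C : ι → Set V} {ρ : ι → ℝ≥0}
    {γ : Set V} (h : ∀ q ∈ X, (C q ∩ γ).Nonempty → q ∈ Y) :
    weightLength X C ρ γ ≤ weightLength Y C ρ γ := by
  classical
  refine Finset.sum_le_sum_of_subset fun q hq => ?_
  rw [Finset.mem_filter] at hq ⊢
  exact ⟨h q hq.1 hq.2, hq.2⟩

open Classical in
/-- The mass of `ρ`, a weight on the cubes of side `3 ^ (-m)`, on the cubes whose ancestors `l`
levels up are within distance `r` of `Q`. -/
noncomputable def localMass (p : ℝ) (m l : ℕ) (ρ : (Fin n → ℤ) → ℝ≥0) (Q : Fin n → ℤ) (r : ℤ) :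
    ℝ≥0 :=
  weightMass p ((cells n m).filter fun R => Near r (ancestor l R) Q) ρ

open Classical in
theorem card_descendants_le (j s : ℕ) (Q : Fin n → ℤ) (r : ℕ) :
    ((cells n (j + s)).filter fun U => Near r (ancestor s U) Q).card ≤
      (2 * r + 1) ^ n * 3 ^ (s * n) := by
  have : ((cells n (j + s)).filter fun U => Near r (ancestor s U) Q) ⊆
      (((cells n j).filter fun P => Near r P Q) ×ˢ cells n s).image
        fun z => unfoldAddr s z.1 z.2 := by
    intro U hU
    rw [Finset.mem_filter] at hU
    refine Finset.mem_image.2 ⟨(ancestor s U, foldAddr s U), Finset.mem_product.2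
      ⟨Finset.mem_filter.2 ⟨ancestor_mem hU.1, hU.2⟩, foldAddr_mem hU.1⟩, unfoldAddr_foldAddr s U⟩
  refine (Finset.card_le_card this).trans (Finset.card_image_le.trans ?_)
  rw [Finset.card_product]
  exact Nat.mul_le_mul (card_near_le _ _ _) (card_cells_le s)

theorem exists_descendant {j s : ℕ} {P : Fin n → ℤ} (hP : P ∈ cells n j) {x : Fin n → ℝ}
    (hx : x ∈ sponge n) (hxP : x ∈ box j P) :
    ∃ U ∈ cells n (j + s), ancestor s U = P ∧ x ∈ box (j + s) U := by
  obtain ⟨t, ht, hxt⟩ := exists_mem_box (fold_mem (j := j) hx) s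
  exact ⟨unfoldAddr s P t, unfoldAddr_mem hP ht, ancestor_unfoldAddr (mem_cells.1 ht).1,
    (mem_box_unfoldAddr hxP).2 hxt⟩

theorem box_inter_sponge_eq {j : ℕ} {P : Fin n → ℤ} (hP : P ∈ cells n j) :
    sponge n ∩ box j P = unfold j P '' sponge n := by
  ext x
  constructor
  · rintro ⟨hx, hxP⟩
    exact ⟨fold j x, fold_mem hx, unfold_fold hxP⟩
  · rintro ⟨y, hy, rfl⟩
    exact ⟨unfold_mem hP hy, unfold_mem_box hy.1⟩

theorem isPathConnected_box_inter {j : ℕ} {P : Fin n → ℤ} (hP : P ∈ cells n j) :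
    IsPathConnected (sponge n ∩ box j P) := by
  rw [box_inter_sponge_eq hP]
  exact isPathConnected_sponge.image (continuous_unfold j P)

/-- The part of the sponge in the cubes that touch a given one is path connected. -/
theorem isPathConnected_neighborhood {j : ℕ} {P₀ : Fin n → ℤ} (hP₀ : P₀ ∈ cells n j) :
    IsPathConnected {x | x ∈ sponge n ∧ ∃ P ∈ cells n j, Near 1 P P₀ ∧ x ∈ box j P} := by
  set E := {x | x ∈ sponge n ∧ ∃ P ∈ cells n j, Near 1 P P₀ ∧ x ∈ box j P} with hE
  have hsub : ∀ P ∈ cells n j, Near 1 P P₀ → sponge n ∩ box j P ⊆ E :=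
    fun P hP h x hx => ⟨hx.1, P, hP, h, hx.2⟩
  have h00 := near_self (r := 1) (by norm_num) P₀
  have hin : innerPoint j P₀ ∈ sponge n ∩ box j P₀ :=
    ⟨innerPoint_mem hP₀, innerPoint_mem_box j P₀⟩
  refine ⟨innerPoint j P₀, hsub P₀ hP₀ h00 hin, fun {x} hx => ?_⟩
  obtain ⟨hxK, P, hP, hPP, hxP⟩ := hx
  -- A common corner of the two cells; grid points have no coordinate in a middle third beyond their
  -- level, so it is in the sponge.
  let v : Fin n → ℝ := fun i => ((max (P i) (P₀ i) : ℤ) : ℝ) / 3 ^ j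
  have hv : ∀ i, 3 ^ j * v i = ((max (P i) (P₀ i) : ℤ) : ℝ) := fun i => by
    simp only [v]; field_simp
  have hvbox : v ∈ box j P ∧ v ∈ box j P₀ := by
    have hb : ∀ i, P i ≤ max (P i) (P₀ i) ∧ max (P i) (P₀ i) ≤ P i + 1 ∧
        P₀ i ≤ max (P i) (P₀ i) ∧ max (P i) (P₀ i) ≤ P₀ i + 1 := by
      intro i
      have := abs_le.1 (hPP i)
      omega
    constructor <;> intro i <;> rw [hv] <;> obtain ⟨h1, h2, h3, h4⟩ := hb i
    · exact ⟨by exact_mod_cast h1, by exact_mod_cast h2⟩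
    · exact ⟨by exact_mod_cast h3, by exact_mod_cast h4⟩
  have hvK : v ∈ sponge n := by
    refine sponge_of_cell hP hvbox.1 fun i i' _ k h => ?_
    rw [hv] at h
    exact int_div_notMem_middleThirds (3 * max (P i) (P₀ i)) (by push_cast; ring) k h.1
  exact (((isPathConnected_box_inter hP₀).joinedIn _ hin v ⟨hvK, hvbox.2⟩).mono
    (hsub P₀ hP₀ h00)).trans (((isPathConnected_box_inter hP).joinedIn v ⟨hvK, hvbox.1⟩ x
      ⟨hxK, hxP⟩).mono (hsub P hP hPP))

open Classical in
/-- The union of the copies of a set that meets all faces, in the descendants of the cubes that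
touch a given one. -/
noncomputable def unfoldedSet (j s : ℕ) (P₀ : Fin n → ℤ) (S : Set (Fin n → ℝ)) :
    Set (Fin n → ℝ) :=
  ⋃ U ∈ (cells n (j + s)).filter fun U => Near 1 (ancestor s U) P₀, unfold (j + s) U '' S

/-- The small cells near `P₀` are linked by chains of cells with common faces, and copies of `S` in
cells with a common face intersect. -/
theorem MeetsAllFaces.isPathConnected_unfoldedSet {S : Set (Fin n → ℝ)} (hS : MeetsAllFaces S)
    (j s : ℕ) {P₀ : Fin n → ℤ} (hP₀ : P₀ ∈ cells n j) :
    IsPathConnected (unfoldedSet j s P₀ S) := by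
  classical
  set 𝒰 := (cells n (j + s)).filter fun U => Near 1 (ancestor s U) P₀ with h𝒰
  set T := unfoldedSet j s P₀ S with hT
  have hsub : ∀ U ∈ 𝒰, unfold (j + s) U '' S ⊆ T := fun U hU =>
    Set.subset_biUnion_of_mem (u := fun U => unfold (j + s) U '' S) hU
  have hE := (isPathConnected_neighborhood hP₀).isConnected.isPreconnected
  set E := {x | x ∈ sponge n ∧ ∃ P ∈ cells n j, Near 1 P P₀ ∧ x ∈ box j P} with hEdef
  obtain ⟨x₀, hx₀, hx₀P⟩ : ∃ x, x ∈ sponge n ∧ x ∈ box j P₀ :=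
    ⟨_, innerPoint_mem hP₀, innerPoint_mem_box j P₀⟩
  obtain ⟨U₀, hU₀c, hU₀a, -⟩ := exists_descendant (s := s) hP₀ hx₀ hx₀P
  have hU₀ : U₀ ∈ 𝒰 := Finset.mem_filter.2 ⟨hU₀c, hU₀a ▸ near_self (by norm_num) _⟩
  obtain ⟨y₀, hy₀, -⟩ := hS.isPathConnected
  have hjoin : ∀ U ∈ 𝒰, ∀ y ∈ S, ∀ z ∈ S, JoinedIn T (unfold (j + s) U y) (unfold (j + s) U z) :=
    fun U hU y hy z hz =>
      ((hS.isPathConnected.image (continuous_unfold (j + s) U)).joinedIn _ ⟨y, hy, rfl⟩ _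
        ⟨z, hz, rfl⟩).mono (hsub U hU)
  have key := box_induction hE (m := j + s) (𝒰 := 𝒰)
    (P := fun U => U ∈ 𝒰 ∧ JoinedIn T (unfold (j + s) U₀ y₀) (unfold (j + s) U y₀)) (U₀ := U₀)
    (by
      rintro x ⟨hx, P, hP, hPP, hxP⟩
      obtain ⟨U, hU, hUP, hxU⟩ := exists_descendant (s := s) hP hx hxP
      exact ⟨U, Finset.mem_filter.2 ⟨hU, hUP ▸ hPP⟩, hxU⟩)
    (by
      intro U hU
      rw [Finset.mem_filter] at hU
      exact ⟨innerPoint _ U, ⟨innerPoint_mem hU.1, _, ancestor_mem hU.1, hU.2,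
        box_subset_box_ancestor j s U (innerPoint_mem_box _ U)⟩, innerPoint_mem_box _ U⟩)
    hU₀ ⟨hU₀, hjoin U₀ hU₀ _ hy₀ _ hy₀⟩
    (by
      intro U hU U' hU' hnear hPU
      rw [Finset.mem_filter] at hU hU'
      refine hnear.face_induction (P := fun U => U ∈ 𝒰 ∧
        JoinedIn T (unfold (j + s) U₀ y₀) (unfold (j + s) U y₀)) hU.1 hU'.1 hPU ?_
      intro u v _ hv _ hv' hadj ⟨hu𝒰, huj⟩
      -- The chain does not leave the neighborhood, since each coordinate of `v` is one of `U` or of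
      -- `U'`.
      have hv𝒰 : v ∈ 𝒰 := by
        refine Finset.mem_filter.2 ⟨hv, fun i => ?_⟩
        have h1 := hU.2 i
        have h2 := hU'.2 i
        simp only [ancestor] at h1 h2 ⊢
        rcases hv' i with e | e <;> rw [e] <;> assumption
      refine ⟨hv𝒰, huj.trans ?_⟩
      obtain ⟨y, hy, he⟩ := hadj.exists_unfold_eq (j + s) hS
      have h1 := hjoin u hu𝒰 y₀ hy₀ y hy
      rw [he] at h1
      exact h1.trans (hjoin v hv𝒰 y hy y₀ hy₀))
  refine ⟨unfold (j + s) U₀ y₀, hsub U₀ hU₀ ⟨y₀, hy₀, rfl⟩, fun {x} hx => ?_⟩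
  obtain ⟨U, hU, y, hy, rfl⟩ := Set.mem_iUnion₂.1 hx
  exact (key U hU).2.trans (hjoin U hU _ hy₀ _ hy)

/-- The set `E` is not small compared with the cubes of side `3 ^ (-j)`. -/
def IsLarge (j : ℕ) (E : Set (Fin n → ℝ)) : Prop :=
  ∃ x ∈ E, ∃ y ∈ E, ∃ i, 1 ≤ 3 ^ j * |x i - y i|

theorem IsLarge.mono {j : ℕ} {E E' : Set (Fin n → ℝ)} (h : IsLarge j E) (hE : E ⊆ E') :
    IsLarge j E' := by
  obtain ⟨x, hx, y, hy, i, hi⟩ := h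
  exact ⟨x, hE hx, y, hE hy, i, hi⟩

theorem IsLarge.add {j : ℕ} {E : Set (Fin n → ℝ)} (h : IsLarge j E) (s : ℕ) :
    IsLarge (j + s) E := by
  obtain ⟨x, hx, y, hy, i, hi⟩ := h
  refine ⟨x, hx, y, hy, i, hi.trans ?_⟩
  gcongr
  · norm_num
  · omega

variable (n) in
/-- The number of symmetric copies used in unfolding a crossing. -/
def unfoldingConst (s : ℕ) : ℕ :=
  Fintype.card (Equiv.Perm (Fin n) × (Fin n → Bool)) * (5 ^ n * 3 ^ (s * n))

/-- The address `R` is folded to a symmetric image of the address `T`. -/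
def FoldsTo (l : ℕ) (T R : Fin n → ℤ) : Prop := ∃ w, foldAddr l R = addrSymm l w T

open Classical in
theorem card_symm_descendants_le (j s l : ℕ) (P₀ T : Fin n → ℤ) :
    (((cells n (j + s + l)).filter fun R => Near 2 (ancestor (s + l) R) P₀).filter
      fun R => FoldsTo l T R).card ≤ unfoldingConst n s := by
  let f : (Equiv.Perm (Fin n) × (Fin n → Bool)) × (Fin n → ℤ) → Fin n → ℤ :=
    fun z => unfoldAddr l z.2 (addrSymm l z.1 T)
  let D := (cells n (j + s)).filter fun U => Near ((2 : ℕ) : ℤ) (ancestor s U) P₀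
  have hsub : (((cells n (j + s + l)).filter fun R => Near 2 (ancestor (s + l) R) P₀).filter
      fun R => FoldsTo l T R) ⊆ (Finset.univ ×ˢ D).image f := by
    intro R hR
    rw [Finset.mem_filter, Finset.mem_filter] at hR
    obtain ⟨⟨hR, hnear⟩, w, hw⟩ := hR
    refine Finset.mem_image.2 ⟨(w, ancestor l R), Finset.mem_product.2
      ⟨Finset.mem_univ _, Finset.mem_filter.2 ⟨ancestor_mem hR, ?_⟩⟩, ?_⟩
    · rw [ancestor_ancestor]; exact_mod_cast hnear
    · simp only [f, ← hw]; exact unfoldAddr_foldAddr l R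
  have h1 := Finset.card_le_card hsub
  have h2 : ((Finset.univ ×ˢ D).image f).card ≤ (Finset.univ ×ˢ D).card := Finset.card_image_le
  have h3 : D.card ≤ 5 ^ n * 3 ^ (s * n) := card_descendants_le j s P₀ 2
  rw [Finset.card_product, Finset.card_univ] at h2
  exact h1.trans (h2.trans (Nat.mul_le_mul_left _ h3))

open Classical in
theorem card_symm_le (s l : ℕ) (R : Fin n → ℤ) :
    ((cells n l).filter fun T => FoldsTo l T R).card ≤
      unfoldingConst n s := by
  let f : Equiv.Perm (Fin n) × (Fin n → Bool) → Fin n → ℤ :=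
    fun w => addrSymm l (invSymm w) (foldAddr l R)
  have hsub : ((cells n l).filter fun T => FoldsTo l T R) ⊆
      Finset.univ.image f := by
    intro T hT
    obtain ⟨w, hw⟩ := (Finset.mem_filter.1 hT).2
    exact Finset.mem_image.2 ⟨w, Finset.mem_univ _, by simp only [f]; rw [hw, invSymm_addrSymm]⟩
  have h1 := Finset.card_le_card hsub
  have h2 : (Finset.univ.image f).card ≤ (Finset.univ : Finset (Equiv.Perm (Fin n) ×
    (Fin n → Bool))).card := Finset.card_image_le
  rw [Finset.card_univ] at h2
  exact h1.trans (h2.trans (Nat.le_mul_of_pos_right _ (by positivity)))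

/-- For every weight there is a short path-connected set that passes through all small cubes in
the neighborhood of a given cube. -/
theorem exists_unfoldedSet (hn : 0 < n) {p : ℝ} (hp : 1 ≤ p) (j s l : ℕ) {P₀ : Fin n → ℤ}
    (hP₀ : P₀ ∈ cells n j) (ρ : (Fin n → ℤ) → ℝ≥0) :
    ∃ S : Set (Fin n → ℝ), IsPathConnected S ∧ S ⊆ sponge n ∧
      (∀ U ∈ cells n (j + s), Near 1 (ancestor s U) P₀ → IsLarge (j + s) (S ∩ box (j + s) U) ∧
        ∀ i, (∃ x ∈ S ∩ box (j + s) U, 3 ^ (j + s) * x i = U i) ∧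
          ∃ x ∈ S ∩ box (j + s) U, 3 ^ (j + s) * x i = U i + 1) ∧
      weightLength (cells n (j + s + l)) (box (j + s + l)) ρ S ^ p * crossModulus n p l ≤
        (unfoldingConst n s : ℝ≥0) ^ p * localMass p (j + s + l) (s + l) ρ P₀ 2 := by
  classical
  -- Radius `2`: the copies lie in cells within `1` of `P₀`, and a cell that touches a copy may lie
  -- one cell further out. A cell `T` of the unit cube is charged with all `R` in `Y` that fold to a
  -- symmetric image of `T`, so the length of the whole unfolded set is at most the length of the
  -- single crossing `θ`.
  set Y := (cells n (j + s + l)).filter fun R => Near 2 (ancestor (s + l) R) P₀ with hY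
  let r : (Fin n → ℤ) → (Fin n → ℤ) → Prop := FoldsTo l
  obtain ⟨θ, hθ, hlen⟩ := exists_short_crossing hn hp l (transferWeight Y r ρ)
  have hS := hθ.symmHull
  set S := unfoldedSet j s P₀ (symmHull θ) with hSdef
  refine ⟨S, hS.isPathConnected_unfoldedSet j s hP₀, ?_, ?_, ?_⟩
  · intro x hx
    obtain ⟨U, hU, y, hy, rfl⟩ := Set.mem_iUnion₂.1 hx
    exact unfold_mem (Finset.mem_filter.1 hU).1 (hS.subset hy)
  · intro U hU hUP
    have hin : ∀ y ∈ symmHull θ, unfold (j + s) U y ∈ S ∩ box (j + s) U := fun y hy =>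
      ⟨Set.mem_biUnion (Finset.mem_filter.2 ⟨hU, hUP⟩) ⟨y, hy, rfl⟩,
        unfold_mem_box (hS.subset hy).1⟩
    have hfaces : ∀ i, (∃ x ∈ S ∩ box (j + s) U, 3 ^ (j + s) * x i = U i) ∧
          ∃ x ∈ S ∩ box (j + s) U, 3 ^ (j + s) * x i = U i + 1 := by
      intro i
      obtain ⟨⟨y₀, hy₀, h0⟩, ⟨y₁, hy₁, h1⟩⟩ := hS.faces i
      by_cases he : Even (U i)
      · exact ⟨⟨_, hin y₀ hy₀, by rw [mul_unfold]; simp [he, h0]⟩,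
          ⟨_, hin y₁ hy₁, by rw [mul_unfold]; simp [he, h1]⟩⟩
      · exact ⟨⟨_, hin y₁ hy₁, by rw [mul_unfold]; simp [he, h1]⟩,
          ⟨_, hin y₀ hy₀, by rw [mul_unfold]; simp [he, h0]⟩⟩
    refine ⟨?_, hfaces⟩
    obtain ⟨⟨x, hx, h0⟩, ⟨y, hy, h1⟩⟩ := hfaces ⟨0, hn⟩
    refine ⟨y, hy, x, hx, ⟨0, hn⟩, ?_⟩
    rw [← abs_of_pos (show (0 : ℝ) < 3 ^ (j + s) by positivity), ← abs_mul, mul_sub, h0, h1]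
    simp
  · have hlen' : weightLength (cells n (j + s + l)) (box (j + s + l)) ρ S ≤
        weightLength (cells n l) (box l) (transferWeight Y r ρ) θ := by
      have key : ∀ R ∈ cells n (j + s + l), (box (j + s + l) R ∩ S).Nonempty →
          R ∈ Y ∧ ∃ T ∈ cells n l, (box l T ∩ θ).Nonempty ∧ r T R := by
        rintro R hR ⟨x, hxR, hxS⟩
        obtain ⟨U, hU, y, hy, rfl⟩ := Set.mem_iUnion₂.1 hxS
        obtain ⟨w, z, hz, rfl⟩ := Set.mem_iUnion.1 hy
        rw [Finset.mem_filter] at hU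
        have hyK := hS.subset hy
        refine ⟨Finset.mem_filter.2 ⟨hR, ?_⟩, ?_⟩
        · have h1 : Near 1 (ancestor l R) U := near_one_of_mem_box
            (box_subset_box_ancestor (j + s) l R hxR) (unfold_mem_box hyK.1)
          have h2 := (h1.ancestor (l := s) (one_le_pow₀ (by norm_num))).trans hU.2
          rw [ancestor_ancestor] at h2
          exact h2
        · have h1 := fold_mem_box hxR
          rw [fold_unfold hyK.1] at h1
          have h2 := cubeSymm_mem_box (w := invSymm w) h1
          rw [invSymm_cubeSymm] at h2
          exact ⟨_, addrSymm_mem (foldAddr_mem hR), ⟨z, h2, hz⟩, w, (addrSymm_invSymm l w _).symm⟩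
      refine (weightLength_le_of_subset (Y := Y) fun R hR h => (key R hR h).1).trans ?_
      exact weightLength_le_transferWeight ρ fun R hR h => (key R (Finset.mem_filter.1 hR).1 h).2
    have hmass : weightMass p (cells n l) (transferWeight Y r ρ) ≤
        (unfoldingConst n s : ℝ≥0) ^ p * weightMass p Y ρ := by
      exact weightMass_transferWeight_le hp (fun T _ => card_symm_descendants_le j s l P₀ T)
        (fun R _ => card_symm_le s l R) ρ
    calc _ ≤ weightLength (cells n l) (box l) (transferWeight Y r ρ) θ ^ p *
          crossModulus n p l := by gcongr
      _ ≤ _ := hlen.trans hmass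

end Unfolding

/-! ### Product weights, submultiplicativity and a first upper bound. -/

section Submultiplicativity

variable {n : ℕ}

theorem ancestor_zero (R : Fin n → ℤ) : ancestor 0 R = R := by
  funext i; simp [ancestor]

/-- The initial part of a path, until it first reaches distance `d` from its origin. -/
theorem exists_subpath {V : Type*} [PseudoMetricSpace V] {γ : Set V} (hγ : IsPathConnected γ)
    {x y : V} (hx : x ∈ γ) (hy : y ∈ γ) {d : ℝ} (hd : 0 < d) (hxy : d ≤ dist x y) :
    ∃ γ' ⊆ γ, IsPathConnected γ' ∧ x ∈ γ' ∧ (∀ z ∈ γ', dist z x ≤ d) ∧ ∃ z ∈ γ', dist z x = d := by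
  obtain ⟨f, hf⟩ := hγ.joinedIn x hx y hy
  let g : ℝ → V := f.extend
  have hg : Continuous g := f.continuous_extend
  have hg0 : g 0 = x := f.extend_zero
  have hg1 : g 1 = y := f.extend_one
  have hgγ : ∀ t ∈ Set.Icc (0 : ℝ) 1, g t ∈ γ := by
    intro t ht
    simp only [g]
    rw [Path.extend_apply f ht]
    exact hf _
  have hdc : Continuous fun t => dist (g t) x := hg.dist continuous_const
  have hcomp : IsCompact (Set.Icc (0 : ℝ) 1 ∩ {t | d ≤ dist (g t) x}) :=
    isCompact_Icc.inter_right (isClosed_le continuous_const hdc)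
  obtain ⟨t₀, ⟨⟨h0, h1⟩, hd₀⟩, hmin⟩ := hcomp.exists_isLeast
    ⟨1, ⟨by norm_num, by norm_num⟩, by change d ≤ dist (g 1) x; rw [hg1, dist_comm]; exact hxy⟩
  have hlt : ∀ t, 0 ≤ t → t < t₀ → dist (g t) x < d := by
    intro t ht htt
    by_contra! h
    exact absurd (hmin ⟨⟨ht, htt.le.trans h1⟩, h⟩) (not_le.2 htt)
  have heq : dist (g t₀) x = d := by
    refine le_antisymm ?_ hd₀
    by_contra! h
    obtain ⟨t, ht, hte⟩ := intermediate_value_Icc h0 hdc.continuousOn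
      (show d ∈ Set.Icc _ _ from ⟨by rw [hg0, dist_self]; exact hd.le, h.le⟩)
    have hte' : dist (g t) x = d := hte
    have h2 : t₀ ≤ t := hmin ⟨⟨ht.1, ht.2.trans h1⟩, hte'.ge⟩
    have h3 : t = t₀ := le_antisymm ht.2 h2
    rw [h3] at hte'
    linarith
  refine ⟨g '' Set.Icc 0 t₀, ?_, ?_, ⟨0, ⟨le_rfl, h0⟩, hg0⟩, ?_, ⟨_, ⟨t₀, ⟨h0, le_rfl⟩, rfl⟩, heq⟩⟩
  · rintro _ ⟨t, ht, rfl⟩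
    exact hgγ t ⟨ht.1, ht.2.trans h1⟩
  · exact ((convex_Icc 0 t₀).isPathConnected ⟨0, le_rfl, h0⟩).image hg
  · rintro _ ⟨t, ht, rfl⟩
    rcases eq_or_lt_of_le ht.2 with h | h
    · rw [h, heq]
    · exact (hlt t ht.1 h).le

theorem triangleWave_int (c : ℤ) : triangleWave c = if Even c then 0 else 1 := by
  rw [triangleWave_eq (c := c) le_rfl (by linarith)]
  split_ifs <;> ring

/-- A path-connected set whose diameter is at least twice the side of a cube is folded to a set
that joins two opposite faces of the unit cube. -/
theorem crosses_fold {γ : Set (Fin n → ℝ)} (hγ : IsPathConnected γ) (hsub : γ ⊆ sponge n) (j : ℕ)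
    {x z : Fin n → ℝ} (hx : x ∈ γ) (hz : z ∈ γ) (hd : 2 / 3 ^ j ≤ dist z x) :
    Crosses (fold j '' γ) := by
  have h3 : (0 : ℝ) < 3 ^ j := by positivity
  obtain ⟨i, hi⟩ : ∃ i, 2 / 3 ^ j ≤ |z i - x i| := by
    by_contra! h
    exact absurd hd (not_le.2 ((dist_pi_lt_iff (by positivity)).2 fun i => by
      rw [Real.dist_eq]; exact h i))
  have hconn := hγ.isConnected.isPreconnected
  -- An interval of length `2` contains a unit interval with integer ends, starting at the ceiling
  -- of its left end; these ends are folded to opposite faces.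
  have key : ∀ x ∈ γ, ∀ z ∈ γ, 2 / 3 ^ j ≤ z i - x i →
      ∃ c : ℤ, (∃ y ∈ γ, 3 ^ j * y i = c) ∧ ∃ y ∈ γ, 3 ^ j * y i = (c + 1 : ℤ) := by
    intro x hx z hz h
    have hval := hconn.intermediate_value hx hz (f := fun y : Fin n → ℝ => 3 ^ j * y i)
      (by fun_prop)
    have h1 := Int.le_ceil (3 ^ j * x i)
    have h2 := Int.ceil_lt_add_one (3 ^ j * x i)
    rw [div_le_iff₀ h3] at h
    obtain ⟨y, hy, hye⟩ := hval (show (⌈3 ^ j * x i⌉ : ℝ) ∈ _ from ⟨h1, by linarith⟩)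
    obtain ⟨y', hy', hye'⟩ := hval (show ((⌈3 ^ j * x i⌉ + 1 : ℤ) : ℝ) ∈ _ from
      ⟨by push_cast; linarith, by push_cast; linarith⟩)
    exact ⟨⌈3 ^ j * x i⌉, ⟨y, hy, hye⟩, ⟨y', hy', hye'⟩⟩
  obtain ⟨c, ⟨y, hy, hye⟩, ⟨y', hy', hye'⟩⟩ : ∃ c : ℤ, (∃ y ∈ γ, 3 ^ j * y i = c) ∧
      ∃ y ∈ γ, 3 ^ j * y i = (c + 1 : ℤ) := by
    rcases le_abs.1 hi with h | h
    · exact key x hx z hz h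
    · exact key z hz x hx (by linarith)
  refine ⟨hγ.image (continuous_fold j), ?_, i, ?_⟩
  · rintro _ ⟨u, hu, rfl⟩; exact fold_mem (hsub hu)
  · have e : fold j y i = if Even c then 0 else 1 := by
      unfold fold; rw [hye, triangleWave_int]
    have e' : fold j y' i = if Even c then 1 else 0 := by
      unfold fold; rw [hye', triangleWave_int]
      simp only [Int.even_add_one, ite_not]
    by_cases hc : Even c
    · exact ⟨⟨_, ⟨y, hy, rfl⟩, by simp [e, hc]⟩, ⟨_, ⟨y', hy', rfl⟩, by simp [e', hc]⟩⟩
    · exact ⟨⟨_, ⟨y', hy', rfl⟩, by simp [e', hc]⟩, ⟨_, ⟨y, hy, rfl⟩, by simp [e, hc]⟩⟩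

theorem sum_le_sum_of_surj {ι κ : Type*} {s : Finset ι} {t : Finset κ} {f : ι → κ} {ρ : κ → ℝ≥0}
    (h : ∀ k ∈ t, ∃ i ∈ s, f i = k) : ∑ k ∈ t, ρ k ≤ ∑ i ∈ s, ρ (f i) := by
  classical
  have h1 : t ⊆ s.image f := fun k hk => by
    obtain ⟨i, hi, e⟩ := h k hk
    exact Finset.mem_image.2 ⟨i, hi, e⟩
  refine (Finset.sum_le_sum_of_subset h1).trans ?_
  rw [← Finset.sum_fiberwise_of_maps_to (s := s) (t := s.image f) (g := f)
    (fun i hi => Finset.mem_image_of_mem f hi)]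
  refine Finset.sum_le_sum fun k hk => ?_
  obtain ⟨i, hi, rfl⟩ := Finset.mem_image.1 hk
  exact Finset.single_le_sum (f := fun i => ρ (f i)) (fun _ _ => bot_le)
    (Finset.mem_filter.2 ⟨hi, rfl⟩)

/-- The product of a weight on large cubes with a folded weight on small cubes. -/
noncomputable def productWeight (j l : ℕ) (w ρ : (Fin n → ℤ) → ℝ≥0) (R : Fin n → ℤ) : ℝ≥0 :=
  transferWeight (cells n j) (Near 3) w (ancestor l R) * ρ (foldAddr l R)

/-- Summed over pairs of ancestor and folded address, the mass factorizes. The constant `7 ^ n`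
counts the cells within distance `3`. -/
theorem weightMass_productWeight_le {p : ℝ} (hp : 1 ≤ p) (j l : ℕ) (w ρ : (Fin n → ℤ) → ℝ≥0) :
    weightMass p (cells n (j + l)) (productWeight j l w ρ) ≤
      ((7 ^ n : ℕ) : ℝ≥0) ^ p * weightMass p (cells n j) w * weightMass p (cells n l) ρ := by
  classical
  have h1 : weightMass p (cells n (j + l)) (productWeight j l w ρ) =
      weightMass p (cells n j) (transferWeight (cells n j) (Near 3) w) *
        weightMass p (cells n l) ρ := by
    unfold weightMass
    rw [sum_cells_add, Finset.sum_mul_sum]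
    refine Finset.sum_congr rfl fun q _ => Finset.sum_congr rfl fun t ht => ?_
    have ht' := (mem_cells.1 ht).1
    rw [productWeight, ancestor_unfoldAddr ht', foldAddr_unfoldAddr ht', NNReal.mul_rpow]
  rw [h1]
  gcongr
  refine weightMass_transferWeight_le hp (fun P _ => ?_) (fun Q _ => ?_) w
  · refine le_trans (Finset.card_le_card fun Q hQ => ?_) (card_near_le (cells n j) P 3)
    rw [Finset.mem_filter] at hQ ⊢
    exact ⟨hQ.1, hQ.2.symm⟩
  · exact card_near_le (cells n j) Q 3

/-- The product weight is large on sets that leave the neighborhoods of the cubes they visit. -/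
theorem sum_le_weightLength_productWeight (j l : ℕ) {w ρ : (Fin n → ℤ) → ℝ≥0}
    (hρ : CrossAdmissible l ρ) {γ : Set (Fin n → ℝ)} (hγ : IsPathConnected γ) (hsub : γ ⊆ sponge n)
    {H : Finset (Fin n → ℤ)} (hH : H ⊆ cells n j)
    (h : ∀ Q ∈ H, ∃ x ∈ γ, x ∈ box j Q ∧ ∃ y ∈ γ, 2 / 3 ^ j ≤ dist x y) :
    ∑ Q ∈ H, w Q ≤ weightLength (cells n (j + l)) (box (j + l)) (productWeight j l w ρ) γ := by
  classical
  have h3 : (0 : ℝ) < 3 ^ j := by positivity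
  let A := (cells n (j + l)).filter fun R => (box (j + l) R ∩ γ).Nonempty
  -- The part of `γ` up to distance `2 / 3 ^ j` from a point of `Q` is folded to a crossing, and it
  -- only visits cells within distance `3` of `Q`.
  have key : ∀ Q ∈ H, 1 ≤ ∑ R ∈ A with Near 3 (ancestor l R) Q, ρ (foldAddr l R) := by
    intro Q hQ
    obtain ⟨x, hx, hxQ, y, hy, hxy⟩ := h Q hQ
    obtain ⟨γ', hγ', hpc, hxγ', hball, z, hz, hzd⟩ := exists_subpath hγ hx hy (by positivity) hxy
    have hcr := crosses_fold hpc (hγ'.trans hsub) j hxγ' hz hzd.ge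
    refine (hρ _ hcr).trans (sum_le_sum_of_surj fun T hT => ?_)
    obtain ⟨hTc, _, hT₁, u, hu, rfl⟩ := Finset.mem_filter.1 hT
    obtain ⟨P, hP, huP⟩ := exists_mem_box (hsub (hγ' hu)) j
    have hTd := (mem_cells.1 hTc).1
    have hR := unfoldAddr_mem hP hTc
    refine ⟨unfoldAddr l P T, Finset.mem_filter.2 ⟨Finset.mem_filter.2 ⟨hR, u, ?_, hγ' hu⟩, ?_⟩,
      foldAddr_unfoldAddr hTd⟩
    · exact (mem_box_unfoldAddr huP).2 hT₁
    · rw [ancestor_unfoldAddr hTd]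
      refine near_of_mem_box huP hxQ fun i => ?_
      have h1 := (dist_le_pi_dist u x i).trans (hball u hu)
      rw [Real.dist_eq, le_div_iff₀ h3] at h1
      push_cast
      linarith
  calc ∑ Q ∈ H, w Q ≤ ∑ Q ∈ H, w Q * ∑ R ∈ A with Near 3 (ancestor l R) Q, ρ (foldAddr l R) := by
        refine Finset.sum_le_sum fun Q hQ => ?_
        exact le_mul_of_one_le_right bot_le (key Q hQ)
    _ = ∑ R ∈ A, ∑ Q ∈ H with Near 3 (ancestor l R) Q, w Q * ρ (foldAddr l R) := by
        simp_rw [Finset.mul_sum]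
        refine Finset.sum_comm' fun Q R => ?_
        simp only [Finset.mem_filter]
        tauto
    _ ≤ ∑ R ∈ A, productWeight j l w ρ R := by
        refine Finset.sum_le_sum fun R _ => ?_
        rw [productWeight, transferWeight, Finset.sum_mul]
        exact Finset.sum_le_sum_of_subset (f := fun Q => w Q * ρ (foldAddr l R))
          (Finset.filter_subset_filter _ hH)

theorem le_mul_crossModulus {p : ℝ} {l : ℕ} {x c : ℝ≥0}
    (h : ∀ ρ : (Fin n → ℤ) → ℝ≥0, CrossAdmissible l ρ → x ≤ c * weightMass p (cells n l) ρ) :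
    x ≤ c * crossModulus n p l := by
  rcases eq_or_ne c 0 with rfl | hc
  · simpa using h 1 (crossAdmissible_one l)
  have hc' : 0 < c := pos_iff_ne_zero.2 hc
  rw [← div_le_iff₀' hc']
  refine le_csInf ⟨_, 1, crossAdmissible_one l, rfl⟩ ?_
  rintro _ ⟨ρ, hρ, rfl⟩
  rw [div_le_iff₀' hc']
  exact h ρ hρ

/-- Every point of a crossing has distance at least `1 / 2` from some point of it on one of the two
faces. The product weight needs the distance `2 / 3 ^ k`, hence `2 ≤ k`. -/
theorem crossModulus_add_le {p : ℝ} (hp : 1 ≤ p) {k : ℕ} (hk : 2 ≤ k) (l : ℕ) :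
    crossModulus n p (k + l) ≤
      ((7 ^ n : ℕ) : ℝ≥0) ^ p * crossModulus n p k * crossModulus n p l := by
  classical
  have hstep : ∀ w ρ : (Fin n → ℤ) → ℝ≥0, CrossAdmissible k w → CrossAdmissible l ρ →
      crossModulus n p (k + l) ≤
        ((7 ^ n : ℕ) : ℝ≥0) ^ p * weightMass p (cells n k) w * weightMass p (cells n l) ρ := by
    intro w ρ hw hρ
    refine (crossModulus_le fun θ hθ => ?_).trans (weightMass_productWeight_le hp k l w ρ)
    refine (hw θ hθ).trans (sum_le_weightLength_productWeight k l hρ hθ.isPathConnected hθ.subset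
      (Finset.filter_subset _ _) fun Q hQ => ?_)
    obtain ⟨-, x, hxQ, hx⟩ := Finset.mem_filter.1 hQ
    obtain ⟨i, ⟨y, hy, h0⟩, ⟨z, hz, h1⟩⟩ := hθ.exists_faces
    have h9 : (2 : ℝ) / 3 ^ k ≤ 1 / 2 := by
      rw [div_le_div_iff₀ (by positivity) (by norm_num)]
      have : (3 : ℝ) ^ 2 ≤ 3 ^ k := pow_le_pow_right₀ (by norm_num) hk
      linarith
    refine ⟨x, hx, hxQ, ?_⟩
    rcases le_total (x i) (1 / 2) with h | h
    · refine ⟨z, hz, h9.trans (le_trans ?_ (dist_le_pi_dist x z i))⟩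
      rw [Real.dist_eq, h1, abs_sub_comm, le_abs]; left; linarith
    · refine ⟨y, hy, h9.trans (le_trans ?_ (dist_le_pi_dist x y i))⟩
      rw [Real.dist_eq, h0, le_abs]; left; linarith
  refine le_mul_crossModulus fun ρ hρ => ?_
  rw [mul_right_comm]
  refine le_mul_crossModulus fun w hw => ?_
  rw [mul_right_comm]
  exact hstep w ρ hw hρ

/-- A crossing meets each of the `3 ^ s` slabs in its direction, so the constant weight `3 ^ (-s)`
is admissible. The slabs are visited at half-integers, where the coordinate of the cell is
unambiguous. -/
theorem crossModulus_le_pow {p : ℝ} (s : ℕ) :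
    crossModulus n p s ≤ 3 ^ (s * n) * ((3 ^ s)⁻¹) ^ p := by
  classical
  have hadm : CrossAdmissible (n := n) s fun _ => (3 ^ s)⁻¹ := by
    intro θ hθ
    obtain ⟨i, ⟨y, hy, h0⟩, ⟨z, hz, h1⟩⟩ := hθ.exists_faces
    have hconn := hθ.isPathConnected.isConnected.isPreconnected
    have h3 : (0 : ℝ) < 3 ^ s := by positivity
    have hex : ∀ a : ℕ, a < 3 ^ s → ∃ q ∈ cells n s, (box s q ∩ θ).Nonempty ∧ q i = a := by
      intro a ha
      have ha' : (a : ℝ) + 1 ≤ 3 ^ s := by exact_mod_cast ha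
      have ha0 : (0 : ℝ) ≤ a := by positivity
      obtain ⟨x, hx, hxe⟩ := hconn.intermediate_value hy hz (f := fun y : Fin n → ℝ => 3 ^ s * y i)
        (by fun_prop) (show (a + 1 / 2 : ℝ) ∈ Set.Icc _ _ by
          rw [h0, h1]; constructor <;> linarith)
      have hxe' : 3 ^ s * x i = a + 1 / 2 := hxe
      obtain ⟨q, hq, hxq⟩ := exists_mem_box (hθ.subset hx) s
      refine ⟨q, hq, ⟨x, hxq, hx⟩, ?_⟩
      have h := hxq i
      rw [hxe'] at h
      have e1 : (q i : ℝ) < ((a + 1 : ℤ) : ℝ) := by push_cast; linarith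
      have e2 : (((a : ℤ) - 1 : ℤ) : ℝ) < q i := by push_cast; linarith
      have e1' : q i < a + 1 := by exact_mod_cast e1
      have e2' : (a : ℤ) - 1 < q i := by exact_mod_cast e2
      omega
    have hcard : 3 ^ s ≤ ((cells n s).filter fun q => (box s q ∩ θ).Nonempty).card := by
      rw [← Finset.card_range (3 ^ s)]
      refine le_trans (Finset.card_le_card (t := ((cells n s).filter fun q =>
        (box s q ∩ θ).Nonempty).image fun q => (q i).toNat) fun a ha => ?_) Finset.card_image_le
      obtain ⟨q, hq, hq', e⟩ := hex a (Finset.mem_range.1 ha)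
      exact Finset.mem_image.2 ⟨q, Finset.mem_filter.2 ⟨hq, hq'⟩, by simp [e]⟩
    unfold weightLength
    rw [Finset.sum_const, nsmul_eq_mul]
    have h3' : (3 : ℝ≥0) ^ s ≠ 0 := by positivity
    calc (1 : ℝ≥0) = 3 ^ s * (3 ^ s)⁻¹ := (mul_inv_cancel₀ h3').symm
      _ ≤ _ := by
        gcongr
        exact_mod_cast hcard
  refine (crossModulus_le hadm).trans ?_
  unfold weightMass
  rw [Finset.sum_const, nsmul_eq_mul]
  gcongr
  exact_mod_cast card_cells_le s

end Submultiplicativity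

/-! ### A lower bound from parallel lines over a Cantor set. -/

section LowerBound

/-- The integers with `m` ternary digits, all of them `0` or `2`. -/
def cantorIntegers : ℕ → Finset ℤ
  | 0 => {0}
  | m + 1 => (cantorIntegers m).image (fun a => 3 * a) ∪
      (cantorIntegers m).image (fun a => 3 * a + 2)

theorem card_cantorIntegers (m : ℕ) : (cantorIntegers m).card = 2 ^ m := by
  induction m with
  | zero => rfl
  | succ m ih =>
    rw [cantorIntegers, Finset.card_union_of_disjoint, Finset.card_image_of_injective,
      Finset.card_image_of_injective, ih, pow_succ, mul_two]
    · intro a b h; simp only at h; omega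
    · intro a b h; simp only at h; omega
    · rw [Finset.disjoint_left]
      intro x hx hx'
      obtain ⟨a, -, rfl⟩ := Finset.mem_image.1 hx
      obtain ⟨b, -, h⟩ := Finset.mem_image.1 hx'
      omega

theorem mem_cantorIntegers {m : ℕ} : ∀ {a : ℤ}, a ∈ cantorIntegers m →
    (0 ≤ a ∧ a < 3 ^ m) ∧ ∀ j, digit j a ≠ 1 := by
  induction m with
  | zero =>
    intro a ha
    obtain rfl : a = 0 := by simpa [cantorIntegers] using ha
    simp [digit]
  | succ m ih =>
    intro a ha
    obtain ⟨b, e, hb, he, rfl⟩ : ∃ b e : ℤ, b ∈ cantorIntegers m ∧ (e = 0 ∨ e = 2) ∧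
        a = 3 * b + e := by
      rw [cantorIntegers, Finset.mem_union] at ha
      rcases ha with ha | ha
      · obtain ⟨b, hb, rfl⟩ := Finset.mem_image.1 ha
        exact ⟨b, 0, hb, Or.inl rfl, by ring⟩
      · obtain ⟨b, hb, rfl⟩ := Finset.mem_image.1 ha
        exact ⟨b, 2, hb, Or.inr rfl, by ring⟩
    obtain ⟨⟨h0, h1⟩, hd⟩ := ih hb
    refine ⟨⟨by omega, by rw [pow_succ]; omega⟩, fun j => ?_⟩
    cases j with
    | zero => simp only [digit, pow_zero, Int.ediv_one]; omega
    | succ j =>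
      have h := hd j
      unfold digit at h ⊢
      rw [pow_succ', ← Int.ediv_ediv_of_nonneg (by norm_num)]
      have : (3 * b + e) / 3 = b := by omega
      rw [this]; exact h

theorem notMem_middleThirds_of_digits {a : ℤ} (ha : ∀ j, digit j a ≠ 1) (m k : ℕ) :
    ((a + 1 / 4) / 3 ^ m : ℝ) ∉ middleThirds k := by
  intro h
  have h3 : (3 : ℝ) ^ m * ((a + 1 / 4) / 3 ^ m) = a + 1 / 4 := by field_simp
  rcases lt_or_ge k m with hk | hk
  · obtain ⟨l, rfl⟩ : ∃ l, m = k + 1 + l := ⟨m - 1 - k, by omega⟩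
    exact ha l (digit_eq_one_of_mem (by rw [h3]; linarith) (by rw [h3]; linarith) h)
  · obtain ⟨l, rfl⟩ : ∃ l, k = m + l := ⟨k - m, by omega⟩
    rw [mem_middleThirds_add, h3, add_comm, add_int_mem_middleThirds_iff] at h
    exact quarter_notMem_middleThirds l h

/-- If `k` coordinates have no digit `1`, the remaining one is free, which gives `2 ^ (m * k)`
segments across the cube. Shifted by `1 / 4` off the grid, they run through disjoint families of at
most `3 ^ m` cells; Hölder's inequality applies on each. -/
theorem le_crossModulus_of_lines {k : ℕ} {p : ℝ} (hp : 1 ≤ p) (m : ℕ) :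
    ((2 ^ m) ^ k : ℝ≥0) ≤ ((3 ^ m : ℕ) : ℝ≥0) ^ (p - 1) * crossModulus (k + 1) p m := by
  classical
  refine le_mul_crossModulus fun ρ hρ => ?_
  let A : Finset ℤ := Finset.Ico 0 (3 ^ m)
  let T : Finset (Fin k → ℤ) := Fintype.piFinset fun _ => cantorIntegers m
  have hT : ∀ y ∈ T, ∀ i, y i ∈ cantorIntegers m := fun y hy => Fintype.mem_piFinset.1 hy
  have h3 : (0 : ℝ) < 3 ^ m := by positivity
  have hA : A.card ≤ 3 ^ m := by
    have : ((3 : ℤ) ^ m).toNat = 3 ^ m := by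
      rw [show (3 : ℤ) ^ m = ((3 ^ m : ℕ) : ℤ) by push_cast; rfl, Int.toNat_natCast]
    simp [A, this]
  have hline : ∀ y ∈ T, 1 ≤ ∑ a ∈ A, ρ (Fin.cons a y) := by
    intro y hy
    let f : ℝ → Fin (k + 1) → ℝ := fun t => Fin.cons t fun i => (y i + 1 / 4) / 3 ^ m
    have hf : Continuous f := by
      refine continuous_pi fun i => ?_
      refine Fin.cases ?_ (fun i => ?_) i
      · simpa [f] using continuous_id'
      · simpa [f] using continuous_const
    have hmem : ∀ t ∈ Set.Icc (0 : ℝ) 1, f t ∈ sponge (k + 1) := by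
      intro t ht
      have hnot : ∀ i l, f t (Fin.succ i) ∉ middleThirds l := by
        intro i l
        simp only [f, Fin.cons_succ]
        exact notMem_middleThirds_of_digits (mem_cantorIntegers (hT y hy i)).2 m l
      refine ⟨fun i => ?_, fun i j hij l h => ?_⟩
      · refine Fin.cases (by simpa [f] using ht) (fun i => ?_) i
        have hb := (mem_cantorIntegers (hT y hy i)).1
        have hb0 : (0 : ℝ) ≤ y i := by exact_mod_cast hb.1
        have hb1 : (y i + 1 : ℝ) ≤ 3 ^ m := by exact_mod_cast hb.2
        simp only [f, Fin.cons_succ]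
        exact ⟨by positivity, by rw [div_le_one h3]; linarith⟩
      · rcases Fin.eq_zero_or_eq_succ i with rfl | ⟨i, rfl⟩
        · rcases Fin.eq_zero_or_eq_succ j with rfl | ⟨j, rfl⟩
          · exact hij rfl
          · exact hnot j l h.2
        · exact hnot i l h.1
    have hcr : Crosses (f '' Set.Icc 0 1) := by
      refine ⟨((convex_Icc 0 1).isPathConnected ⟨0, by simp⟩).image hf, ?_, 0,
        ⟨f 0, ⟨0, by simp, rfl⟩, rfl⟩, ⟨f 1, ⟨1, by simp, rfl⟩, rfl⟩⟩
      rintro _ ⟨t, ht, rfl⟩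
      exact hmem t ht
    refine (hρ _ hcr).trans (sum_le_sum_of_surj fun R hR => ?_)
    obtain ⟨hRc, _, hxR, t, ht, rfl⟩ := Finset.mem_filter.1 hR
    refine ⟨R 0, Finset.mem_Ico.2 ((mem_cells.1 hRc).1 0), ?_⟩
    funext i
    refine Fin.cases rfl (fun i => ?_) i
    have h := hxR (Fin.succ i)
    simp only [f, Fin.cons_succ] at h ⊢
    rw [mul_div_cancel₀ _ h3.ne'] at h
    have e1 : (R (Fin.succ i) : ℝ) < ((y i + 1 : ℤ) : ℝ) := by push_cast; linarith
    have e2 : ((y i - 1 : ℤ) : ℝ) < R (Fin.succ i) := by push_cast; linarith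
    have e1' : R (Fin.succ i) < y i + 1 := by exact_mod_cast e1
    have e2' : y i - 1 < R (Fin.succ i) := by exact_mod_cast e2
    omega
  have hcell : ∀ a ∈ A, ∀ y ∈ T, (Fin.cons a y : Fin (k + 1) → ℤ) ∈ cells (k + 1) m := by
    intro a ha y hy
    refine mem_cells.2 ⟨fun i => ?_, fun i j hij l _ h => ?_⟩
    · exact Fin.cases (Finset.mem_Ico.1 ha) (fun i => (mem_cantorIntegers (hT y hy i)).1) i
    · rcases Fin.eq_zero_or_eq_succ i with rfl | ⟨i, rfl⟩
      · rcases Fin.eq_zero_or_eq_succ j with rfl | ⟨j, rfl⟩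
        · exact hij rfl
        · exact (mem_cantorIntegers (hT y hy j)).2 l h.2
      · exact (mem_cantorIntegers (hT y hy i)).2 l h.1
  calc ((2 ^ m) ^ k : ℝ≥0) = ∑ y ∈ T, 1 := by
        rw [Finset.sum_const, Fintype.card_piFinset]
        simp [card_cantorIntegers]
    _ ≤ ∑ y ∈ T, ((3 ^ m : ℕ) : ℝ≥0) ^ (p - 1) * ∑ a ∈ A, ρ (Fin.cons a y) ^ p := by
        refine Finset.sum_le_sum fun y hy => ?_
        refine le_trans ?_ (sum_rpow_le_card_mul hp A (fun a => ρ (Fin.cons a y)) hA)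
        exact NNReal.one_le_rpow (hline y hy) (by linarith)
    _ = ((3 ^ m : ℕ) : ℝ≥0) ^ (p - 1) *
          ∑ z ∈ T ×ˢ A, ρ (Fin.cons z.2 z.1 : Fin (k + 1) → ℤ) ^ p := by
        rw [← Finset.mul_sum, Finset.sum_product]
    _ ≤ _ := by
        gcongr
        rw [← Finset.sum_image (s := T ×ˢ A)
          (g := fun z : (Fin k → ℤ) × ℤ => (Fin.cons z.2 z.1 : Fin (k + 1) → ℤ))
          (f := fun R => ρ R ^ p)]
        · refine Finset.sum_le_sum_of_subset fun R hR => ?_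
          obtain ⟨z, hz, rfl⟩ := Finset.mem_image.1 hR
          rw [Finset.mem_product] at hz
          exact hcell _ hz.2 _ hz.1
        · intro z _ z' _ h
          have := Fin.cons_injective2 h
          exact Prod.ext this.2 this.1

end LowerBound

/-! ### Dependence of the modulus on the exponent. -/

section Exponents

variable {n : ℕ}

theorem cells_nonempty (m : ℕ) : (cells n m).Nonempty := by
  obtain ⟨q, hq, -⟩ := exists_mem_box (zero_mem_sponge (n := n)) m
  exact ⟨q, hq⟩

/-- A weight cut off at `1` remains admissible, and for values in `[0, 1]` the larger exponent gives
the smaller mass. -/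
theorem crossModulus_anti {p q : ℝ} (hp : 0 < p) (hpq : p ≤ q) (m : ℕ) :
    crossModulus n q m ≤ crossModulus n p m := by
  classical
  rw [← one_mul (crossModulus n p m)]
  refine le_mul_crossModulus fun ρ hρ => ?_
  rw [one_mul]
  have hadm : CrossAdmissible m fun R => min (ρ R) 1 := by
    intro θ hθ
    by_cases h : ∃ R ∈ cells n m, (box m R ∩ θ).Nonempty ∧ 1 ≤ ρ R
    · obtain ⟨R, hR, hRθ, h1⟩ := h
      refine le_trans ?_ (weightLength_pos_mem (ρ := fun R => min (ρ R) 1) hR hRθ)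
      exact (min_eq_right h1).ge
    · push Not at h
      refine (hρ θ hθ).trans (Finset.sum_le_sum fun R hR => ?_)
      rw [Finset.mem_filter] at hR
      exact (min_eq_left (h R hR.1 hR.2).le).ge
  refine (crossModulus_le hadm).trans (Finset.sum_le_sum fun R _ => ?_)
  rcases eq_or_ne (ρ R) 0 with h | h
  · simp only [h, zero_le_one, inf_of_le_left]
    rw [NNReal.zero_rpow (by linarith)]; exact bot_le
  · refine (NNReal.rpow_le_rpow_of_exponent_ge (lt_min (pos_iff_ne_zero.2 h) one_pos)
      (min_le_right _ _) hpq).trans ?_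
    exact NNReal.rpow_le_rpow (min_le_left _ _) hp.le

/-- Hölder's inequality with exponent `q / p`. On a fixed level it serves as one-sided continuity in
the exponent, with which limits are taken at the critical exponent from either side. -/
theorem crossModulus_rpow_le {p q : ℝ} (hp : 0 < p) (hpq : p ≤ q) (m : ℕ) :
    crossModulus n p m ^ q ≤ ((cells n m).card : ℝ≥0) ^ (q - p) * crossModulus n q m ^ p := by
  set N := (cells n m).card with hN
  have hq : 0 < q := hp.trans_le hpq
  have key : ∀ ρ : (Fin n → ℤ) → ℝ≥0, weightMass p (cells n m) ρ ^ q ≤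
      (N : ℝ≥0) ^ (q - p) * weightMass q (cells n m) ρ ^ p := by
    intro ρ
    have h := sum_rpow_le_card_mul (p := q / p) ((one_le_div hp).2 hpq) (cells n m)
      (fun R => ρ R ^ p) le_rfl
    have h' := NNReal.rpow_le_rpow h hp.le
    rw [NNReal.mul_rpow, ← NNReal.rpow_mul, ← NNReal.rpow_mul, div_mul_cancel₀ _ hp.ne',
      sub_mul, div_mul_cancel₀ _ hp.ne', one_mul] at h'
    have e : ∀ R, (ρ R ^ p) ^ (q / p) = ρ R ^ q := fun R => by
      rw [← NNReal.rpow_mul, mul_div_cancel₀ _ hp.ne']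
    simp only [e] at h'
    exact h'
  have hN0 : (N : ℝ≥0) ^ ((q - p) / p) ≠ 0 := by
    have : (N : ℝ≥0) ≠ 0 := by
      rw [Nat.cast_ne_zero, hN]; exact (Finset.card_pos.2 (cells_nonempty m)).ne'
    rw [Ne, NNReal.rpow_eq_zero_iff]; tauto
  have h1 : crossModulus n p m ^ (q / p) ≤ (N : ℝ≥0) ^ ((q - p) / p) * crossModulus n q m := by
    refine le_mul_crossModulus fun ρ hρ => ?_
    have h2 := NNReal.rpow_le_rpow (key ρ) (inv_pos.2 hp).le
    rw [NNReal.mul_rpow, ← NNReal.rpow_mul, ← NNReal.rpow_mul, ← NNReal.rpow_mul,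
      mul_inv_cancel₀ hp.ne', NNReal.rpow_one, ← div_eq_mul_inv, ← div_eq_mul_inv] at h2
    exact (NNReal.rpow_le_rpow (crossModulus_le hρ) (by positivity)).trans h2
  have h2 := NNReal.rpow_le_rpow h1 hp.le
  rwa [NNReal.mul_rpow, ← NNReal.rpow_mul, ← NNReal.rpow_mul, div_mul_cancel₀ _ hp.ne',
    div_mul_cancel₀ _ hp.ne'] at h2

end Exponents

/-! ### Linking of connected sets, and supermultiplicativity. -/

section Linking

variable {n : ℕ}

variable (n) in
/-- Any two connected sets that meet a common cube, and are not small compared with it, are joined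
by a path-connected set whose length is controlled by the local mass. -/
def Linkable (p : ℝ) (B : ℝ≥0) (l : ℕ) : Prop :=
  ∀ (j : ℕ) (Q : Fin n → ℤ) (ρ : (Fin n → ℤ) → ℝ≥0) (E F : Set (Fin n → ℝ)), Q ∈ cells n j →
    E ⊆ sponge n → F ⊆ sponge n → IsPreconnected E → IsPreconnected F →
    (E ∩ box j Q).Nonempty → (F ∩ box j Q).Nonempty → IsLarge j E → IsLarge j F →
    ∃ T : Set (Fin n → ℝ), IsPathConnected T ∧ T ⊆ sponge n ∧ (T ∩ E).Nonempty ∧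
      (T ∩ F).Nonempty ∧ weightLength (cells n (j + l)) (box (j + l)) ρ T ^ p * crossModulus n p l ≤
        B * localMass p (j + l) l ρ Q 2

theorem crossModulus_le_card (p : ℝ) (l : ℕ) : crossModulus n p l ≤ 3 ^ (l * n) := by
  refine (crossModulus_le (crossAdmissible_one l)).trans ?_
  simp only [weightMass, Pi.one_apply, NNReal.one_rpow, Finset.sum_const, nsmul_eq_mul, mul_one]
  exact_mod_cast card_cells_le l

/-- On boundedly many levels the whole sponge in the cell `Q` can serve as link, at the price of a
constant depending on `s`. -/
theorem linkable_of_lt {p : ℝ} (hp : 1 ≤ p) {s l : ℕ} (hl : l ≤ s) {B : ℝ≥0}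
    (hB : (5 ^ n * 3 ^ (s * n)) ^ p * 3 ^ (s * n) ≤ B) : Linkable n p B l := by
  classical
  intro j Q ρ E F hQ hE hF _ _ hEQ hFQ _ _
  refine ⟨sponge n ∩ box j Q, isPathConnected_box_inter hQ, Set.inter_subset_left, ?_, ?_, ?_⟩
  · obtain ⟨x, hx, hxQ⟩ := hEQ
    exact ⟨x, ⟨hE hx, hxQ⟩, hx⟩
  · obtain ⟨x, hx, hxQ⟩ := hFQ
    exact ⟨x, ⟨hF hx, hxQ⟩, hx⟩
  set Y := (cells n (j + l)).filter fun R => Near 2 (ancestor l R) Q with hY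
  have h1 : weightLength (cells n (j + l)) (box (j + l)) ρ (sponge n ∩ box j Q) ≤ ∑ R ∈ Y, ρ R := by
    refine (weightLength_le_of_subset (Y := Y) ?_).trans
      (Finset.sum_le_sum_of_subset (Finset.filter_subset _ _))
    rintro R hR ⟨x, hxR, -, hxQ⟩
    exact Finset.mem_filter.2 ⟨hR, (near_one_of_mem_box (box_subset_box_ancestor j l R hxR)
      hxQ).mono (by norm_num)⟩
  have hcard : Y.card ≤ 5 ^ n * 3 ^ (l * n) := card_descendants_le j l Q 2
  have h2 := sum_rpow_le_card_mul hp Y ρ hcard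
  have h31 : (1 : ℝ≥0) ≤ 3 := by norm_num
  have hpow : (3 : ℝ≥0) ^ (l * n) ≤ 3 ^ (s * n) :=
    pow_le_pow_right₀ h31 (Nat.mul_le_mul_right n hl)
  have hN : (((5 ^ n * 3 ^ (l * n) : ℕ) : ℝ≥0)) ^ (p - 1) ≤ (5 ^ n * 3 ^ (s * n)) ^ p := by
    have h1 : (1 : ℝ≥0) ≤ 5 ^ n * 3 ^ (s * n) :=
      one_le_mul (one_le_pow₀ (by norm_num)) (one_le_pow₀ h31)
    refine (NNReal.rpow_le_rpow (x := ((5 ^ n * 3 ^ (l * n) : ℕ) : ℝ≥0))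
      (y := 5 ^ n * 3 ^ (s * n)) ?_ (by linarith)).trans
      (NNReal.rpow_le_rpow_of_exponent_le h1 (by linarith))
    push_cast
    gcongr
  calc weightLength (cells n (j + l)) (box (j + l)) ρ (sponge n ∩ box j Q) ^ p * crossModulus n p l
      ≤ ((5 ^ n * 3 ^ (s * n)) ^ p * weightMass p Y ρ) * 3 ^ (s * n) := by
        gcongr
        · exact (NNReal.rpow_le_rpow h1 (by linarith)).trans (h2.trans (by
            unfold weightMass; gcongr))
        · exact (crossModulus_le_card p l).trans hpow
    _ = ((5 ^ n * 3 ^ (s * n)) ^ p * 3 ^ (s * n)) * weightMass p Y ρ := by ring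
    _ ≤ B * localMass p (j + l) l ρ Q 2 := by unfold localMass; gcongr

/-- A connected set that is not small compared with a cube it meets also meets a much smaller
cube with little mass around it. -/
theorem exists_cell_small_mass {p : ℝ} {j s l A : ℕ} (hs : 1 ≤ s) (hA : 1 ≤ A)
    (hA' : 14 * A ≤ 3 ^ s) (ρ : (Fin n → ℤ) → ℝ≥0) {Q : Fin n → ℤ} {E : Set (Fin n → ℝ)}
    (hE : E ⊆ sponge n) (hEc : IsPreconnected E) (hEQ : (E ∩ box j Q).Nonempty)
    (hEl : IsLarge j E) : ∃ U ∈ cells n (j + s), (E ∩ box (j + s) U).Nonempty ∧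
      Near 1 (ancestor s U) Q ∧ A * localMass p (j + s + l) l ρ U 2 ≤
        localMass p (j + s + l) (s + l) ρ Q 2 := by
  classical
  obtain ⟨e, he, heQ⟩ := hEQ
  have h3 : (0 : ℝ) < 3 ^ j := by positivity
  have h3s : (0 : ℝ) < 3 ^ (j + s) := by positivity
  have hA'' : (14 * A : ℝ) ≤ 3 ^ s := by exact_mod_cast hA'
  have hfar : ∃ y ∈ E, 1 / (2 * 3 ^ j) ≤ dist y e := by
    obtain ⟨x, hx, y, hy, i, hi⟩ := hEl
    by_contra! h
    have h1 := (dist_le_pi_dist x e i).trans_lt (h x hx)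
    have h2 := (dist_le_pi_dist y e i).trans_lt (h y hy)
    rw [Real.dist_eq, lt_div_iff₀ (by positivity)] at h1 h2
    have h4 := abs_sub_le (x i) (e i) (y i)
    rw [abs_sub_comm (e i)] at h4
    nlinarith
  obtain ⟨y, hy, hye⟩ := hfar
  -- Points of `E` at distances `7 * a` from `e`, in units of `3 ^ (-(j + s))`. A cell within `2` of
  -- the cells of two such points would force a distance of at most `5`, so the neighborhoods are
  -- disjoint; `14 * A ≤ 3 ^ s` keeps the points within half a large cell of `e`.
  have hpt : ∀ a : ℕ, a < A → ∃ x ∈ E, 3 ^ (j + s) * dist x e = 7 * a := by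
    intro a ha
    have ha' : (a : ℝ) ≤ A := by exact_mod_cast ha.le
    obtain ⟨x, hx, hxe⟩ := hEc.intermediate_value he hy (f := fun x => 3 ^ (j + s) * dist x e)
      (by fun_prop) (show (7 * a : ℝ) ∈ Set.Icc _ _ from by
        constructor
        · rw [dist_self, mul_zero]; positivity
        · rw [div_le_iff₀ (by positivity)] at hye
          have h4 := mul_le_mul_of_nonneg_left hye (show (0 : ℝ) ≤ 3 ^ s by positivity)
          rw [pow_add]
          nlinarith)
    exact ⟨x, hx, hxe⟩
  choose! f hfE hfd using hpt
  choose! U hU hfU using fun (a : ℕ) (ha : a < A) => exists_mem_box (hE (hfE a ha)) (j + s)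
  have hUQ : ∀ a, a < A → Near 1 (ancestor s (U a)) Q := by
    intro a ha
    refine near_of_mem_box (box_subset_box_ancestor j s _ (hfU a ha)) heQ fun i => ?_
    have h1 := dist_le_pi_dist (f a) e i
    rw [Real.dist_eq] at h1
    have h2 := hfd a ha
    have ha' : (a : ℝ) ≤ A := by exact_mod_cast ha.le
    rw [pow_add, mul_right_comm] at h2
    have h4 : (3 : ℝ) ^ j * dist (f a) e * 3 ^ s ≤ 1 / 2 * 3 ^ s := by rw [h2]; linarith
    have h5 := le_of_mul_le_mul_right h4 (by positivity)
    push_cast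
    nlinarith
  let D : ℕ → Finset (Fin n → ℤ) := fun a =>
    (cells n (j + s + l)).filter fun R => Near 2 (ancestor l R) (U a)
  have hdisj : Set.PairwiseDisjoint (Finset.range A : Set ℕ) D := by
    intro a ha b hb hab
    rw [Finset.mem_coe, Finset.mem_range] at ha hb
    rw [Function.onFun, Finset.disjoint_left]
    intro R hRa hRb
    have h1 := (Finset.mem_filter.1 hRa).2.symm.trans (Finset.mem_filter.1 hRb).2
    have h2 : dist (f a) (f b) ≤ 5 / 3 ^ (j + s) := by
      rw [dist_pi_le_iff (by positivity)]
      intro i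
      have h5 := abs_sub_le_of_mem_box h1 (hfU a ha) (hfU b hb) i
      rw [Real.dist_eq, le_div_iff₀ h3s]
      push_cast at h5
      linarith
    rw [le_div_iff₀ h3s] at h2
    have h6 := abs_dist_sub_le (f a) (f b) e
    have h7 : |3 ^ (j + s) * dist (f a) e - 3 ^ (j + s) * dist (f b) e| ≤ 5 := by
      rw [← mul_sub, abs_mul, abs_of_pos h3s]
      nlinarith
    rw [hfd a ha, hfd b hb, abs_le] at h7
    have h8 : 7 * (a : ℤ) - 7 * b ≤ 5 := by exact_mod_cast h7.2
    have h9 : (-5 : ℤ) ≤ 7 * a - 7 * b := by exact_mod_cast h7.1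
    omega
  have hsum : ∑ a ∈ Finset.range A, localMass p (j + s + l) l ρ (U a) 2 ≤
      localMass p (j + s + l) (s + l) ρ Q 2 := by
    unfold localMass weightMass
    rw [← Finset.sum_biUnion hdisj]
    refine Finset.sum_le_sum_of_subset fun R hR => ?_
    obtain ⟨a, ha, hRa⟩ := Finset.mem_biUnion.1 hR
    obtain ⟨hRc, hRU⟩ := Finset.mem_filter.1 hRa
    refine Finset.mem_filter.2 ⟨hRc, ?_⟩
    have h9 : (2 : ℤ) ≤ 3 ^ s :=
      le_trans (by norm_num) (pow_le_pow_right₀ (by norm_num : (1 : ℤ) ≤ 3) hs)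
    have := (hRU.ancestor (l := s) h9).trans (hUQ a (Finset.mem_range.1 ha))
    rwa [ancestor_ancestor] at this
  -- Pigeonhole: one of the `A` disjoint neighborhoods carries at most the fraction `1 / A` of the
  -- mass.
  obtain ⟨a, ha, hle⟩ := Finset.exists_le_of_sum_le (s := Finset.range A)
    (f := fun a => A * localMass p (j + s + l) l ρ (U a) 2)
    (g := fun _ => localMass p (j + s + l) (s + l) ρ Q 2) ⟨0, Finset.mem_range.2 hA⟩ (by
      rw [← Finset.mul_sum, Finset.sum_const, Finset.card_range, nsmul_eq_mul]
      gcongr)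
  rw [Finset.mem_range] at ha
  exact ⟨U a, hU a ha, ⟨f a, hfE a ha, hfU a ha⟩, hUQ a ha, hle⟩

theorem add_three_rpow_le {p : ℝ} (hp : 1 ≤ p) (a b c : ℝ≥0) :
    (a + b + c) ^ p ≤ 3 ^ p * (a ^ p + b ^ p + c ^ p) := by
  have h := sum_rpow_le_card_mul hp Finset.univ ![a, b, c] (N := 3) (by simp)
  simp only [Fin.sum_univ_three, Matrix.cons_val] at h
  refine h.trans (mul_le_mul' ?_ le_rfl)
  exact NNReal.rpow_le_rpow_of_exponent_le (by norm_num) (by linarith)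

/-- An unfolded set `S` passes through all subcells near `Q`. Both `E` and `F` visit subcells with
little mass around them and are linked to `S` there. Replacing `M p (s + l)` by `M p l`, together
with the convexity constant, costs the factor `D`. Since `4 * D ≤ A`, each end link uses at most a
quarter of `B * μ`, and `S` uses at most half of it, so the constant `B` reproduces itself. -/
theorem linkable_add (hn : 0 < n) {p : ℝ} (hp : 1 ≤ p) {s l A : ℕ} (hs : 2 ≤ s) (hA : 1 ≤ A)
    (hA' : 14 * A ≤ 3 ^ s) {D B : ℝ≥0}
    (hD : 3 ^ p * (((7 ^ n : ℕ) : ℝ≥0) ^ p * crossModulus n p s) ≤ D) (hDA : 4 * D ≤ A)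
    (hB : 2 * D * (unfoldingConst n s : ℝ≥0) ^ p ≤ B) (hl : Linkable n p B l) :
    Linkable n p B (s + l) := by
  intro j Q ρ E F hQ hE hF hEc hFc hEQ hFQ hEl hFl
  obtain ⟨U, hU, hEU, hUQ, hUm⟩ := exists_cell_small_mass (p := p) (l := l) (by omega) hA hA' ρ
    hE hEc hEQ hEl
  obtain ⟨W, hW, hFW, hWQ, hWm⟩ := exists_cell_small_mass (p := p) (l := l) (by omega) hA hA' ρ
    hF hFc hFQ hFl
  obtain ⟨S, hS, hSK, hSU, hSlen⟩ := exists_unfoldedSet hn hp j s l hQ ρ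
  have hSc := hS.isConnected.isPreconnected
  have hSne : ∀ V ∈ cells n (j + s), Near 1 (ancestor s V) Q → (S ∩ box (j + s) V).Nonempty :=
    fun V hV hVQ => by
      obtain ⟨x, hx, -⟩ := (hSU V hV hVQ).1
      exact ⟨x, hx⟩
  obtain ⟨T₁, hT₁, hT₁K, hT₁E, hT₁S, hT₁len⟩ := hl (j + s) U ρ E S hU hE hSK hEc hSc hEU
    (hSne U hU hUQ) (hEl.add s) ((hSU U hU hUQ).1.mono Set.inter_subset_left)
  obtain ⟨T₂, hT₂, hT₂K, hT₂S, hT₂F, hT₂len⟩ := hl (j + s) W ρ S F hW hSK hF hSc hFc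
    (hSne W hW hWQ) hFW ((hSU W hW hWQ).1.mono Set.inter_subset_left) (hFl.add s)
  refine ⟨T₁ ∪ S ∪ T₂, ?_, Set.union_subset (Set.union_subset hT₁K hSK) hT₂K, ?_, ?_, ?_⟩
  · refine (hT₁.union hS hT₁S).union hT₂ ?_
    obtain ⟨x, hx, hxS⟩ := hT₂S
    exact ⟨x, Or.inr hxS, hx⟩
  · obtain ⟨x, hx, hxE⟩ := hT₁E
    exact ⟨x, Or.inl (Or.inl hx), hxE⟩
  · obtain ⟨x, hx, hxF⟩ := hT₂F
    exact ⟨x, Or.inr hx, hxF⟩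
  rw [← add_assoc]
  set L := weightLength (cells n (j + s + l)) (box (j + s + l)) ρ
  set μ := localMass p (j + s + l) (s + l) ρ Q 2
  set μ₁ := localMass p (j + s + l) l ρ U 2
  set μ₂ := localMass p (j + s + l) l ρ W 2
  set c := (unfoldingConst n s : ℝ≥0) ^ p
  have h1 : L (T₁ ∪ S ∪ T₂) ^ p ≤ 3 ^ p * (L T₁ ^ p + L S ^ p + L T₂ ^ p) := by
    refine le_trans ?_ (add_three_rpow_le hp _ _ _)
    gcongr
    refine (weightLength_union_le _ _ _ _ _).trans ?_
    gcongr
    exact weightLength_union_le _ _ _ _ _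
  have h2 : L (T₁ ∪ S ∪ T₂) ^ p * crossModulus n p (s + l) ≤ D * (B * μ₁ + c * μ + B * μ₂) := by
    calc L (T₁ ∪ S ∪ T₂) ^ p * crossModulus n p (s + l)
        ≤ (3 ^ p * (L T₁ ^ p + L S ^ p + L T₂ ^ p)) *
          (((7 ^ n : ℕ) : ℝ≥0) ^ p * crossModulus n p s * crossModulus n p l) := by
          gcongr
          exact crossModulus_add_le hp hs l
      _ = (3 ^ p * (((7 ^ n : ℕ) : ℝ≥0) ^ p * crossModulus n p s)) *
          (L T₁ ^ p * crossModulus n p l + L S ^ p * crossModulus n p l +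
            L T₂ ^ p * crossModulus n p l) := by ring
      _ ≤ D * (B * μ₁ + c * μ + B * μ₂) := by gcongr
  have h3 : 4 * D * μ₁ ≤ μ := le_trans (by gcongr) hUm
  have h4 : 4 * D * μ₂ ≤ μ := le_trans (by gcongr) hWm
  have h5 : 4 * (D * (B * μ₁ + c * μ + B * μ₂)) ≤ 4 * (B * μ) := by
    calc 4 * (D * (B * μ₁ + c * μ + B * μ₂))
        = B * (4 * D * μ₁) + 2 * (2 * D * c * μ) + B * (4 * D * μ₂) := by ring
      _ ≤ B * μ + 2 * (B * μ) + B * μ := by gcongr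
      _ = 4 * (B * μ) := by ring
  exact h2.trans (le_of_mul_le_mul_left h5 (by norm_num))

theorem linkable_all (hn : 0 < n) {p : ℝ} (hp : 1 ≤ p) {s A : ℕ} (hs : 2 ≤ s) (hA : 1 ≤ A)
    (hA' : 14 * A ≤ 3 ^ s) {D B : ℝ≥0}
    (hD : 3 ^ p * (((7 ^ n : ℕ) : ℝ≥0) ^ p * crossModulus n p s) ≤ D) (hDA : 4 * D ≤ A)
    (hB : 2 * D * (unfoldingConst n s : ℝ≥0) ^ p ≤ B)
    (hB' : (5 ^ n * 3 ^ (s * n)) ^ p * 3 ^ (s * n) ≤ B) (l : ℕ) : Linkable n p B l := by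
  induction l using Nat.strong_induction_on with
  | _ l ih =>
    rcases le_total l s with h | h
    · exact linkable_of_lt hp h hB'
    · obtain ⟨k, rfl⟩ : ∃ k, l = s + k := ⟨l - s, by omega⟩
      exact linkable_add hn hp hs hA hA' hD hDA hB (ih k (by omega))

/-- The constant in the supermultiplicativity of the modulus. -/
noncomputable def superConst (n : ℕ) (p : ℝ) (B : ℝ≥0) : ℝ≥0 :=
  3 ^ p * ((unfoldingConst n 0 : ℝ≥0) ^ p + ((3 ^ n : ℕ) : ℝ≥0) ^ p * B) * 5 ^ n

/-- Around each cell `Q` of level `k` take a short unfolded set `S Q`, and short links `T Q Q'` to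
those of the cells that touch `Q`; let `σ Q` be their total length. Along a crossing of level `k`
these sets unite to a crossing, so `σ` is admissible whenever `ρ` is, and `σ Q ^ p * M p l` is
bounded by the mass of `ρ` near `Q`. -/
theorem crossModulus_mul_le (hn : 0 < n) {p : ℝ} (hp : 1 ≤ p) {B : ℝ≥0} {l : ℕ}
    (hl : Linkable n p B l) (k : ℕ) :
    crossModulus n p k * crossModulus n p l ≤ superConst n p B * crossModulus n p (k + l) := by
  classical
  refine le_mul_crossModulus fun ρ hρ => ?_
  set L := weightLength (cells n (k + l)) (box (k + l)) ρ with hL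
  let μ : (Fin n → ℤ) → ℝ≥0 := fun Q => localMass p (k + l) l ρ Q 2
  have hex : ∀ Q ∈ cells n k, ∃ S : Set (Fin n → ℝ), IsPathConnected S ∧ S ⊆ sponge n ∧
      (∀ U ∈ cells n k, Near 1 U Q → IsLarge k (S ∩ box k U) ∧
        ∀ i, (∃ x ∈ S ∩ box k U, 3 ^ k * x i = U i) ∧
          ∃ x ∈ S ∩ box k U, 3 ^ k * x i = U i + 1) ∧
      L S ^ p * crossModulus n p l ≤ (unfoldingConst n 0 : ℝ≥0) ^ p * μ Q := by
    intro Q hQ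
    obtain ⟨S, h1, h2, h3, h4⟩ := exists_unfoldedSet hn hp k 0 l hQ ρ
    simp only [ancestor_zero, add_zero, zero_add] at h3 h4
    exact ⟨S, h1, h2, h3, h4⟩
  choose! S hSpc hSK hSbox hSlen using hex
  have hSne : ∀ Q ∈ cells n k, ∀ U ∈ cells n k, Near 1 U Q → (S Q ∩ box k U).Nonempty := by
    intro Q hQ U hU h
    obtain ⟨x, hx, -⟩ := (hSbox Q hQ U hU h).1
    exact ⟨x, hx⟩
  have hself : ∀ Q : Fin n → ℤ, Near 1 Q Q := near_self (by norm_num)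
  have hlarge : ∀ Q ∈ cells n k, IsLarge k (S Q) := fun Q hQ =>
    (hSbox Q hQ Q hQ (hself Q)).1.mono Set.inter_subset_left
  have hex' : ∀ Q Q', Q ∈ cells n k ∧ Q' ∈ cells n k ∧ Near 1 Q' Q →
      ∃ T : Set (Fin n → ℝ), IsPathConnected T ∧ T ⊆ sponge n ∧ (T ∩ S Q).Nonempty ∧
      (T ∩ S Q').Nonempty ∧ L T ^ p * crossModulus n p l ≤ B * μ Q := by
    rintro Q Q' ⟨hQ, hQ', hnear⟩
    exact hl k Q ρ (S Q) (S Q') hQ (hSK Q hQ) (hSK Q' hQ') (hSpc Q hQ).isConnected.isPreconnected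
      (hSpc Q' hQ').isConnected.isPreconnected (hSne Q hQ Q hQ (hself Q))
      (hSne Q' hQ' Q hQ hnear.symm) (hlarge Q hQ) (hlarge Q' hQ')
  choose! T hTpc hTK hTS hTS' hTlen using hex'
  let N : (Fin n → ℤ) → Finset (Fin n → ℤ) := fun Q => (cells n k).filter fun Q' => Near 1 Q' Q
  let σ : (Fin n → ℤ) → ℝ≥0 := fun Q => L (S Q) + ∑ Q' ∈ N Q, L (T Q Q')
  have hNcard : ∀ Q, (N Q).card ≤ 3 ^ n := fun Q => card_near_le (cells n k) Q 1
  have hσ : CrossAdmissible k σ := by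
    intro θ hθ
    let H := (cells n k).filter fun Q => (box k Q ∩ θ).Nonempty
    have hH : ∀ Q ∈ H, Q ∈ cells n k := fun Q hQ => (Finset.mem_filter.1 hQ).1
    let N' : (Fin n → ℤ) → Finset (Fin n → ℤ) := fun Q => H.filter fun Q' => Near 1 Q' Q
    have hN' : ∀ Q, ∀ Q' ∈ N' Q, Q' ∈ H ∧ Near 1 Q' Q := fun Q Q' h => Finset.mem_filter.1 h
    let Z : Set (Fin n → ℝ) := ⋃ Q ∈ H, (S Q ∪ ⋃ Q' ∈ N' Q, T Q Q')
    have hSZ : ∀ Q ∈ H, S Q ⊆ Z := fun Q hQ x hx => Set.mem_biUnion hQ (Or.inl hx)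
    have hTZ : ∀ Q ∈ H, ∀ Q' ∈ N' Q, T Q Q' ⊆ Z := fun Q hQ Q' hQ' x hx =>
      Set.mem_biUnion hQ (Or.inr (Set.mem_biUnion hQ' hx))
    have hθH : ∀ x ∈ θ, ∃ Q ∈ H, x ∈ box k Q := by
      intro x hx
      obtain ⟨Q, hQ, hxQ⟩ := exists_mem_box (hθ.subset hx) k
      exact ⟨Q, Finset.mem_filter.2 ⟨hQ, x, hxQ, hx⟩, hxQ⟩
    obtain ⟨i, ⟨x₀, hx₀, h0⟩, ⟨x₁, hx₁, h1⟩⟩ := hθ.exists_faces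
    obtain ⟨Q₀, hQ₀, hx₀Q⟩ := hθH x₀ hx₀
    obtain ⟨Q₁, hQ₁, hx₁Q⟩ := hθH x₁ hx₁
    obtain ⟨y₀, hy₀⟩ := (hSpc Q₀ (hH _ hQ₀)).nonempty
    have hjoinS : ∀ Q ∈ H, ∀ x ∈ S Q, ∀ y ∈ S Q, JoinedIn Z x y := fun Q hQ x hx y hy =>
      ((hSpc Q (hH Q hQ)).joinedIn x hx y hy).mono (hSZ Q hQ)
    have hreach := box_induction hθ.isPathConnected.isConnected.isPreconnected (m := k) (𝒰 := H)
      (P := fun Q => Q ∈ H ∧ ∀ y ∈ S Q, JoinedIn Z y₀ y) (U₀ := Q₀) hθH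
      (fun Q hQ => by
        obtain ⟨x, hx, hx'⟩ := (Finset.mem_filter.1 hQ).2
        exact ⟨x, hx', hx⟩) hQ₀
      ⟨hQ₀, fun y hy => hjoinS Q₀ hQ₀ y₀ hy₀ y hy⟩
      (by
        rintro Q hQ Q' hQ' hnear ⟨-, hreach⟩
        refine ⟨hQ', fun y hy => ?_⟩
        have hq : Q ∈ cells n k ∧ Q' ∈ cells n k ∧ Near 1 Q' Q :=
          ⟨hH Q hQ, hH Q' hQ', hnear.symm⟩
        have hQ'N : Q' ∈ N' Q := Finset.mem_filter.2 ⟨hQ', hnear.symm⟩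
        obtain ⟨u, hu, huS⟩ := hTS Q Q' hq
        obtain ⟨v, hv, hvS⟩ := hTS' Q Q' hq
        exact ((hreach u huS).trans (((hTpc Q Q' hq).joinedIn u hu v hv).mono
          (hTZ Q hQ Q' hQ'N))).trans (hjoinS Q' hQ' v hvS y hy))
    -- The union reaches the same two faces as `θ`: a cell that meets a face of the cube has a side
    -- on it, and its set `S Q` meets all sides of the cell.
    have hZ : Crosses Z := by
      refine ⟨⟨y₀, hSZ Q₀ hQ₀ hy₀, fun {x} hx => ?_⟩, ?_, i, ?_, ?_⟩
      · obtain ⟨Q, hQ, hx | hx⟩ := Set.mem_iUnion₂.1 hx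
        · exact (hreach Q hQ).2 x hx
        · obtain ⟨Q', hQ', hx⟩ := Set.mem_iUnion₂.1 hx
          have hq : Q ∈ cells n k ∧ Q' ∈ cells n k ∧ Near 1 Q' Q :=
            ⟨hH Q hQ, hH Q' (hN' Q Q' hQ').1, (hN' Q Q' hQ').2⟩
          obtain ⟨u, hu, huS⟩ := hTS Q Q' hq
          exact ((hreach Q hQ).2 u huS).trans (((hTpc Q Q' hq).joinedIn u hu x hx).mono
            (hTZ Q hQ Q' hQ'))
      · refine Set.iUnion₂_subset fun Q hQ => Set.union_subset (hSK Q (hH Q hQ)) ?_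
        exact Set.iUnion₂_subset fun Q' hQ' =>
          hTK Q Q' ⟨hH Q hQ, hH Q' (hN' Q Q' hQ').1, (hN' Q Q' hQ').2⟩
      · obtain ⟨⟨x, hx, hxe⟩, -⟩ := (hSbox Q₀ (hH _ hQ₀) Q₀ (hH _ hQ₀) (hself _)).2 i
        refine ⟨x, hSZ Q₀ hQ₀ hx.1, ?_⟩
        have hb := hx₀Q i
        rw [h0, mul_zero] at hb
        have hb0 : Q₀ i = 0 := by
          have e1 : Q₀ i ≤ 0 := by exact_mod_cast hb.1
          have e2 := ((mem_cells.1 (hH _ hQ₀)).1 i).1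
          omega
        rw [hb0, Int.cast_zero] at hxe
        exact (mul_eq_zero.1 hxe).resolve_left (by positivity)
      · obtain ⟨-, ⟨x, hx, hxe⟩⟩ := (hSbox Q₁ (hH _ hQ₁) Q₁ (hH _ hQ₁) (hself _)).2 i
        refine ⟨x, hSZ Q₁ hQ₁ hx.1, ?_⟩
        have hb := hx₁Q i
        rw [h1, mul_one] at hb
        have hb1 : Q₁ i + 1 = 3 ^ k := by
          have e1 : (3 : ℤ) ^ k ≤ Q₁ i + 1 := by exact_mod_cast hb.2
          have e2 := ((mem_cells.1 (hH _ hQ₁)).1 i).2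
          omega
        have hb2 : (Q₁ i : ℝ) + 1 = 3 ^ k := by exact_mod_cast hb1
        rw [hb2] at hxe
        have h3 : (3 : ℝ) ^ k ≠ 0 := by positivity
        exact mul_left_cancel₀ h3 (by rw [hxe, mul_one])
    refine (hρ Z hZ).trans ((weightLength_biUnion_le _ _ _ _ _).trans ?_)
    refine Finset.sum_le_sum fun Q hQ => ?_
    refine (weightLength_union_le _ _ _ _ _).trans ?_
    simp only [σ]
    gcongr
    refine (weightLength_biUnion_le _ _ _ _ _).trans (Finset.sum_le_sum_of_subset fun Q' hQ' => ?_)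
    exact Finset.mem_filter.2 ⟨hH Q' (hN' Q Q' hQ').1, (hN' Q Q' hQ').2⟩
  have hterm : ∀ Q ∈ cells n k, σ Q ^ p * crossModulus n p l ≤
      (3 ^ p * ((unfoldingConst n 0 : ℝ≥0) ^ p + ((3 ^ n : ℕ) : ℝ≥0) ^ p * B)) * μ Q := by
    intro Q hQ
    have h1 : σ Q ^ p ≤ 3 ^ p * (L (S Q) ^ p + (∑ Q' ∈ N Q, L (T Q Q')) ^ p) := by
      have := add_three_rpow_le hp (L (S Q)) (∑ Q' ∈ N Q, L (T Q Q')) 0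
      rwa [NNReal.zero_rpow (by linarith), add_zero, add_zero] at this
    have h2 : (∑ Q' ∈ N Q, L (T Q Q')) ^ p * crossModulus n p l ≤
        ((3 ^ n : ℕ) : ℝ≥0) ^ p * B * μ Q := by
      calc (∑ Q' ∈ N Q, L (T Q Q')) ^ p * crossModulus n p l
          ≤ (((3 ^ n : ℕ) : ℝ≥0) ^ (p - 1) * ∑ Q' ∈ N Q, L (T Q Q') ^ p) * crossModulus n p l := by
            gcongr
            exact sum_rpow_le_card_mul hp _ _ (hNcard Q)
        _ = ((3 ^ n : ℕ) : ℝ≥0) ^ (p - 1) *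
            ∑ Q' ∈ N Q, L (T Q Q') ^ p * crossModulus n p l := by
            rw [mul_assoc, Finset.sum_mul]
        _ ≤ ((3 ^ n : ℕ) : ℝ≥0) ^ (p - 1) * ∑ Q' ∈ N Q, B * μ Q := by
            refine mul_le_mul' le_rfl (Finset.sum_le_sum fun Q' hQ' => ?_)
            obtain ⟨h, h'⟩ := Finset.mem_filter.1 hQ'
            exact hTlen Q Q' ⟨hQ, h, h'⟩
        _ ≤ ((3 ^ n : ℕ) : ℝ≥0) ^ (p - 1) * (((3 ^ n : ℕ) : ℝ≥0) * (B * μ Q)) := by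
            rw [Finset.sum_const, nsmul_eq_mul]
            gcongr
            exact hNcard Q
        _ = ((3 ^ n : ℕ) : ℝ≥0) ^ p * B * μ Q := by
            have h0 : ((3 ^ n : ℕ) : ℝ≥0) ≠ 0 := by positivity
            rw [← mul_assoc, ← NNReal.rpow_add_one h0, sub_add_cancel, mul_assoc]
    calc σ Q ^ p * crossModulus n p l
        ≤ (3 ^ p * (L (S Q) ^ p + (∑ Q' ∈ N Q, L (T Q Q')) ^ p)) * crossModulus n p l := by gcongr
      _ = 3 ^ p * (L (S Q) ^ p * crossModulus n p l +
          (∑ Q' ∈ N Q, L (T Q Q')) ^ p * crossModulus n p l) := by ring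
      _ ≤ 3 ^ p * ((unfoldingConst n 0 : ℝ≥0) ^ p * μ Q + ((3 ^ n : ℕ) : ℝ≥0) ^ p * B * μ Q) := by
          exact mul_le_mul' le_rfl (add_le_add (hSlen Q hQ) h2)
      _ = _ := by ring
  have hmu : ∑ Q ∈ cells n k, μ Q ≤ 5 ^ n * weightMass p (cells n (k + l)) ρ := by
    simp only [μ, localMass, weightMass]
    rw [Finset.sum_comm' (t' := cells n (k + l))
      (s' := fun R => (cells n k).filter fun Q => Near 2 Q (ancestor l R)) (fun Q R => by
        simp only [Finset.mem_filter]
        constructor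
        · rintro ⟨h1, h2, h3⟩; exact ⟨⟨h1, h3.symm⟩, h2⟩
        · rintro ⟨⟨h1, h3⟩, h2⟩; exact ⟨h1, h2, h3.symm⟩), Finset.mul_sum]
    refine Finset.sum_le_sum fun R _ => ?_
    rw [Finset.sum_const, nsmul_eq_mul]
    gcongr
    exact_mod_cast card_near_le (cells n k) (ancestor l R) 2
  calc crossModulus n p k * crossModulus n p l
      ≤ weightMass p (cells n k) σ * crossModulus n p l := by
        gcongr; exact crossModulus_le hσ
    _ = ∑ Q ∈ cells n k, σ Q ^ p * crossModulus n p l := by rw [weightMass, Finset.sum_mul]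
    _ ≤ ∑ Q ∈ cells n k,
        (3 ^ p * ((unfoldingConst n 0 : ℝ≥0) ^ p + ((3 ^ n : ℕ) : ℝ≥0) ^ p * B)) * μ Q :=
        Finset.sum_le_sum hterm
    _ ≤ superConst n p B * weightMass p (cells n (k + l)) ρ := by
        rw [← Finset.mul_sum, superConst, mul_assoc _ (5 ^ n)]
        gcongr

end Linking

/-! ### The critical exponent. -/

section Critical

open Filter

variable {n : ℕ}

theorem continuous_nnreal_const_rpow {a : ℝ≥0} (ha : a ≠ 0) : Continuous fun y : ℝ => a ^ y := by
  refine continuous_iff_continuousAt.2 fun y => ?_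
  exact (NNReal.continuousAt_rpow (x := a) (y := y) (Or.inl ha)).comp
    (f := fun y : ℝ => (a, y)) (by fun_prop)

theorem crossModulus_pos {k : ℕ} {p : ℝ} (hp : 1 ≤ p) (m : ℕ) : 0 < crossModulus (k + 1) p m := by
  have h := le_crossModulus_of_lines (k := k) hp m
  by_contra h0
  rw [not_lt, nonpos_iff_eq_zero] at h0
  rw [h0, mul_zero, nonpos_iff_eq_zero] at h
  exact absurd h (by positivity)

/-- The exponent at which the cubes in the standard lines alone have modulus `1`. -/
noncomputable def lineExponent (k : ℕ) : ℝ := 1 + k * (Real.log 2 / Real.log 3)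

theorem three_rpow_lineExponent_sub_one (k : ℕ) : (3 : ℝ≥0) ^ (lineExponent k - 1) = 2 ^ k := by
  rw [← NNReal.coe_inj]
  push_cast
  rw [lineExponent, add_sub_cancel_left, mul_comm, Real.rpow_mul (by norm_num)]
  have : (3 : ℝ) ^ (Real.log 2 / Real.log 3) = 2 := by
    rw [Real.rpow_def_of_pos (by norm_num), mul_div_cancel₀ _ (Real.log_pos (by norm_num)).ne',
      Real.exp_log (by norm_num)]
  rw [this, Real.rpow_natCast]

theorem one_le_lineExponent (k : ℕ) : 1 ≤ lineExponent k := by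
  have h2 := Real.log_pos (show (1 : ℝ) < 2 by norm_num)
  have h3 := Real.log_pos (show (1 : ℝ) < 3 by norm_num)
  unfold lineExponent
  have : 0 ≤ (k : ℝ) * (Real.log 2 / Real.log 3) := by positivity
  linarith

theorem one_lt_lineExponent {k : ℕ} (hk : 1 ≤ k) : 1 < lineExponent k := by
  have h2 := Real.log_pos (show (1 : ℝ) < 2 by norm_num)
  have h3 := Real.log_pos (show (1 : ℝ) < 3 by norm_num)
  have hk' : (0 : ℝ) < k := by exact_mod_cast hk
  unfold lineExponent
  have : 0 < (k : ℝ) * (Real.log 2 / Real.log 3) := by positivity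
  linarith

theorem lineExponent_le (k : ℕ) : lineExponent k ≤ k + 1 := by
  have h3 := Real.log_pos (show (1 : ℝ) < 3 by norm_num)
  have h : Real.log 2 / Real.log 3 ≤ 1 := by
    rw [div_le_one h3]; exact Real.log_le_log (by norm_num) (by norm_num)
  have hk : (0 : ℝ) ≤ k := by positivity
  unfold lineExponent
  nlinarith

/-- At `lineExponent k` the constant weight has mass `3 ^ (s * (k + 1)) / (3 * 2 ^ k) ^ s`, and the
modulus decreases in the exponent. -/
theorem crossModulus_le_three_halves_pow {k : ℕ} {p : ℝ} (hp : lineExponent k ≤ p) (s : ℕ) :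
    crossModulus (k + 1) p s ≤ ((3 / 2) ^ k) ^ s := by
  refine (crossModulus_anti (by linarith [one_le_lineExponent k]) hp s).trans
    ((crossModulus_le_pow s).trans (le_of_eq ?_))
  have h : (3 : ℝ≥0) ^ lineExponent k = 3 * 2 ^ k := by
    rw [← three_rpow_lineExponent_sub_one, NNReal.rpow_sub (by norm_num), NNReal.rpow_one]
    field_simp
  have h' : ((3 : ℝ≥0) ^ s) ^ lineExponent k = (3 * 2 ^ k) ^ s := by
    rw [← NNReal.rpow_natCast 3 s, ← NNReal.rpow_mul, mul_comm (s : ℝ), NNReal.rpow_mul, h,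
      NNReal.rpow_natCast]
  have e : (3 : ℝ≥0) ^ (s * (k + 1)) = 3 ^ s * (3 ^ k) ^ s := by
    rw [← pow_mul, ← pow_add]; congr 1; ring
  rw [NNReal.inv_rpow, h', div_pow, div_pow, mul_pow, e]
  have h1 : (3 : ℝ≥0) ^ s ≠ 0 := by positivity
  field_simp

/-- The exponent is chosen so that Hölder's constant `3 ^ (m * (p - 1))` equals the number `2 ^ (k *
m)` of lines. -/
theorem one_le_crossModulus_lineExponent (k m : ℕ) :
    1 ≤ crossModulus (k + 1) (lineExponent k) m := by
  have h := le_crossModulus_of_lines (k := k) (one_le_lineExponent k) m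
  rw [Nat.cast_pow, ← NNReal.rpow_natCast ((3 : ℕ) : ℝ≥0), ← NNReal.rpow_mul, mul_comm (m : ℝ),
    NNReal.rpow_mul, Nat.cast_ofNat, three_rpow_lineExponent_sub_one, NNReal.rpow_natCast,
    ← pow_mul, ← pow_mul, mul_comm m k] at h
  exact le_of_mul_le_mul_left (by rwa [mul_one]) (show (0 : ℝ≥0) < 2 ^ (k * m) by positivity)

theorem superConst_mono {p P : ℝ} (hpP : p ≤ P) (B : ℝ≥0) :
    superConst n p B ≤ superConst n P B := by
  have h1 : (1 : ℝ≥0) ≤ unfoldingConst n 0 := by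
    have : 1 ≤ unfoldingConst n 0 := by
      unfold unfoldingConst
      exact Nat.mul_pos Fintype.card_pos (by positivity)
    exact_mod_cast this
  have h2 : (1 : ℝ≥0) ≤ ((3 ^ n : ℕ) : ℝ≥0) := by exact_mod_cast Nat.one_le_pow _ _ (by norm_num)
  unfold superConst
  gcongr
  norm_num

theorem one_le_superConst {p : ℝ} (hp : 0 ≤ p) (B : ℝ≥0) : 1 ≤ superConst n p B := by
  have h1 : (1 : ℝ≥0) ≤ unfoldingConst n 0 := by
    have : 1 ≤ unfoldingConst n 0 := by
      unfold unfoldingConst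
      exact Nat.mul_pos Fintype.card_pos (by positivity)
    exact_mod_cast this
  unfold superConst
  refine one_le_mul (one_le_mul (NNReal.one_le_rpow (by norm_num) hp) ?_) (one_le_pow₀ (by norm_num))
  exact (NNReal.one_le_rpow h1 hp).trans le_self_add

/-- Uniform constants in the linking property, for a bounded range of exponents. -/
theorem exists_linkable {k : ℕ} (hk : ((3 : ℝ≥0) / 2) ^ k < 3) (P : ℝ) :
    ∃ B : ℝ≥0, ∀ p, lineExponent k ≤ p → p ≤ P → ∀ l, Linkable (k + 1) p B l := by
  set b : ℝ≥0 := (3 / 2) ^ k with hb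
  have hb0 : 0 < b := by positivity
  set c : ℝ≥0 := 3 ^ P * ((7 ^ (k + 1) : ℕ) : ℝ≥0) ^ P with hc
  -- Possible because `b < 3`. The number `112 = 4 * 28` comes from `4 * D ≤ A` and `3 ^ s ≤ 28 *
  -- A`; `3 ≤ s` makes `3 ^ s` large enough for `A` to be positive and for the latter bound.
  obtain ⟨s, hs3, hs⟩ : ∃ s, 3 ≤ s ∧ 112 * c ≤ (3 / b) ^ s := by
    have h1 : 1 < 3 / b := by rwa [lt_div_iff₀ hb0, one_mul]
    have := (tendsto_pow_atTop_atTop_of_one_lt h1).eventually_ge_atTop (112 * c)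
    obtain ⟨s, h⟩ := (this.and (eventually_ge_atTop 3)).exists
    exact ⟨s, h.2, h.1⟩
  set A : ℕ := 3 ^ s / 14 with hA
  have h27 : 27 ≤ 3 ^ s := le_trans (by norm_num) (Nat.pow_le_pow_right (by norm_num) hs3)
  have hA1 : 1 ≤ A := by omega
  have hA14 : 14 * A ≤ 3 ^ s := by omega
  have hA28 : 3 ^ s ≤ 28 * A := by omega
  have hDA : 4 * (c * b ^ s) ≤ A := by
    have h1 : 112 * c * b ^ s ≤ 3 ^ s := by
      calc 112 * c * b ^ s ≤ (3 / b) ^ s * b ^ s := by gcongr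
        _ = 3 ^ s := by rw [← mul_pow, div_mul_cancel₀ _ hb0.ne']
    have h2 : (3 : ℝ≥0) ^ s ≤ 28 * A := by exact_mod_cast hA28
    have h3 : 28 * (4 * (c * b ^ s)) ≤ 28 * A := by
      calc 28 * (4 * (c * b ^ s)) = 112 * c * b ^ s := by ring
        _ ≤ 28 * A := h1.trans h2
    exact le_of_mul_le_mul_left h3 (by norm_num)
  refine ⟨2 * (c * b ^ s) * (unfoldingConst (k + 1) s : ℝ≥0) ^ P +
    (5 ^ (k + 1) * 3 ^ (s * (k + 1))) ^ P * 3 ^ (s * (k + 1)), fun p hp hpP l => ?_⟩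
  have h7 : (1 : ℝ≥0) ≤ ((7 ^ (k + 1) : ℕ) : ℝ≥0) := by
    exact_mod_cast Nat.one_le_pow _ _ (by norm_num)
  have hu : (1 : ℝ≥0) ≤ unfoldingConst (k + 1) s := by
    have : 1 ≤ unfoldingConst (k + 1) s := by
      unfold unfoldingConst
      exact Nat.mul_pos Fintype.card_pos (by positivity)
    exact_mod_cast this
  have h53 : (1 : ℝ≥0) ≤ 5 ^ (k + 1) * 3 ^ (s * (k + 1)) :=
    one_le_mul (one_le_pow₀ (by norm_num)) (one_le_pow₀ (by norm_num))
  refine linkable_all (Nat.succ_pos k) ((one_le_lineExponent k).trans hp) (by omega) hA1 hA14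
    (D := c * b ^ s) ?_ hDA ?_ ?_ l
  · rw [← mul_assoc, hc]
    have h31 : (1 : ℝ≥0) ≤ 3 := by norm_num
    gcongr
    exact crossModulus_le_three_halves_pow hp s
  · refine le_trans ?_ le_self_add
    gcongr
  · refine le_trans ?_ le_add_self
    gcongr

/-- At the critical exponent the moduli are bounded above and below. -/
theorem exists_criticalExponent {k : ℕ} (hk1 : 1 ≤ k) (hk : ((3 : ℝ≥0) / 2) ^ k < 3) :
    ∃ p : ℝ, 1 < p ∧ ∃ δ C B : ℝ≥0, 0 < δ ∧
      ∀ l, δ ≤ crossModulus (k + 1) p l ∧ crossModulus (k + 1) p l ≤ C ∧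
        Linkable (k + 1) p B l := by
  -- Two more than the dimension `k + 1`: at this exponent the constant weight has mass `9 ^ (-m)`,
  -- so the critical exponent lies strictly below.
  set P : ℝ := k + 3 with hP
  set M := crossModulus (k + 1) with hM
  obtain ⟨B, hB⟩ := exists_linkable hk P
  have hp₀ := one_le_lineExponent k
  have hP₀ := lineExponent_le k
  set p₀ := lineExponent k with hp₀def
  set C₁ := superConst (k + 1) P B with hC₁
  set C₂ : ℝ≥0 := ((7 ^ (k + 1) : ℕ) : ℝ≥0) ^ P with hC₂
  have hC₁1 : 1 ≤ C₁ := one_le_superConst (by linarith) B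
  have h7 : (1 : ℝ≥0) ≤ ((7 ^ (k + 1) : ℕ) : ℝ≥0) := by
    exact_mod_cast Nat.one_le_pow _ _ (by norm_num)
  have hC₂1 : 1 ≤ C₂ := NNReal.one_le_rpow h7 (by linarith)
  have hC₂0 : 0 < C₂ := by positivity
  have hsuper : ∀ p, p₀ ≤ p → p ≤ P → ∀ a l, M p a * M p l ≤ C₁ * M p (a + l) := by
    intro p hp hpP a l
    refine (crossModulus_mul_le (Nat.succ_pos k) (hp₀.trans hp) (hB p hp hpP l) a).trans ?_
    gcongr
    exact superConst_mono hpP B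
  have hsub : ∀ p, p₀ ≤ p → p ≤ P → ∀ a, 2 ≤ a → ∀ l, M p (a + l) ≤ C₂ * M p a * M p l := by
    intro p hp hpP a ha l
    refine (crossModulus_add_le (hp₀.trans hp) ha l).trans ?_
    gcongr
    exact NNReal.rpow_le_rpow_of_exponent_le h7 hpP
  -- Once a modulus on a level `m ≥ 2` falls below this threshold, submultiplicativity halves it
  -- again and again along the multiples of `m`.
  set δ₀ : ℝ≥0 := (2 * C₂)⁻¹ with hδ₀
  have hδ₀0 : 0 < δ₀ := by positivity
  let S : Set ℝ := {p | p₀ ≤ p ∧ p ≤ P ∧ ∀ m, 2 ≤ m → δ₀ ≤ M p m}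
  have hS₀ : p₀ ∈ S := by
    refine ⟨le_rfl, by linarith, fun m _ => le_trans ?_ (one_le_crossModulus_lineExponent k m)⟩
    refine inv_le_one_of_one_le₀ ?_
    exact le_trans (by norm_num) (mul_le_mul' (le_refl 2) hC₂1)
  have hSb : BddAbove S := ⟨P, fun p hp => hp.2.1⟩
  set q := sSup S with hq
  have hqp₀ : p₀ ≤ q := le_csSup hSb hS₀
  have hqP : q ≤ P := csSup_le ⟨_, hS₀⟩ fun p hp => hp.2.1
  have hq0 : 0 < q := by linarith
  have hpos : ∀ p, p₀ ≤ p → ∀ m, 0 < M p m := fun p hp m => crossModulus_pos (hp₀.trans hp) m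
  -- For `p` in `S` the comparison of exponents gives `δ₀ ^ q ≤ N ^ (q - p) * M q m ^ p`, a closed
  -- condition on `p` that passes to the supremum.
  have hqlow : ∀ m, 2 ≤ m → δ₀ ≤ M q m := by
    intro m hm
    set N : ℝ≥0 := ((cells (k + 1) m).card : ℝ≥0) with hN
    have hN0 : N ≠ 0 := by
      rw [hN, Nat.cast_ne_zero]; exact (Finset.card_pos.2 (cells_nonempty m)).ne'
    have hcont : Continuous fun p : ℝ => N ^ (q - p) * M q m ^ p := by
      refine Continuous.mul ?_ ?_
      · exact (continuous_nnreal_const_rpow hN0).comp (by fun_prop)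
      · exact continuous_nnreal_const_rpow (hpos q hqp₀ m).ne'
    have hcl : IsClosed {p : ℝ | δ₀ ^ q ≤ N ^ (q - p) * M q m ^ p} :=
      isClosed_le continuous_const hcont
    have hmem : q ∈ {p : ℝ | δ₀ ^ q ≤ N ^ (q - p) * M q m ^ p} := by
      refine hcl.closure_subset_iff.2 ?_ (csSup_mem_closure ⟨_, hS₀⟩ hSb)
      intro p hp
      refine le_trans ?_ (crossModulus_rpow_le (by linarith [hp.1]) (le_csSup hSb hp) m)
      exact NNReal.rpow_le_rpow (hp.2.2 m hm) hq0.le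
    have h : δ₀ ^ q ≤ N ^ (q - q) * M q m ^ q := hmem
    rw [sub_self, NNReal.rpow_zero, one_mul] at h
    exact (NNReal.rpow_le_rpow_iff hq0).1 h
  have hqlt : q < P := by
    refine lt_of_le_of_ne hqP fun he => ?_
    have hlim : Tendsto (fun m : ℕ => ((3 : ℝ≥0)⁻¹) ^ m) atTop (𝓝 0) :=
      NNReal.tendsto_pow_atTop_nhds_zero_of_lt_one (by
        rw [← NNReal.coe_lt_coe]; push_cast; norm_num)
    obtain ⟨m, h1, h2⟩ := ((hlim.eventually_lt_const hδ₀0).and (eventually_ge_atTop 2)).exists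
    have h3 := hqlow m h2
    rw [he] at h3
    have h4 : M P m ≤ (3⁻¹ : ℝ≥0) ^ m := by
      refine (crossModulus_le_pow m).trans ?_
      have e : ((3 ^ m)⁻¹ : ℝ≥0) ^ P = ((3 ^ m)⁻¹) ^ (k + 3) := by
        rw [← NNReal.rpow_natCast ((3 ^ m)⁻¹ : ℝ≥0) (k + 3)]; push_cast; rfl
      have h30 : (3 : ℝ≥0) ^ m ≠ 0 := by positivity
      have e' : (3 : ℝ≥0) ^ (m * (k + 1)) * ((3 ^ m)⁻¹) ^ (k + 3) = ((3 ^ m)⁻¹) ^ 2 := by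
        rw [pow_mul, show k + 3 = (k + 1) + 2 by ring, pow_add ((3 ^ m)⁻¹ : ℝ≥0), ← mul_assoc,
          ← mul_pow, mul_inv_cancel₀ h30, one_pow, one_mul]
      rw [e, e', inv_pow (3 : ℝ≥0) m, pow_two]
      have h31 : ((3 : ℝ≥0) ^ m)⁻¹ ≤ 1 := inv_le_one_of_one_le₀ (one_le_pow₀ (by norm_num))
      exact mul_le_of_le_one_left bot_le h31
    exact absurd (h3.trans h4) (not_le.2 h1)
  -- If `M q a` were larger, so would be `M r a` for some `r > q`, and supermultiplicativity would
  -- make `M r` grow along the multiples of `a`. But `r` is not in `S`, so `M r` decays along the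
  -- multiples of some `m`.
  have hqup : ∀ a, M q a ≤ 2 * C₁ := by
    intro a
    by_contra! hcon
    have ha : 1 ≤ a := by
      rcases Nat.eq_zero_or_pos a with rfl | h
      · exfalso
        have h1 := crossModulus_le_card (n := k + 1) q 0
        rw [zero_mul, pow_zero] at h1
        have h2 := hcon.trans_le h1
        refine absurd h2 (not_lt.2 ?_)
        exact le_trans (by norm_num) (mul_le_mul' (le_refl 2) hC₁1)
      · exact h
    obtain ⟨r, hqr, hrP, hr⟩ : ∃ r, q < r ∧ r ≤ P ∧ 2 * C₁ < M r a := by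
      by_contra! hno
      set N : ℝ≥0 := ((cells (k + 1) a).card : ℝ≥0) with hN
      have hN0 : N ≠ 0 := by
        rw [hN, Nat.cast_ne_zero]; exact (Finset.card_pos.2 (cells_nonempty a)).ne'
      have hc1 : Continuous fun r : ℝ => M q a ^ r :=
        continuous_nnreal_const_rpow (hpos q hqp₀ a).ne'
      have hc2 : Continuous fun r : ℝ => N ^ (r - q) * (2 * C₁) ^ q :=
        ((continuous_nnreal_const_rpow hN0).comp (by fun_prop)).mul continuous_const
      have hle : M q a ^ q ≤ N ^ (q - q) * (2 * C₁) ^ q := by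
        refine le_of_tendsto_of_tendsto (b := 𝓝[>] q)
          ((hc1.tendsto q).mono_left nhdsWithin_le_nhds)
          ((hc2.tendsto q).mono_left nhdsWithin_le_nhds) ?_
        filter_upwards [Ioc_mem_nhdsGT hqlt] with r hr
        refine (crossModulus_rpow_le hq0 hr.1.le a).trans ?_
        refine mul_le_mul' le_rfl (NNReal.rpow_le_rpow (hno r hr.1 hr.2) hq0.le)
      rw [sub_self, NNReal.rpow_zero, one_mul, NNReal.rpow_le_rpow_iff hq0] at hle
      exact absurd hle (not_le.2 hcon)
    have hpr : p₀ ≤ r := hqp₀.trans hqr.le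
    obtain ⟨m, hm, hmr⟩ : ∃ m, 2 ≤ m ∧ M r m < δ₀ := by
      by_contra! hno
      exact absurd (le_csSup hSb (show r ∈ S from ⟨hpr, hrP, hno⟩)) (not_le.2 hqr)
    have hgrow : ∀ t, C₁ * 2 ^ (t + 1) ≤ M r (a * (t + 1)) := by
      intro t
      induction t with
      | zero => rw [zero_add, mul_one, pow_one, mul_comm]; exact hr.le
      | succ t ih =>
        have h1 := hsuper r hpr hrP (a * (t + 1)) a
        rw [← Nat.mul_succ] at h1
        refine le_of_mul_le_mul_left (le_trans ?_ h1) (show 0 < C₁ by positivity)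
        calc C₁ * (C₁ * 2 ^ (t + 1 + 1)) = (C₁ * 2 ^ (t + 1)) * (2 * C₁) := by ring
          _ ≤ M r (a * (t + 1)) * M r a := by gcongr
    have hdecay : ∀ t, C₂ * M r (m * (t + 1)) ≤ (2⁻¹ : ℝ≥0) ^ (t + 1) := by
      have hbase : C₂ * M r m ≤ 2⁻¹ := by
        calc C₂ * M r m ≤ C₂ * δ₀ := by gcongr
          _ = 2⁻¹ := by rw [hδ₀, mul_inv, mul_left_comm, mul_inv_cancel₀ hC₂0.ne', mul_one]
      intro t
      induction t with
      | zero => rw [zero_add, mul_one, pow_one]; exact hbase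
      | succ t ih =>
        have h1 := hsub r hpr hrP m hm (m * (t + 1))
        rw [show m + m * (t + 1) = m * (t + 1 + 1) by ring] at h1
        calc C₂ * M r (m * (t + 1 + 1)) ≤ C₂ * (C₂ * M r m * M r (m * (t + 1))) := by gcongr
          _ = (C₂ * M r m) * (C₂ * M r (m * (t + 1))) := by ring
          _ ≤ 2⁻¹ * (2⁻¹) ^ (t + 1) := by gcongr
          _ = _ := by rw [← pow_succ']
    -- Growth and decay contradict each other on the common level `a * m`.
    have h1 := hgrow (m - 1)
    have h2 := hdecay (a - 1)
    rw [Nat.sub_add_cancel (by omega)] at h1 h2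
    rw [mul_comm m a] at h2
    have h3 : (1 : ℝ≥0) ≤ M r (a * m) := by
      refine le_trans ?_ h1
      exact one_le_mul hC₁1 (one_le_pow₀ (by norm_num))
    have h4 : (1 : ℝ≥0) ≤ (2⁻¹) ^ a := le_trans (one_le_mul hC₂1 h3) h2
    have h5 : (2⁻¹ : ℝ≥0) ^ a < 1 := pow_lt_one₀ bot_le (by
      rw [← NNReal.coe_lt_coe]; push_cast; norm_num) (by omega)
    exact absurd h4 (not_le.2 h5)
  refine ⟨q, (one_lt_lineExponent hk1).trans_le hqp₀, min δ₀ (min (M q 0) (M q 1)), 2 * C₁, B,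
    lt_min hδ₀0 (lt_min (hpos q hqp₀ 0) (hpos q hqp₀ 1)), fun l => ⟨?_, hqup l, hB q hqp₀ hqP l⟩⟩
  -- The threshold `δ₀` is only available from level `2` on; the levels `0` and `1` are covered by
  -- the positive values in the minimum.
  rcases lt_or_ge l 2 with h | h
  · interval_cases l
    · exact (min_le_right _ _).trans (min_le_left _ _)
    · exact (min_le_right _ _).trans (min_le_right _ _)
  · exact (min_le_left _ _).trans (hqlow l h)

end Critical

/-! ### Weights for the sets that join two given continua. -/

section Joining

variable {n : ℕ}

/-- Every path-connected subset of the sponge that meets `A` and `B` has length at least `1`. -/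
def JoinAdmissible (m : ℕ) (A B : Set (Fin n → ℝ)) (ρ : (Fin n → ℤ) → ℝ≥0) : Prop :=
  ∀ T, IsPathConnected T → T ⊆ sponge n → (T ∩ A).Nonempty → (T ∩ B).Nonempty →
    1 ≤ weightLength (cells n m) (box m) ρ T

theorem JoinAdmissible.symm {m : ℕ} {A B : Set (Fin n → ℝ)} {ρ : (Fin n → ℤ) → ℝ≥0}
    (h : JoinAdmissible m A B ρ) : JoinAdmissible m B A ρ :=
  fun T hT hTs hA hB => h T hT hTs hB hA

theorem weightMass_mono {ι : Type*} {p : ℝ} {X Y : Finset ι} (h : X ⊆ Y) (ρ : ι → ℝ≥0) :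
    weightMass p X ρ ≤ weightMass p Y ρ :=
  Finset.sum_le_sum_of_subset h

theorem near_of_cells_zero {r : ℤ} (hr : 0 ≤ r) {P P' : Fin n → ℤ} (h : P ∈ cells n 0)
    (h' : P' ∈ cells n 0) : Near r P P' := by
  intro i
  have h1 := (mem_cells.1 h).1 i
  have h2 := (mem_cells.1 h').1 i
  simp only [pow_zero] at h1 h2
  rw [abs_le]
  constructor <;> omega

/-- A lower bound for the mass of weights admissible for two continua that are not too far apart
compared to their size. -/
theorem exists_le_mul_mass (hn : 0 < n) {p : ℝ} (hp : 1 ≤ p) {δ B : ℝ≥0}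
    (hδ : ∀ l, δ ≤ crossModulus n p l) (hB : ∀ l, Linkable n p B l) (s : ℕ) :
    ∃ K : ℝ≥0, ∀ (j m : ℕ), j ≤ m → ∀ E F : Set (Fin n → ℝ), E ⊆ sponge n → F ⊆ sponge n →
      IsPreconnected E → IsPreconnected F → IsLarge j E → IsLarge j F →
      (∃ a ∈ E, ∃ b ∈ F, 3 ^ j * dist a b < 3 ^ s) →
      ∀ ρ, JoinAdmissible m E F ρ → δ ≤ K * weightMass p (cells n m) ρ := by
  refine ⟨3 ^ p * (B + (unfoldingConst n s : ℝ≥0) ^ p + B), ?_⟩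
  intro j m hjm E F hE hF hEc hFc hEl hFl ⟨a, ha, b, hb, hab⟩ ρ hρ
  -- Going `t = min s j` levels up, the cells of `a` and `b` touch: either their size exceeds the
  -- distance of the points, or there is just the unit cube. An unfolded set through all their
  -- descendants of level `j` is then linked to `E` near `a` and to `F` near `b`.
  obtain ⟨t, j₀, hts, hj, ht⟩ : ∃ t j₀, t ≤ s ∧ j = j₀ + t ∧ (t = s ∨ j₀ = 0) := by
    rcases le_total s j with h | h
    · exact ⟨s, j - s, le_rfl, by omega, Or.inl rfl⟩
    · exact ⟨j, 0, h, by omega, Or.inr rfl⟩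
  obtain ⟨l, rfl⟩ := Nat.exists_eq_add_of_le hjm
  subst hj
  obtain ⟨P, hP, haP⟩ := exists_mem_box (hE ha) j₀
  obtain ⟨P', hP', hbP'⟩ := exists_mem_box (hF hb) j₀
  have hnear : Near 1 P' P := by
    rcases ht with rfl | rfl
    · refine near_of_mem_box hbP' haP fun i => ?_
      have h1 : |b i - a i| ≤ dist a b := by
        rw [dist_comm, ← Real.dist_eq]; exact dist_le_pi_dist b a i
      rw [pow_add, mul_right_comm] at hab
      have h2 : (3 : ℝ) ^ j₀ * dist a b < 1 := by
        by_contra! hcon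
        have := mul_le_mul_of_nonneg_right hcon (show (0 : ℝ) ≤ 3 ^ t by positivity)
        linarith
      have h3 : (3 : ℝ) ^ j₀ * |b i - a i| ≤ 3 ^ j₀ * dist a b := by gcongr
      push_cast
      linarith
    · exact near_of_cells_zero zero_le_one hP' hP
  obtain ⟨Q, hQ, hQP, haQ⟩ := exists_descendant (s := t) hP (hE ha) haP
  obtain ⟨Q', hQ', hQP', hbQ'⟩ := exists_descendant (s := t) hP' (hF hb) hbP'
  obtain ⟨S, hS, hSs, hSU, hSρ⟩ := exists_unfoldedSet hn hp j₀ t l hP ρ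
  have hlargeQ := (hSU Q hQ (by rw [hQP]; exact near_self zero_le_one _)).1
  have hlargeQ' := (hSU Q' hQ' (by rwa [hQP'])).1
  have hne : ∀ {U}, IsLarge (j₀ + t) (S ∩ box (j₀ + t) U) → (S ∩ box (j₀ + t) U).Nonempty :=
    fun ⟨x, hx, _⟩ => ⟨x, hx⟩
  obtain ⟨T, hT, hTs, hTE, hTS, hTρ⟩ := hB l (j₀ + t) Q ρ E S hQ hE hSs hEc
    hS.isConnected.isPreconnected ⟨a, ha, haQ⟩ (hne hlargeQ) hEl
    (hlargeQ.mono Set.inter_subset_left)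
  obtain ⟨T', hT', hTs', hTS', hTF', hTρ'⟩ := hB l (j₀ + t) Q' ρ S F hQ' hSs hF
    hS.isConnected.isPreconnected hFc (hne hlargeQ') ⟨b, hb, hbQ'⟩
    (hlargeQ'.mono Set.inter_subset_left) hFl
  have hpath : IsPathConnected (T ∪ S ∪ T') :=
    (hT.union hS hTS).union hT' (by
      obtain ⟨x, hx, hx'⟩ := hTS'
      exact ⟨x, Or.inr hx', hx⟩)
  have hlen := hρ _ hpath (Set.union_subset (Set.union_subset hTs hSs) hTs')
    (hTE.mono (Set.inter_subset_inter_left _ (Set.subset_union_left.trans Set.subset_union_left)))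
    (hTF'.mono (Set.inter_subset_inter_left _ Set.subset_union_right))
  set W := weightMass p (cells n (j₀ + t + l)) ρ with hW
  have hloc : ∀ l' Q r, localMass p (j₀ + t + l) l' ρ Q r ≤ W := fun l' Q r => by
    classical
    unfold localMass
    exact weightMass_mono (Finset.filter_subset _ _) ρ
  set x := weightLength (cells n (j₀ + t + l)) (box (j₀ + t + l)) ρ T
  set y := weightLength (cells n (j₀ + t + l)) (box (j₀ + t + l)) ρ S
  set z := weightLength (cells n (j₀ + t + l)) (box (j₀ + t + l)) ρ T'
  have h1 : 1 ≤ x + y + z :=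
    hlen.trans ((weightLength_union_le _ _ _ _ _).trans
      (add_le_add (weightLength_union_le _ _ _ _ _) le_rfl))
  have hu : ((unfoldingConst n t : ℕ) : ℝ≥0) ≤ unfoldingConst n s := by
    have : unfoldingConst n t ≤ unfoldingConst n s := by
      unfold unfoldingConst
      gcongr
      norm_num
    exact_mod_cast this
  calc δ ≤ 1 ^ p * crossModulus n p l := by rw [NNReal.one_rpow, one_mul]; exact hδ l
    _ ≤ (x + y + z) ^ p * crossModulus n p l := by gcongr
    _ ≤ 3 ^ p * (x ^ p + y ^ p + z ^ p) * crossModulus n p l := by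
      gcongr
      exact add_three_rpow_le hp x y z
    _ = 3 ^ p * (x ^ p * crossModulus n p l + y ^ p * crossModulus n p l +
        z ^ p * crossModulus n p l) := by ring
    _ ≤ 3 ^ p * (B * W + (unfoldingConst n s : ℝ≥0) ^ p * W + B * W) := by
      refine mul_le_mul' le_rfl (add_le_add (add_le_add ?_ ?_) ?_)
      · exact hTρ.trans (mul_le_mul' le_rfl (hloc _ _ _))
      · exact hSρ.trans (mul_le_mul' (NNReal.rpow_le_rpow hu (by linarith)) (hloc _ _ _))
      · exact hTρ'.trans (mul_le_mul' le_rfl (hloc _ _ _))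
    _ = _ := by ring

open Classical in
/-- The indicator of the cells that meet `A`. -/
noncomputable def hitWeight (m : ℕ) (A : Set (Fin n → ℝ)) (q : Fin n → ℤ) : ℝ≥0 :=
  if (box m q ∩ A).Nonempty then 1 else 0

theorem weightMass_hitWeight_le {p : ℝ} (hp : 0 < p) {m : ℕ} {A : Set (Fin n → ℝ)}
    {a : Fin n → ℝ} (ha : a ∈ sponge n) {R : ℕ} (h : ∀ x ∈ A, 3 ^ m * dist x a < R) :
    weightMass p (cells n m) (hitWeight m A) ≤ (((2 * R + 1) ^ n : ℕ) : ℝ≥0) := by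
  classical
  obtain ⟨q, hq, haq⟩ := exists_mem_box ha m
  refine le_trans ?_ (Nat.cast_le.2 (card_near_le (cells n m) q R))
  rw [Finset.card_filter, Nat.cast_sum]
  refine Finset.sum_le_sum fun q' _ => ?_
  unfold hitWeight
  split_ifs with h1 h2 h2
  · simp
  · obtain ⟨x, hx, hxA⟩ := h1
    refine absurd (near_of_mem_box hx haq fun i => ?_) h2
    rw [Int.cast_natCast, ← Real.dist_eq]
    refine lt_of_le_of_lt ?_ (h x hxA)
    gcongr
    exact dist_le_pi_dist x a i
  · simp [hp.ne']
  · simp [hp.ne']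

/-- An upper bound for the modulus of two sets whose distance is not much smaller than the
diameter of one of them. -/
theorem exists_joinAdmissible {p : ℝ} (hp : 1 ≤ p) {C : ℝ≥0} (hC : ∀ l, crossModulus n p l ≤ C)
    (R t : ℕ) :
    ∃ K : ℝ≥0, ∀ (j m : ℕ), j ≤ m → ∀ E F : Set (Fin n → ℝ), E ⊆ sponge n → F ⊆ sponge n →
      ∀ a ∈ E, (∀ x ∈ E, 3 ^ j * dist x a < R) → (∀ x ∈ E, ∀ y ∈ F, 2 / 3 ^ (j + t) ≤ dist x y) →
      ∃ ρ, JoinAdmissible m E F ρ ∧ weightMass p (cells n m) ρ ≤ K := by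
  set D : ℝ≥0 := (((2 * (3 ^ t * R) + 1) ^ n : ℕ) : ℝ≥0) with hD
  refine ⟨D + ((7 ^ n : ℕ) : ℝ≥0) ^ p * D * (C + 1), ?_⟩
  intro j m hjm E F hE hF a ha hEa hEF
  have hscale : ∀ {i}, i ≤ j + t → ∀ x ∈ E, 3 ^ i * dist x a < ((3 ^ t * R : ℕ) : ℝ) := by
    intro i hi x hx
    calc (3 : ℝ) ^ i * dist x a ≤ 3 ^ (j + t) * dist x a := by
          gcongr
          norm_num
      _ = 3 ^ t * (3 ^ j * dist x a) := by rw [pow_add]; ring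
      _ < 3 ^ t * R := by
          have := hEa x hx
          gcongr
      _ = _ := by push_cast; rfl
  -- On fine levels a joining set moves by `2 / 3 ^ (j + t)` away from a cell that meets `E`, so the
  -- product weight sees it. On the few levels from `j` up to `j + t` the indicator of the cells
  -- that meet `E` has bounded mass already.
  rcases le_or_gt (j + t) m with h | h
  · obtain ⟨l, rfl⟩ := Nat.exists_eq_add_of_le h
    have hlt : crossModulus n p l < C + 1 := (hC l).trans_lt (lt_add_of_pos_right _ one_pos)
    obtain ⟨ρ, hρ, hρm⟩ := exists_crossAdmissible_lt hlt
    refine ⟨productWeight (j + t) l (hitWeight (j + t) E) ρ, ?_, ?_⟩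
    · rintro T hT hTs ⟨x, hxT, hxE⟩ ⟨y, hyT, hyF⟩
      obtain ⟨Q, hQ, hxQ⟩ := exists_mem_box (hE hxE) (j + t)
      have := sum_le_weightLength_productWeight (j + t) l (w := hitWeight (j + t) E) hρ hT hTs
        (H := {Q}) (Finset.singleton_subset_iff.2 hQ) (by
          intro Q' hQ'
          rw [Finset.mem_singleton] at hQ'
          subst hQ'
          exact ⟨x, hxT, hxQ, y, hyT, hEF x hxE y hyF⟩)
      rw [Finset.sum_singleton, hitWeight, if_pos ⟨x, hxQ, hxE⟩] at this
      exact this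
    · refine (weightMass_productWeight_le hp _ _ _ _).trans (le_trans ?_ le_add_self)
      gcongr
      exact weightMass_hitWeight_le (by linarith) (hE ha) (hscale le_rfl)
  · refine ⟨hitWeight m E, ?_, ?_⟩
    · rintro T hT hTs ⟨x, hxT, hxE⟩ -
      obtain ⟨Q, hQ, hxQ⟩ := exists_mem_box (hE hxE) m
      have := weightLength_pos_mem (X := cells n m) (C := box m) (ρ := hitWeight m E) (γ := T) hQ
        ⟨x, hxQ, hxT⟩
      rwa [hitWeight, if_pos ⟨x, hxQ, hxE⟩] at this
    · exact (weightMass_hitWeight_le (by linarith) (hE ha) (hscale h.le)).trans le_self_add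

/-- The mass of an average of weights with disjoint supports. -/
theorem weightMass_average_le {ι : Type*} {p : ℝ} (hp : 1 < p) {X : Finset ι} {N : ℕ}
    (hN : 0 < N) (w : ℕ → ι → ℝ≥0) (K : ℝ≥0)
    (hdisj : ∀ q ∈ X, ∀ i < N, ∀ i' < N, w i q ≠ 0 → w i' q ≠ 0 → i = i')
    (hK : ∀ i < N, weightMass p X (w i) ≤ K) :
    weightMass p X (fun q => (N : ℝ≥0)⁻¹ * ∑ i ∈ Finset.range N, w i q) ≤
      (N : ℝ≥0) ^ (1 - p) * K := by
  have hp0 : 0 < p := by linarith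
  have hN0 : (N : ℝ≥0) ≠ 0 := by exact_mod_cast hN.ne'
  have h1 : ∀ q ∈ X, (∑ i ∈ Finset.range N, w i q) ^ p = ∑ i ∈ Finset.range N, w i q ^ p := by
    intro q hq
    by_cases h : ∃ i ∈ Finset.range N, w i q ≠ 0
    · obtain ⟨i, hi, hne⟩ := h
      have h0 : ∀ i' ∈ Finset.range N, i' ≠ i → w i' q = 0 := fun i' hi' hii' => by
        by_contra hne'
        exact hii' (hdisj q hq i' (Finset.mem_range.1 hi') i (Finset.mem_range.1 hi) hne' hne)
      rw [Finset.sum_eq_single_of_mem i hi h0, Finset.sum_eq_single_of_mem i hi]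
      intro i' hi' hii'
      rw [h0 i' hi' hii', NNReal.zero_rpow hp0.ne']
    · push Not at h
      rw [Finset.sum_eq_zero h, NNReal.zero_rpow hp0.ne', Finset.sum_eq_zero]
      intro i hi
      rw [h i hi, NNReal.zero_rpow hp0.ne']
  calc weightMass p X (fun q => (N : ℝ≥0)⁻¹ * ∑ i ∈ Finset.range N, w i q)
      = ∑ q ∈ X, ((N : ℝ≥0)⁻¹) ^ p * ∑ i ∈ Finset.range N, w i q ^ p := by
        refine Finset.sum_congr rfl fun q hq => ?_
        rw [NNReal.mul_rpow, h1 q hq]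
    _ = ((N : ℝ≥0)⁻¹) ^ p * ∑ i ∈ Finset.range N, weightMass p X (w i) := by
        rw [← Finset.mul_sum, Finset.sum_comm]; rfl
    _ ≤ ((N : ℝ≥0)⁻¹) ^ p * (N * K) := by
        gcongr
        refine (Finset.sum_le_card_nsmul _ _ K fun i hi => hK i (Finset.mem_range.1 hi)).trans ?_
        rw [Finset.card_range, nsmul_eq_mul]
    _ = (N : ℝ≥0) ^ (1 - p) * K := by
        rw [NNReal.rpow_sub hN0, NNReal.rpow_one, NNReal.inv_rpow, div_eq_mul_inv]; ring

/-- The product weight of the cells that meet the sphere of radius `20 * 3 ^ (-j)`. -/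
theorem exists_annulusWeight {p : ℝ} (hp : 1 ≤ p) {C : ℝ≥0} (hC : ∀ l, crossModulus n p l ≤ C)
    {a : Fin n → ℝ} (ha : a ∈ sponge n) {j m : ℕ} (hjm : j ≤ m) :
    ∃ w : (Fin n → ℤ) → ℝ≥0,
      weightMass p (cells n m) w ≤ ((7 ^ n : ℕ) : ℝ≥0) ^ p * ((43 ^ n : ℕ) : ℝ≥0) * (C + 1) ∧
      (∀ q, w q ≠ 0 → ∀ x ∈ box m q, 16 ≤ 3 ^ j * dist x a ∧ 3 ^ j * dist x a ≤ 24) ∧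
      ∀ T, IsPathConnected T → T ⊆ sponge n → (∃ x ∈ T, 3 ^ j * dist x a ≤ 20) →
        (∃ y ∈ T, 22 ≤ 3 ^ j * dist y a) → 1 ≤ weightLength (cells n m) (box m) w T := by
  obtain ⟨l, rfl⟩ := Nat.exists_eq_add_of_le hjm
  have hlt : crossModulus n p l < C + 1 := (hC l).trans_lt (lt_add_of_pos_right _ one_pos)
  obtain ⟨ρ, hρ, hρm⟩ := exists_crossAdmissible_lt hlt
  set A : Set (Fin n → ℝ) := {x | 3 ^ j * dist x a = 20}
  have h3 : (0 : ℝ) < 3 ^ j := by positivity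
  -- In units of `3 ^ (-j)`: the support is within `3 + 1` of the sphere of radius `20`, whence `16`
  -- and `24`; a path from the sphere to radius `22` travels the distance `2` that folding requires;
  -- and `43 = 2 * 21 + 1` counts cells around `a`.
  refine ⟨productWeight j l (hitWeight j A) ρ, ?_, ?_, ?_⟩
  · refine (weightMass_productWeight_le hp _ _ _ _).trans ?_
    gcongr
    refine weightMass_hitWeight_le (R := 21) (by linarith) ha fun x hx => ?_
    rw [show (3 : ℝ) ^ j * dist x a = 20 from hx]
    norm_num
  · intro q hq x hx
    have h1 := left_ne_zero_of_mul hq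
    obtain ⟨Q, hQ, hne⟩ := Finset.exists_ne_zero_of_sum_ne_zero h1
    classical
    have hQ' := (Finset.mem_filter.1 hQ).2
    have hhit : (box j Q ∩ A).Nonempty := by
      by_contra h
      exact hne (by rw [hitWeight, if_neg h])
    obtain ⟨y, hyQ, hy⟩ := hhit
    have hxy := abs_sub_le_of_mem_box hQ' (box_subset_box_ancestor j l q hx) hyQ
    have hd : 3 ^ j * dist x y ≤ 4 := by
      rw [← le_div_iff₀' h3, dist_pi_le_iff (by positivity)]
      intro i
      rw [Real.dist_eq, le_div_iff₀' h3]
      refine (hxy i).trans (by norm_num)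
    have hy' : (3 : ℝ) ^ j * dist y a = 20 := hy
    have t1 := mul_le_mul_of_nonneg_left (dist_triangle x y a) h3.le
    have t2 := mul_le_mul_of_nonneg_left (dist_triangle_left y a x) h3.le
    rw [mul_add] at t1 t2
    constructor <;> linarith
  · rintro T hT hTs ⟨x, hx, hxa⟩ ⟨y, hy, hya⟩
    obtain ⟨z, hz, hza⟩ : ∃ z ∈ T, (3 : ℝ) ^ j * dist z a = 20 :=
      hT.isConnected.isPreconnected.intermediate_value hx hy
        (f := fun z => (3 : ℝ) ^ j * dist z a) (by fun_prop) ⟨hxa, by linarith⟩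
    obtain ⟨Q, hQ, hzQ⟩ := exists_mem_box (hTs hz) j
    have := sum_le_weightLength_productWeight j l (w := hitWeight j A) hρ hT hTs
      (H := {Q}) (Finset.singleton_subset_iff.2 hQ) (by
        intro Q' hQ'
        rw [Finset.mem_singleton] at hQ'
        subst hQ'
        refine ⟨z, hz, hzQ, y, hy, ?_⟩
        rw [div_le_iff₀' h3]
        have t1 := mul_le_mul_of_nonneg_left (dist_triangle_left y a z) h3.le
        rw [mul_add] at t1
        linarith)
    rw [Finset.sum_singleton, hitWeight, if_pos ⟨z, hzQ, hza⟩] at this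
    exact this

/-- The modulus of two sets that are far apart compared to the diameter of one of them is small. -/
theorem exists_joinAdmissible_of_far {p : ℝ} (hp : 1 < p) {C : ℝ≥0}
    (hC : ∀ l, crossModulus n p l ≤ C) (i₀ : ℕ) {ε : ℝ≥0} (hε : 0 < ε) :
    ∃ t : ℕ, ∀ (j m : ℕ), j ≤ m → ∀ E F : Set (Fin n → ℝ), E ⊆ sponge n → F ⊆ sponge n →
      ∀ a ∈ E, (∀ x ∈ E, 3 ^ j * dist x a ≤ 20 * 3 ^ i₀) →
      (∀ y ∈ F, 3 ^ t ≤ 3 ^ j * dist y a) →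
      ∃ ρ, JoinAdmissible m E F ρ ∧ weightMass p (cells n m) ρ ≤ ε := by
  set K : ℝ≥0 := ((7 ^ n : ℕ) : ℝ≥0) ^ p * ((43 ^ n : ℕ) : ℝ≥0) * (C + 1) with hK
  -- Here `p > 1` is essential: averaging over `N` annuli gains `N ^ (1 - p)`.
  obtain ⟨N, hN, hNε⟩ : ∃ N : ℕ, 0 < N ∧ (N : ℝ≥0) ^ (1 - p) * K ≤ ε := by
    have h1 : Filter.Tendsto (fun N : ℕ => (N : ℝ) ^ (-(p - 1)) * (K : ℝ)) Filter.atTop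
        (𝓝 (0 * (K : ℝ))) :=
      ((tendsto_rpow_neg_atTop (by linarith)).comp tendsto_natCast_atTop_atTop).mul_const _
    rw [zero_mul] at h1
    have hε' : (0 : ℝ) < ε := by exact_mod_cast hε
    obtain ⟨N, h2, h3⟩ := ((h1.eventually_le_const hε').and (Filter.eventually_gt_atTop 0)).exists
    refine ⟨N, h3, ?_⟩
    rw [← NNReal.coe_le_coe]
    push_cast
    rwa [neg_sub] at h2
  refine ⟨i₀ + N + 3, ?_⟩
  intro j m hjm E F hE hF a ha hEa hFa
  rcases F.eq_empty_or_nonempty with rfl | ⟨y₀, hy₀⟩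
  · refine ⟨0, fun T _ _ _ h => absurd h (by simp), ?_⟩
    have : weightMass p (cells n m) 0 = 0 :=
      Finset.sum_eq_zero fun q _ => NNReal.zero_rpow (by linarith)
    rw [this]; exact bot_le
  -- The sponge has diameter at most `1`, so a point of `F` that far from `a` forces `j` to be
  -- large. The subtractions `j - (i₀ + i)` below are then not truncated.
  have hj : i₀ + N ≤ j := by
    have h1 := hFa y₀ hy₀
    have h2 := dist_le_one (hF hy₀) (hE ha)
    have h3 : (3 : ℝ) ^ (i₀ + N + 3) ≤ 3 ^ j :=
      h1.trans (mul_le_of_le_one_right (by positivity) h2)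
    have := (pow_le_pow_iff_right₀ (show (1 : ℝ) < 3 by norm_num)).1 h3
    omega
  have hex : ∀ i, ∃ w : (Fin n → ℤ) → ℝ≥0, weightMass p (cells n m) w ≤ K ∧
      (∀ q, w q ≠ 0 → ∀ x ∈ box m q,
        16 ≤ 3 ^ (j - (i₀ + i)) * dist x a ∧ 3 ^ (j - (i₀ + i)) * dist x a ≤ 24) ∧
      ∀ T, IsPathConnected T → T ⊆ sponge n → (∃ x ∈ T, 3 ^ (j - (i₀ + i)) * dist x a ≤ 20) →
        (∃ y ∈ T, 22 ≤ 3 ^ (j - (i₀ + i)) * dist y a) →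
        1 ≤ weightLength (cells n m) (box m) w T :=
    fun i => exists_annulusWeight hp.le hC (hE ha) (by omega)
  choose w hw₁ hw₂ hw₃ using hex
  have hN0 : (N : ℝ≥0) ≠ 0 := by exact_mod_cast hN.ne'
  have hsplit : ∀ i < N, (3 : ℝ) ^ j = 3 ^ (j - (i₀ + i)) * (3 ^ i₀ * 3 ^ i) := fun i hi => by
    rw [← pow_add, ← pow_add]; congr 1; omega
  refine ⟨fun q => (N : ℝ≥0)⁻¹ * ∑ i ∈ Finset.range N, w i q, ?_, ?_⟩
  · rintro T hT hTs ⟨x, hxT, hxE⟩ ⟨y, hyT, hyF⟩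
    have hlen : ∀ i < N, 1 ≤ weightLength (cells n m) (box m) (w i) T := by
      intro i hi
      refine hw₃ i T hT hTs ⟨x, hxT, ?_⟩ ⟨y, hyT, ?_⟩
      · have h1 := hEa x hxE
        rw [hsplit i hi] at h1
        have h2 : (1 : ℝ) ≤ 3 ^ i := one_le_pow₀ (by norm_num)
        have h3 : (0 : ℝ) < 3 ^ i₀ := by positivity
        have h4 : 3 ^ (j - (i₀ + i)) * dist x a * 3 ^ i₀ ≤ 20 * 3 ^ i₀ := by
          refine le_trans ?_ h1
          have : 0 ≤ 3 ^ (j - (i₀ + i)) * dist x a * 3 ^ i₀ := by positivity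
          nlinarith
        exact le_of_mul_le_mul_right h4 h3
      · have h1 := hFa y hyF
        rw [hsplit i hi] at h1
        have h3 : (0 : ℝ) < 3 ^ i₀ * 3 ^ i := by positivity
        have h4 : 27 * (3 ^ i₀ * 3 ^ i) ≤ (3 : ℝ) ^ (i₀ + N + 3) := by
          rw [show (27 : ℝ) = 3 ^ 3 by norm_num, ← pow_add, ← pow_add]
          exact pow_le_pow_right₀ (by norm_num) (by omega)
        have h5 : 27 * (3 ^ i₀ * 3 ^ i) ≤
            3 ^ (j - (i₀ + i)) * dist y a * (3 ^ i₀ * 3 ^ i) := by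
          refine (h4.trans h1).trans (le_of_eq (by ring))
        have := le_of_mul_le_mul_right h5 h3
        linarith
    have h : weightLength (cells n m) (box m)
        (fun q => (N : ℝ≥0)⁻¹ * ∑ i ∈ Finset.range N, w i q) T =
        (N : ℝ≥0)⁻¹ * ∑ i ∈ Finset.range N, weightLength (cells n m) (box m) (w i) T := by
      unfold weightLength
      rw [← Finset.mul_sum, Finset.sum_comm]
    rw [h]
    have h1 : (N : ℝ≥0) ≤ ∑ i ∈ Finset.range N, weightLength (cells n m) (box m) (w i) T := by
      have := Finset.card_nsmul_le_sum (Finset.range N)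
        (fun i => weightLength (cells n m) (box m) (w i) T) 1
        fun i hi => hlen i (Finset.mem_range.1 hi)
      rwa [Finset.card_range, nsmul_eq_mul, mul_one] at this
    calc (1 : ℝ≥0) = (N : ℝ≥0)⁻¹ * N := (inv_mul_cancel₀ hN0).symm
      _ ≤ _ := by gcongr
  · refine (weightMass_average_le hp hN w K ?_ fun i _ => hw₁ i).trans hNε
    -- Scales of different annuli differ at least by the factor `3`, and `3 * 16 > 24`, so the
    -- supports are disjoint.
    have key : ∀ q, ∀ i < N, ∀ i' < N, w i q ≠ 0 → w i' q ≠ 0 → ¬ i < i' := by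
      intro q i hi i' hi' h h' hlt
      have hx : (fun c => (q c : ℝ) / 3 ^ m) ∈ box m q := fun c => by
        rw [mul_div_cancel₀ _ (by positivity)]
        constructor <;> linarith
      have h1 := (hw₂ i q h _ hx).2
      have h2 := (hw₂ i' q h' _ hx).1
      have h3 : (3 : ℝ) * 3 ^ (j - (i₀ + i')) ≤ 3 ^ (j - (i₀ + i)) := by
        rw [← pow_succ']
        exact pow_le_pow_right₀ (by norm_num) (by omega)
      have h4 := mul_le_mul_of_nonneg_right h3
        (dist_nonneg (x := fun c => (q c : ℝ) / 3 ^ m) (y := a))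
      linarith
    intro q _ i hi i' hi' h h'
    exact le_antisymm (not_lt.1 (key q i' hi' i hi h' h)) (not_lt.1 (key q i hi i' hi' h h'))

end Joining

/-! ### Comparison functions from uniform bounds. -/

section LoewnerFunctions

/-- Uniform bounds for a family of quantities give comparison functions. -/
theorem exists_loewner_functions {ι : Type*} (u M : ι → ℝ) (hM : ∀ i, 0 ≤ M i)
    (lower : ∀ τ, 0 < τ → ∃ c, 0 < c ∧ ∀ i, τ ≤ u i → c ≤ M i)
    (upper : ∀ τ, 0 < τ → ∃ C, ∀ i, u i ≤ τ → M i ≤ C)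
    (small : ∀ ε, 0 < ε → ∃ τ, 0 < τ ∧ ∀ i, u i ≤ τ → M i ≤ ε) :
    ∃ φ ψ : ℝ → ℝ, (∀ t, 0 < t → 0 < φ t) ∧ (∀ t, 0 < t → 0 < ψ t) ∧
      StrictMonoOn φ (Set.Ioi 0) ∧ StrictMonoOn ψ (Set.Ioi 0) ∧
      Filter.Tendsto ψ (𝓝[>] 0) (𝓝 0) ∧ ∀ i, 0 < u i → φ (u i) ≤ M i ∧ M i ≤ ψ (u i) := by
  -- The inserted values `1` and `0` keep the sets nonempty when no index satisfies the condition;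
  -- otherwise `sInf ∅ = 0` would spoil positivity.
  let S : ℝ → Set ℝ := fun t => insert 1 (M '' {i | t ≤ u i})
  let S' : ℝ → Set ℝ := fun t => insert 0 (M '' {i | u i ≤ t})
  have hSne : ∀ t, (S t).Nonempty := fun t => Set.insert_nonempty _ _
  have hSne' : ∀ t, (S' t).Nonempty := fun t => Set.insert_nonempty _ _
  have hSb : ∀ t, BddBelow (S t) := fun t => ⟨0, by
    rintro x (rfl | ⟨i, -, rfl⟩)
    exacts [zero_le_one, hM i]⟩
  have hSb' : ∀ t, 0 < t → BddAbove (S' t) := fun t ht => by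
    obtain ⟨C, hC⟩ := upper t ht
    refine ⟨max C 0, ?_⟩
    rintro x (rfl | ⟨i, hi, rfl⟩)
    exacts [le_max_right _ _, (hC i hi).trans (le_max_left _ _)]
  have hpos : ∀ t, 0 < t → 0 < sInf (S t) := fun t ht => by
    obtain ⟨c, hc, h⟩ := lower t ht
    refine (lt_min hc one_pos).trans_le (le_csInf (hSne t) ?_)
    rintro x (rfl | ⟨i, hi, rfl⟩)
    exacts [min_le_right _ _, (min_le_left _ _).trans (h i hi)]
  have hmono : ∀ {s t}, s ≤ t → sInf (S s) ≤ sInf (S t) := fun {s t} h =>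
    csInf_le_csInf (hSb s) (hSne t)
      (Set.insert_subset_insert (Set.image_mono fun i hi => le_trans h hi))
  have hmono' : ∀ {s t}, 0 < t → s ≤ t → sSup (S' s) ≤ sSup (S' t) := fun {s t} ht h =>
    csSup_le_csSup (hSb' t ht) (hSne' s)
      (Set.insert_subset_insert (Set.image_mono fun i hi => le_trans hi h))
  have hnonneg' : ∀ t, 0 < t → 0 ≤ sSup (S' t) := fun t ht =>
    le_csSup (hSb' t ht) (Set.mem_insert _ _)
  -- Infimum and supremum are only weakly monotone; the increasing factor below `1` and the summand
  -- `t` make the functions strictly increasing without damaging the bounds.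
  refine ⟨fun t => sInf (S t) * (1 - (1 + t)⁻¹), fun t => sSup (S' t) + t, ?_, ?_, ?_, ?_, ?_, ?_⟩
  · intro t ht
    refine mul_pos (hpos t ht) (sub_pos.2 (inv_lt_one_of_one_lt₀ (by linarith)))
  · intro t ht
    have := hnonneg' t ht
    positivity
  · intro s hs t ht hst
    rw [Set.mem_Ioi] at hs ht
    have h1 : (1 + t)⁻¹ < (1 + s)⁻¹ := by gcongr
    have h2 : (1 + s)⁻¹ < 1 := inv_lt_one_of_one_lt₀ (by linarith)
    exact mul_lt_mul' (hmono hst.le) (by linarith) (by linarith) (hpos t ht)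
  · intro s hs t ht hst
    exact add_lt_add_of_le_of_lt (hmono' ht hst.le) hst
  · rw [Metric.tendsto_nhdsWithin_nhds]
    intro ε hε
    obtain ⟨τ, hτ, h⟩ := small (ε / 2) (by positivity)
    refine ⟨min τ (ε / 2), lt_min hτ (by positivity), fun {t} ht htd => ?_⟩
    rw [Set.mem_Ioi] at ht
    rw [Real.dist_eq, sub_zero, abs_of_pos ht] at htd
    have h1 := hnonneg' t ht
    have h2 : sSup (S' t) ≤ ε / 2 := by
      refine csSup_le (hSne' t) ?_
      rintro x (rfl | ⟨i, hi, rfl⟩)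
      · positivity
      · exact h i (le_trans hi (htd.le.trans (min_le_left _ _)))
    have h3 := htd.trans_le (min_le_right _ _)
    rw [Real.dist_eq, sub_zero, abs_of_nonneg (by positivity)]
    linarith
  · intro i hi
    constructor
    · have h1 : sInf (S (u i)) ≤ M i := csInf_le (hSb _) (Set.mem_insert_of_mem _ ⟨i, le_refl (u i), rfl⟩)
      have h2 : 0 < (1 + u i)⁻¹ := by positivity
      have h3 := hpos _ hi
      show sInf (S (u i)) * (1 - (1 + u i)⁻¹) ≤ M i
      nlinarith
    · have h1 : M i ≤ sSup (S' (u i)) :=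
        le_csSup (hSb' _ hi) (Set.mem_insert_of_mem _ ⟨i, le_refl (u i), rfl⟩)
      show M i ≤ sSup (S' (u i)) + u i
      linarith

end LoewnerFunctions

/-! ### Bi-Lipschitz copies of the sponge: compactness, doubling, comparison of covers. -/

section Chart

variable {Z : Type*} [MetricSpace Z] {n : ℕ}

/-- A bi-Lipschitz parametrization of the sponge, with the supremum metric, by `Z`. -/
structure IsSpongeChart (L : ℕ) (e : Z → Fin n → ℝ) : Prop where
  one_le : 1 ≤ L
  dist_le : ∀ x y, dist (e x) (e y) ≤ dist x y
  le_dist : ∀ x y, dist x y ≤ L * dist (e x) (e y)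
  range_eq : Set.range e = sponge n

namespace IsSpongeChart

variable {L : ℕ} {e : Z → Fin n → ℝ}

theorem mem (h : IsSpongeChart L e) (x : Z) : e x ∈ sponge n := by
  rw [← h.range_eq]; exact Set.mem_range_self x

theorem image_subset (h : IsSpongeChart L e) (A : Set Z) : e '' A ⊆ sponge n := by
  rintro _ ⟨x, -, rfl⟩; exact h.mem x

theorem isInducing (h : IsSpongeChart L e) : Topology.IsInducing e := by
  have h1 : LipschitzWith 1 e := LipschitzWith.of_dist_le_mul fun x y => by
    rw [NNReal.coe_one, one_mul]; exact h.dist_le x y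
  have h2 : AntilipschitzWith (L : ℝ≥0) e := AntilipschitzWith.of_le_mul_dist fun x y => by
    rw [NNReal.coe_natCast]; exact h.le_dist x y
  exact (h2.isUniformInducing h1.uniformContinuous).isInducing

theorem compactSpace (h : IsSpongeChart L e) : CompactSpace Z := by
  rw [← isCompact_univ_iff, h.isInducing.isCompact_iff, Set.image_univ, h.range_eq]
  exact isCompact_sponge

theorem isPathConnected_preimage (h : IsSpongeChart L e) {T : Set (Fin n → ℝ)}
    (hT : IsPathConnected T) (hTs : T ⊆ sponge n) : IsPathConnected (e ⁻¹' T) := by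
  rw [h.isInducing.isPathConnected_iff, Set.image_preimage_eq_of_subset (by rwa [h.range_eq])]
  exact hT

theorem pathConnectedSpace (h : IsSpongeChart L e) : PathConnectedSpace Z := by
  rw [pathConnectedSpace_iff_univ]
  have := h.isPathConnected_preimage isPathConnected_sponge le_rfl
  rwa [← h.range_eq, Set.preimage_range] at this

/-- Separated families in a ball are small. -/
theorem card_le_of_separated (h : IsSpongeChart L e) {ι : Type*} (s : Finset ι) (z : ι → Z) (x : Z)
    {r η : ℝ} (hη : 0 < η) {R : ℕ} (hR : r / η + 1 ≤ R) (hs : ∀ i ∈ s, dist (z i) x ≤ r)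
    (hsep : ∀ i ∈ s, ∀ i' ∈ s, i ≠ i' → L * η ≤ dist (z i) (z i')) :
    s.card ≤ (2 * R + 1) ^ n := by
  classical
  let g : Z → Fin n → ℤ := fun y c => ⌊e y c / η⌋
  have hinj : Set.InjOn (fun i => g (z i)) s := by
    intro i hi i' hi' hg
    by_contra hne
    have h1 := hsep i hi i' hi' hne
    have h2 : dist (e (z i)) (e (z i')) < η := by
      rw [dist_pi_lt_iff hη]
      intro c
      have h3 : |e (z i) c / η - e (z i') c / η| < 1 :=
        Int.abs_sub_lt_one_of_floor_eq_floor (congrFun hg c)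
      rwa [← sub_div, abs_div, abs_of_pos hη, div_lt_one hη] at h3
    have hL : (0 : ℝ) < L := by exact_mod_cast h.one_le
    have h3 := h1.trans (h.le_dist _ _)
    exact absurd (le_of_mul_le_mul_left h3 hL) (not_le.2 h2)
  rw [← Finset.card_image_of_injOn hinj]
  refine le_trans (le_of_eq ?_) (card_near_le (s.image fun i => g (z i)) (g x) R)
  congr 1
  symm
  rw [Finset.filter_eq_self]
  intro q hq
  obtain ⟨i, hi, rfl⟩ := Finset.mem_image.1 hq
  intro c
  have h1 : |e (z i) c - e x c| ≤ r := by
    rw [← Real.dist_eq]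
    exact (dist_le_pi_dist _ _ c).trans ((h.dist_le _ _).trans (hs i hi))
  have h2 : |e (z i) c / η - e x c / η| ≤ r / η := by
    rw [← sub_div, abs_div, abs_of_pos hη]
    gcongr
  rw [abs_le] at h2
  have f1 := Int.floor_le (e (z i) c / η)
  have f2 := Int.lt_floor_add_one (e (z i) c / η)
  have f3 := Int.floor_le (e x c / η)
  have f4 := Int.lt_floor_add_one (e x c / η)
  have h5 : |((⌊e (z i) c / η⌋ - ⌊e x c / η⌋ : ℤ) : ℝ)| ≤ ((R : ℤ) : ℝ) := by
    push_cast
    rw [abs_le]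
    constructor <;> linarith
  exact_mod_cast h5

/-- An `r / 2`-separated subset of the ball with the most points is an `r / 2`-net, and its size is
bounded by `card_le_of_separated` with `η = r / (2 * L)`. -/
theorem isDoublingSpace (h : IsSpongeChart L e) : IsDoublingSpace Z := by
  classical
  have hL : (0 : ℝ) < L := by exact_mod_cast h.one_le
  refine ⟨(2 * (2 * L + 1) + 1) ^ n, fun x r hr => ?_⟩
  let P : Finset Z → Prop := fun s => (∀ y ∈ s, dist y x ≤ r) ∧
    ∀ y ∈ s, ∀ y' ∈ s, y ≠ y' → r / 2 ≤ dist y y'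
  have hcard : ∀ s, P s → s.card ≤ (2 * (2 * L + 1) + 1) ^ n := fun s hs =>
    h.card_le_of_separated s id x (r := r) (η := r / (2 * L)) (by positivity)
      (by push_cast; field_simp; exact le_rfl) hs.1 fun y hy y' hy' hne =>
        le_trans (le_of_eq (by field_simp)) (hs.2 y hy y' hy' hne)
  have hmem := Nat.sSup_mem (s := {k | ∃ s, P s ∧ s.card = k}) ⟨0, ∅, by simp [P], rfl⟩
    ⟨_, by rintro _ ⟨s, hs, rfl⟩; exact hcard s hs⟩
  obtain ⟨c, hc, hcs⟩ := hmem
  refine ⟨c, hcard c hc, fun y hy => ?_⟩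
  by_contra hno
  simp only [Set.mem_iUnion, Metric.mem_ball, not_exists, not_lt] at hno
  have hyc : y ∉ c := fun hyc => by
    have := hno y hyc
    rw [dist_self] at this
    linarith
  have hP : P (insert y c) := by
    constructor
    · intro w hw
      rcases Finset.mem_insert.1 hw with rfl | hw
      exacts [(Metric.mem_ball.1 hy).le, hc.1 w hw]
    · intro w hw w' hw' hne
      rcases Finset.mem_insert.1 hw with rfl | h1 <;> rcases Finset.mem_insert.1 hw' with rfl | h2
      · exact absurd rfl hne
      · exact hno w' h2
      · rw [dist_comm]; exact hno w h1
      · exact hc.2 w h1 w' h2 hne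
  have := le_csSup (s := {k | ∃ s, P s ∧ s.card = k})
    ⟨_, by rintro _ ⟨s, hs, rfl⟩; exact hcard s hs⟩ ⟨_, hP, rfl⟩
  rw [← hcs, Finset.card_insert_of_notMem hyc] at this
  omega

/-- The set `v` meets the cell `q`. -/
def Touches (e : Z → Fin n → ℝ) (m : ℕ) (v : Set Z) (q : Fin n → ℤ) : Prop :=
  (v ∩ e ⁻¹' box m q).Nonempty

open Classical in
/-- At comparable scales, the cells and the vertices of an approximation touch boundedly often. -/
theorem exists_card_touches_le (h : IsSpongeChart L e) {κ : ℝ} (hκ : 1 ≤ κ) :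
    ∃ N : ℕ, ∀ (k m : ℕ) (G : Finset (Set Z)), IsApproximationAt κ k G →
      (L : ℝ) ≤ 3 ^ m * ((2 : ℝ) ^ k)⁻¹ → 3 ^ m * ((2 : ℝ) ^ k)⁻¹ ≤ 3 * L →
      (∀ v ∈ G, ({q ∈ cells n m | Touches e m v q} : Finset _).card ≤ N) ∧
      (∀ q ∈ cells n m, ({v ∈ G | Touches e m v q} : Finset _).card ≤ N) := by
  have hL : (0 : ℝ) < L := by exact_mod_cast h.one_le
  have hL1 : (1 : ℝ) ≤ L := by exact_mod_cast h.one_le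
  -- Two points of a vertex are at most `2 * κ * 2 ^ (-k)` apart, which is at most `6 * L * κ`
  -- cells. For `R₂`: the centers of vertices touching one cell lie in a ball of radius `(κ + L) * 2
  -- ^ (-k)`, and disjointness of the small balls keeps them `κ⁻¹ * 2 ^ (-k)` apart.
  obtain ⟨R₁, hR₁⟩ := exists_nat_gt (6 * L * κ)
  obtain ⟨R₂, hR₂⟩ := exists_nat_ge ((κ + L) / (κ⁻¹ / L) + 1)
  refine ⟨max ((2 * R₁ + 1) ^ n) ((2 * R₂ + 1) ^ n), fun k m G hG hm hm' => ⟨fun v hv => ?_,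
    fun q hq => ?_⟩⟩
  · obtain ⟨z, hz, -⟩ := hG.exists_centers
    refine le_trans ?_ (le_max_left _ _)
    rcases Finset.eq_empty_or_nonempty {q ∈ cells n m | Touches e m v q} with h0 | ⟨q₀, hq₀⟩
    · rw [h0]; simp
    obtain ⟨-, x₀, hx₀, hx₀q⟩ := Finset.mem_filter.1 hq₀
    refine le_trans (Finset.card_le_card fun q hq => ?_) (card_near_le (cells n m) q₀ R₁)
    obtain ⟨hq, x, hx, hxq⟩ := Finset.mem_filter.1 hq
    refine Finset.mem_filter.2 ⟨hq, near_of_mem_box hxq hx₀q fun i => ?_⟩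
    have h1 := Metric.mem_ball.1 ((hz ⟨v, hv⟩).2 hx)
    have h2 := Metric.mem_ball.1 ((hz ⟨v, hv⟩).2 hx₀)
    have h3 : dist x x₀ ≤ 2 * (κ * ((2 : ℝ) ^ k)⁻¹) := by
      have := dist_triangle_right x x₀ (z ⟨v, hv⟩)
      linarith
    have h4 : |e x i - e x₀ i| ≤ 2 * (κ * ((2 : ℝ) ^ k)⁻¹) := by
      rw [← Real.dist_eq]
      exact (dist_le_pi_dist _ _ i).trans ((h.dist_le _ _).trans h3)
    calc (3 : ℝ) ^ m * |e x i - e x₀ i| ≤ 3 ^ m * (2 * (κ * ((2 : ℝ) ^ k)⁻¹)) := by gcongr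
      _ = 2 * κ * (3 ^ m * ((2 : ℝ) ^ k)⁻¹) := by ring
      _ ≤ 2 * κ * (3 * L) := by gcongr
      _ = 6 * L * κ := by ring
      _ < _ := by exact_mod_cast hR₁
  · obtain ⟨z, hz, hzd⟩ := hG.exists_centers
    refine le_trans ?_ (le_max_right _ _)
    set r : ℝ := ((2 : ℝ) ^ k)⁻¹ with hr
    have hr0 : 0 < r := by positivity
    rcases Finset.eq_empty_or_nonempty {v ∈ G | Touches e m v q} with h0 | ⟨v₀, hv₀⟩
    · rw [h0]; simp
    obtain ⟨-, x₀, hx₀, hx₀q⟩ := Finset.mem_filter.1 hv₀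
    have hdist : ∀ v (hv : v ∈ G), Touches e m v q → dist (z ⟨v, hv⟩) x₀ ≤ (κ + L) * r := by
      rintro v hv ⟨x, hx, hxq⟩
      have h1 := Metric.mem_ball.1 ((hz ⟨v, hv⟩).2 hx)
      have h2 : dist (e x) (e x₀) ≤ r := by
        rw [dist_pi_le_iff hr0.le]
        intro i
        have h3 := abs_sub_le_of_mem_box (near_self le_rfl q) hxq hx₀q i
        rw [Int.cast_zero, zero_add] at h3
        have h4 : 3 ^ m * |e x i - e x₀ i| ≤ 3 ^ m * r := h3.trans (hL1.trans hm)
        rw [Real.dist_eq]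
        exact le_of_mul_le_mul_left h4 (by positivity)
      have h3 : dist x x₀ ≤ L * r := (h.le_dist x x₀).trans (by gcongr)
      have h4 := dist_triangle (z ⟨v, hv⟩) x x₀
      rw [dist_comm x] at h1
      linarith
    let z' : Set Z → Z := fun v => if hv : v ∈ G then z ⟨v, hv⟩ else x₀
    have hz' : ∀ v (hv : v ∈ G), z' v = z ⟨v, hv⟩ := fun v hv => dif_pos hv
    refine h.card_le_of_separated _ z' x₀ (r := (κ + L) * r) (η := κ⁻¹ / L * r) (by positivity)
      ?_ ?_ ?_
    · rwa [mul_div_mul_right _ _ hr0.ne']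
    · intro v hv
      obtain ⟨hv, ht⟩ := Finset.mem_filter.1 hv
      rw [hz' v hv]
      exact hdist v hv ht
    · intro v hv w hw hne
      have hv := (Finset.mem_filter.1 hv).1
      have hw := (Finset.mem_filter.1 hw).1
      rw [hz' v hv, hz' w hw, ← mul_assoc, mul_div_cancel₀ _ hL.ne']
      by_contra! hlt
      have hmem : z ⟨w, hw⟩ ∈ Metric.ball (z ⟨v, hv⟩) (κ⁻¹ * r) := by
        rw [Metric.mem_ball, dist_comm]
        exact hlt
      exact Set.disjoint_left.1 (hzd ⟨v, hv⟩ ⟨w, hw⟩ (by simpa using hne)) hmem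
        (Metric.mem_ball_self (by positivity))

end IsSpongeChart
end Chart

/-! ### Comparison of the modulus on an approximation with weights on cells. -/

section Transfer

theorem pMass_eq {Z : Type*} (p : ℝ) (G : Finset (Set Z)) (ρ : Set Z → ℝ≥0) :
    pMass p G ρ = (weightMass p G ρ : ℝ) := by
  simp [pMass, weightMass]

theorem rhoLength_eq {Z : Type*} (G : Finset (Set Z)) (ρ : Set Z → ℝ≥0) (γ : Set Z) :
    rhoLength G ρ γ = weightLength G id ρ γ := rfl

variable {Z : Type*} [MetricSpace Z] {n : ℕ}

theorem modulus_nonneg (p : ℝ) (G : Finset (Set Z)) (F : Set C(unitInterval, Z)) :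
    0 ≤ modulus p G F := by
  refine Real.sInf_nonneg ?_
  rintro _ ⟨ρ, -, rfl⟩
  rw [pMass_eq]
  exact NNReal.coe_nonneg _

theorem modulus_le {p : ℝ} {G : Finset (Set Z)} {F : Set C(unitInterval, Z)} {ρ : Set Z → ℝ≥0}
    (hρ : IsAdmissible G F ρ) : modulus p G F ≤ weightMass p G ρ := by
  refine csInf_le ⟨0, ?_⟩ ⟨ρ, hρ, (pMass_eq p G ρ).symm⟩
  rintro _ ⟨ρ, -, rfl⟩
  rw [pMass_eq]
  exact NNReal.coe_nonneg _

theorem exists_mem_of_covers {κ : ℝ} {k : ℕ} {G : Finset (Set Z)} (hG : IsApproximationAt κ k G)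
    (x : Z) : ∃ v ∈ G, x ∈ v := by
  have : x ∈ ⋃ v ∈ G, v := by rw [hG.covers]; trivial
  simpa using this

theorem le_modulus {κ : ℝ} {k : ℕ} {G : Finset (Set Z)} (hG : IsApproximationAt κ k G) {p c : ℝ}
    {F : Set C(unitInterval, Z)} (h : ∀ ρ, IsAdmissible G F ρ → c ≤ weightMass p G ρ) :
    c ≤ modulus p G F := by
  refine le_csInf ⟨_, fun _ => 1, fun γ _ => ?_, rfl⟩ ?_
  · obtain ⟨v, hv, hxv⟩ := exists_mem_of_covers hG (γ 0)
    exact weightLength_pos_mem (X := G) (C := id) (ρ := fun _ => 1) hv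
      ⟨γ 0, hxv, Set.mem_range_self _⟩
  · rintro _ ⟨ρ, hρ, rfl⟩
    rw [pMass_eq]
    exact h ρ hρ

namespace IsSpongeChart

variable {L : ℕ} {e : Z → Fin n → ℝ}

/-- A path-connected subset of the sponge contains the image of a curve in `Z`. -/
theorem exists_curve (h : IsSpongeChart L e) {A B : Set Z} {T : Set (Fin n → ℝ)}
    (hT : IsPathConnected T) (hTs : T ⊆ sponge n) (hA : (T ∩ e '' A).Nonempty)
    (hB : (T ∩ e '' B).Nonempty) :
    ∃ γ ∈ joiningCurves A B, e '' Set.range γ ⊆ T := by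
  obtain ⟨_, haT, a, ha, rfl⟩ := hA
  obtain ⟨_, hbT, b, hb, rfl⟩ := hB
  obtain ⟨γ, hγ⟩ := (h.isPathConnected_preimage hT hTs).joinedIn a haT b hbT
  refine ⟨γ.toContinuousMap, ⟨?_, ?_⟩, ?_⟩
  · simpa using ha
  · simpa using hb
  · rintro _ ⟨_, ⟨t, rfl⟩, rfl⟩
    exact hγ t

open Classical in
/-- Modulus bounds on the cells give modulus bounds on an approximation. -/
theorem modulus_le_of_joinAdmissible (h : IsSpongeChart L e) {p : ℝ} (hp : 1 ≤ p) {κ : ℝ}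
    {k m N : ℕ} {G : Finset (Set Z)} (hG : IsApproximationAt κ k G)
    (h₁ : ∀ v ∈ G, ({q ∈ cells n m | Touches e m v q} : Finset _).card ≤ N)
    (h₂ : ∀ q ∈ cells n m, ({v ∈ G | Touches e m v q} : Finset _).card ≤ N)
    {A B : Set Z} {ρ : (Fin n → ℤ) → ℝ≥0} (hρ : JoinAdmissible m (e '' A) (e '' B) ρ) :
    modulus p G (joiningCurves A B) ≤ ((N : ℝ≥0) ^ p * weightMass p (cells n m) ρ : ℝ≥0) := by
  refine (modulus_le (ρ := transferWeight (cells n m) (Touches e m) ρ) fun γ hγ => ?_).trans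
    (NNReal.coe_le_coe.2 (weightMass_transferWeight_le hp h₁ h₂ ρ))
  rw [rhoLength_eq]
  have hT : IsPathConnected (e '' Set.range γ) := by
    have : PathConnectedSpace unitInterval := isPathConnected_iff_pathConnectedSpace.1
      ((convex_Icc (0 : ℝ) 1).isPathConnected ⟨0, unitInterval.zero_mem⟩)
    rw [← Set.image_univ]
    exact (isPathConnected_univ.image γ.continuous).image h.isInducing.continuous
  refine (hρ _ hT (h.image_subset _) ⟨e (γ 0), ⟨_, Set.mem_range_self _, rfl⟩, _, hγ.1, rfl⟩
    ⟨e (γ 1), ⟨_, Set.mem_range_self _, rfl⟩, _, hγ.2, rfl⟩).trans ?_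
  refine weightLength_le_transferWeight ρ ?_
  rintro q - ⟨_, hq, x, hx, rfl⟩
  obtain ⟨v, hv, hxv⟩ := exists_mem_of_covers hG x
  exact ⟨v, hv, ⟨x, hxv, hx⟩, x, hxv, hq⟩

-- A weight on the vertices is transferred to the cells, where `hK` applies; a path-connected set
-- contains the image of a curve, so admissibility carries over. The `+ 1` only keeps the
-- denominator positive.
open Classical in
theorem le_modulus_of_joinAdmissible (h : IsSpongeChart L e) {p : ℝ} (hp : 1 ≤ p) {κ : ℝ}
    {k m N : ℕ} {G : Finset (Set Z)} (hG : IsApproximationAt κ k G)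
    (h₁ : ∀ v ∈ G, ({q ∈ cells n m | Touches e m v q} : Finset _).card ≤ N)
    (h₂ : ∀ q ∈ cells n m, ({v ∈ G | Touches e m v q} : Finset _).card ≤ N)
    {A B : Set Z} {δ K : ℝ≥0}
    (hK : ∀ ρ, JoinAdmissible m (e '' A) (e '' B) ρ → δ ≤ K * weightMass p (cells n m) ρ) :
    ((δ / (K * N ^ p + 1) : ℝ≥0) : ℝ) ≤ modulus p G (joiningCurves A B) := by
  refine le_modulus hG fun ρ hρ => NNReal.coe_le_coe.2 ?_
  rw [div_le_iff₀' (by positivity)]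
  have h1 : δ ≤ K * (N ^ p * weightMass p G ρ) := by
    refine (hK (transferWeight G (fun q v => Touches e m v q) ρ) ?_).trans ?_
    · intro T hT hTs hA hB
      obtain ⟨γ, hγ, hγT⟩ := h.exists_curve hT hTs hA hB
      refine (hρ γ hγ).trans ?_
      rw [rhoLength_eq]
      refine (weightLength_le_transferWeight ρ ?_).trans (weightLength_mono hγT)
      rintro v - ⟨x, hxv, hx⟩
      obtain ⟨q, hq, hxq⟩ := exists_mem_box (h.mem x) m
      exact ⟨q, hq, ⟨e x, hxq, x, hx, rfl⟩, x, hxv, hxq⟩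
    · gcongr
      exact weightMass_transferWeight_le hp h₂ h₁ ρ
  refine h1.trans ?_
  rw [add_mul, mul_assoc]
  exact le_self_add

end IsSpongeChart

end Transfer

/-! ### Scales, diameters and distances of compact sets. -/

section Continua

variable {Z : Type*} [MetricSpace Z]

/-- Takes the least `m` with `L ≤ 3 ^ m * r`; the previous power fails, which gives the upper bound.
Minimality serves to compare the scales of two radii. -/
theorem exists_scale {L r : ℝ} (hr : 0 < r) (hrL : r ≤ 3 * L) :
    ∃ m : ℕ, L ≤ 3 ^ m * r ∧ 3 ^ m * r ≤ 3 * L ∧ ∀ m', L ≤ 3 ^ m' * r → m ≤ m' := by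
  classical
  have hex : ∃ m : ℕ, L ≤ 3 ^ m * r := by
    obtain ⟨m, hm⟩ := pow_unbounded_of_one_lt (L / r) (show (1 : ℝ) < 3 by norm_num)
    exact ⟨m, by rw [← div_le_iff₀ hr]; exact hm.le⟩
  refine ⟨Nat.find hex, Nat.find_spec hex, ?_, fun m' hm' => Nat.find_min' hex hm'⟩
  rcases h : Nat.find hex with _ | m
  · rwa [pow_zero, one_mul]
  · have := not_le.1 (Nat.find_min hex (m := m) (by omega))
    rw [pow_succ]
    linarith

theorem exists_dist_eq_diam {A : Set Z} (hA : IsCompact A) (hne : A.Nonempty) :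
    ∃ x ∈ A, ∃ y ∈ A, dist x y = Metric.diam A := by
  obtain ⟨⟨x, y⟩, hxy, hmax⟩ := (hA.prod hA).exists_isMaxOn (hne.prod hne)
    (f := fun q : Z × Z => dist q.1 q.2) (by fun_prop)
  refine ⟨x, hxy.1, y, hxy.2, le_antisymm (Metric.dist_le_diam_of_mem hA.isBounded hxy.1 hxy.2) ?_⟩
  exact Metric.diam_le_of_forall_dist_le dist_nonneg fun a ha b hb =>
    hmax (show (a, b) ∈ A ×ˢ A from ⟨ha, hb⟩)

theorem exists_dist_eq_setDist {A B : Set Z} (hA : IsCompact A) (hB : IsCompact B)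
    (hAne : A.Nonempty) (hBne : B.Nonempty) : ∃ a ∈ A, ∃ b ∈ B, dist a b = setDist A B := by
  have hc : IsCompact (Set.image2 dist A B) := by
    rw [← Set.image_uncurry_prod]
    exact (hA.prod hB).image continuous_dist
  obtain ⟨a, ha, b, hb, h⟩ := hc.sInf_mem (hAne.image2 hBne)
  exact ⟨a, ha, b, hb, h⟩

theorem setDist_le_dist {A B : Set Z} {a b : Z} (ha : a ∈ A) (hb : b ∈ B) :
    setDist A B ≤ dist a b :=
  csInf_le ⟨0, by rintro _ ⟨x, -, y, -, rfl⟩; exact dist_nonneg⟩ ⟨a, ha, b, hb, rfl⟩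

end Continua

/-! ### The Loewner bounds for copies of the sponge. -/

section Loewner

variable {Z : Type*} [MetricSpace Z] {n : ℕ}

/-- Two disjoint non-degenerate continua, with a scale at which both are visible. -/
structure IsVisiblePair (A B : Set Z) (k : ℕ) : Prop where
  left : IsNondegenerateContinuum A
  right : IsNondegenerateContinuum B
  disjoint : Disjoint A B
  scale : ((2 : ℝ) ^ k)⁻¹ ≤ min (Metric.diam A) (Metric.diam B)

namespace IsVisiblePair

variable {A B : Set Z} {k : ℕ}

theorem min_diam_pos (hv : IsVisiblePair A B k) : 0 < min (Metric.diam A) (Metric.diam B) :=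
  lt_of_lt_of_le (by positivity) hv.scale

theorem setDist_pos (hv : IsVisiblePair A B k) : 0 < setDist A B := by
  obtain ⟨a, ha, b, hb, hab⟩ := exists_dist_eq_setDist hv.left.1 hv.right.1 hv.left.2.1.nonempty
    hv.right.2.1.nonempty
  rw [← hab, dist_pos]
  rintro rfl
  exact Set.disjoint_left.1 hv.disjoint ha hb

theorem relativeDistance_inv_pos (hv : IsVisiblePair A B k) : 0 < (relativeDistance A B)⁻¹ :=
  inv_pos.2 (div_pos hv.setDist_pos hv.min_diam_pos)

theorem le_relativeDistance_inv_iff (hv : IsVisiblePair A B k) {τ : ℝ} :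
    τ ≤ (relativeDistance A B)⁻¹ ↔
      τ * setDist A B ≤ min (Metric.diam A) (Metric.diam B) := by
  rw [relativeDistance, inv_div, le_div_iff₀ hv.setDist_pos]

theorem relativeDistance_inv_le_iff (hv : IsVisiblePair A B k) {τ : ℝ} :
    (relativeDistance A B)⁻¹ ≤ τ ↔
      min (Metric.diam A) (Metric.diam B) ≤ τ * setDist A B := by
  rw [relativeDistance, inv_div, div_le_iff₀ hv.setDist_pos]

end IsVisiblePair

namespace IsSpongeChart

variable {L : ℕ} {e : Z → Fin n → ℝ}

theorem diam_le (h : IsSpongeChart L e) (A : Set Z) : Metric.diam A ≤ L :=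
  Metric.diam_le_of_forall_dist_le (by positivity) fun x _ y _ =>
    (h.le_dist x y).trans (mul_le_of_le_one_right (by positivity) (dist_le_one (h.mem x) (h.mem y)))

theorem isLarge_image (h : IsSpongeChart L e) {A : Set Z} (hA : IsNondegenerateContinuum A) {j : ℕ}
    (hj : (L : ℝ) ≤ 3 ^ j * Metric.diam A) : IsLarge j (e '' A) := by
  obtain ⟨x, hx, y, hy, hxy⟩ := exists_dist_eq_diam hA.1 hA.2.1.nonempty
  have hL : (0 : ℝ) < L := by exact_mod_cast h.one_le
  rw [← hxy] at hj
  refine ⟨e x, ⟨x, hx, rfl⟩, e y, ⟨y, hy, rfl⟩, ?_⟩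
  by_contra! hlt
  have h1 : dist (e x) (e y) < (3 ^ j)⁻¹ := by
    rw [dist_pi_lt_iff (by positivity)]
    intro i
    have := hlt i
    rw [Real.dist_eq, inv_eq_one_div, lt_div_iff₀' (by positivity)]
    exact this
  have h2 : (3 : ℝ) ^ j * dist x y ≤ 3 ^ j * (L * dist (e x) (e y)) := by
    gcongr
    exact h.le_dist x y
  have h3 : (3 : ℝ) ^ j * (L * dist (e x) (e y)) < 3 ^ j * (L * (3 ^ j)⁻¹) := by gcongr
  have h4 : (3 : ℝ) ^ j * (L * (3 ^ j)⁻¹) = L := by field_simp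
  linarith

/-- Level `m` matches the scale of the approximation and level `j` the smaller diameter; visibility
of the pair gives `j ≤ m`. -/
theorem exists_scales (h : IsSpongeChart L e) {A B : Set Z} {k : ℕ} (hv : IsVisiblePair A B k) :
    ∃ j m : ℕ, j ≤ m ∧ (L : ℝ) ≤ 3 ^ m * ((2 : ℝ) ^ k)⁻¹ ∧ 3 ^ m * ((2 : ℝ) ^ k)⁻¹ ≤ 3 * L ∧
      (L : ℝ) ≤ 3 ^ j * min (Metric.diam A) (Metric.diam B) ∧
      3 ^ j * min (Metric.diam A) (Metric.diam B) ≤ 3 * L := by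
  have h1 : min (Metric.diam A) (Metric.diam B) ≤ 3 * L := by
    have := (min_le_left _ (Metric.diam B)).trans (h.diam_le A)
    have hL : (0 : ℝ) < L := by exact_mod_cast h.one_le
    linarith
  obtain ⟨m, hm, hm', -⟩ := exists_scale (by positivity) (hv.scale.trans h1)
  obtain ⟨j, hj, hj', hjmin⟩ := exists_scale hv.min_diam_pos h1
  refine ⟨j, m, hjmin m (hm.trans ?_), hm, hm', hj, hj'⟩
  gcongr
  exact hv.scale

theorem exists_le_modulus (h : IsSpongeChart L e) (hn : 0 < n) {p : ℝ} (hp : 1 ≤ p) {δ B₀ : ℝ≥0}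
    (hδ₀ : 0 < δ) (hδ : ∀ l, δ ≤ crossModulus n p l) (hB₀ : ∀ l, Linkable n p B₀ l) {κ : ℝ}
    (hκ : 1 ≤ κ) {G : ℕ → Finset (Set Z)} (hG : IsApproximation κ G) {τ : ℝ} (hτ : 0 < τ) :
    ∃ c, 0 < c ∧ ∀ A B k, IsVisiblePair A B k → τ ≤ (relativeDistance A B)⁻¹ →
      c ≤ modulus p (G k) (joiningCurves A B) := by
  classical
  -- The continua are at distance at most `min diam / τ`, which is at most `3 * L / τ` cells of
  -- level `j`.
  obtain ⟨s, hs⟩ := pow_unbounded_of_one_lt (3 * L / τ) (show (1 : ℝ) < 3 by norm_num)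
  obtain ⟨K, hK⟩ := exists_le_mul_mass hn hp hδ hB₀ s
  obtain ⟨N, hN⟩ := h.exists_card_touches_le hκ
  refine ⟨((δ / (K * N ^ p + 1) : ℝ≥0) : ℝ), NNReal.coe_pos.2 (by positivity),
    fun A B k hv hτ' => ?_⟩
  obtain ⟨j, m, hjm, hm, hm', hj, hj'⟩ := h.exists_scales hv
  obtain ⟨h₁, h₂⟩ := hN k m (G k) (hG k) hm hm'
  refine h.le_modulus_of_joinAdmissible hp (hG k) h₁ h₂ ?_
  have hpre : ∀ {A : Set Z}, IsNondegenerateContinuum A → IsPreconnected (e '' A) := fun hA =>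
    hA.2.1.isPreconnected.image e h.isInducing.continuous.continuousOn
  refine hK j m hjm _ _ (h.image_subset A) (h.image_subset B) (hpre hv.left) (hpre hv.right)
    (h.isLarge_image hv.left (hj.trans ?_)) (h.isLarge_image hv.right (hj.trans ?_)) ?_
  · gcongr
    exact min_le_left _ _
  · gcongr
    exact min_le_right _ _
  · obtain ⟨a, ha, b, hb, hab⟩ := exists_dist_eq_setDist hv.left.1 hv.right.1
      hv.left.2.1.nonempty hv.right.2.1.nonempty
    refine ⟨e a, ⟨a, ha, rfl⟩, e b, ⟨b, hb, rfl⟩, lt_of_le_of_lt ?_ hs⟩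
    rw [le_div_iff₀ hτ]
    rw [hv.le_relativeDistance_inv_iff, ← hab] at hτ'
    calc 3 ^ j * dist (e a) (e b) * τ ≤ 3 ^ j * dist a b * τ := by
          gcongr
          exact h.dist_le a b
      _ = 3 ^ j * (τ * dist a b) := by ring
      _ ≤ 3 ^ j * min (Metric.diam A) (Metric.diam B) := by gcongr
      _ ≤ 3 * L := hj'

/-- An upper bound from weights on the cells, which need only be found when the first of the two
continua has the smaller diameter. -/
theorem modulus_le_of_exists (h : IsSpongeChart L e) {p : ℝ} {N : ℕ} {G : Finset (Set Z)} {k : ℕ}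
    (hN : ∀ m : ℕ, (L : ℝ) ≤ 3 ^ m * ((2 : ℝ) ^ k)⁻¹ → 3 ^ m * ((2 : ℝ) ^ k)⁻¹ ≤ 3 * L →
      ∀ A B : Set Z, ∀ ρ, JoinAdmissible m (e '' A) (e '' B) ρ →
        modulus p G (joiningCurves A B) ≤ ((N : ℝ≥0) ^ p * weightMass p (cells n m) ρ : ℝ≥0))
    {K : ℝ≥0} {τ : ℝ}
    (hK : ∀ j m : ℕ, j ≤ m → ∀ A B : Set Z, IsCompact A → A.Nonempty →
      (L : ℝ) ≤ 3 ^ j * Metric.diam A → 3 ^ j * Metric.diam A ≤ 3 * L →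
      (∀ x ∈ A, ∀ y ∈ B, Metric.diam A ≤ τ * dist x y) →
      ∃ ρ, JoinAdmissible m (e '' A) (e '' B) ρ ∧ weightMass p (cells n m) ρ ≤ K)
    (hτ : 0 < τ) {A B : Set Z} (hv : IsVisiblePair A B k) (hAB : (relativeDistance A B)⁻¹ ≤ τ) :
    modulus p G (joiningCurves A B) ≤ ((N : ℝ≥0) ^ p * K : ℝ≥0) := by
  obtain ⟨j, m, hjm, hm, hm', hj, hj'⟩ := h.exists_scales hv
  rw [hv.relativeDistance_inv_le_iff] at hAB
  have hex : ∃ ρ, JoinAdmissible m (e '' A) (e '' B) ρ ∧ weightMass p (cells n m) ρ ≤ K := by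
    rcases le_total (Metric.diam A) (Metric.diam B) with hle | hle
    · rw [min_eq_left hle] at hAB hj hj'
      refine hK j m hjm A B hv.left.1 hv.left.2.1.nonempty hj hj' fun x hx y hy => hAB.trans ?_
      gcongr
      exact setDist_le_dist hx hy
    · rw [min_eq_right hle] at hAB hj hj'
      obtain ⟨ρ, hρ, hρK⟩ := hK j m hjm B A hv.right.1 hv.right.2.1.nonempty hj hj'
        fun x hx y hy => hAB.trans (by
          gcongr
          rw [dist_comm]
          exact setDist_le_dist hy hx)
      exact ⟨ρ, hρ.symm, hρK⟩
  obtain ⟨ρ, hρ, hρK⟩ := hex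
  refine (hN m hm hm' A B ρ hρ).trans (NNReal.coe_le_coe.2 ?_)
  gcongr

open Classical in
theorem exists_modulus_le_mul (h : IsSpongeChart L e) {p : ℝ} (hp : 1 ≤ p) {κ : ℝ} (hκ : 1 ≤ κ)
    {G : ℕ → Finset (Set Z)} (hG : IsApproximation κ G) :
    ∃ N : ℕ, ∀ k m : ℕ, (L : ℝ) ≤ 3 ^ m * ((2 : ℝ) ^ k)⁻¹ → 3 ^ m * ((2 : ℝ) ^ k)⁻¹ ≤ 3 * L →
      ∀ A B : Set Z, ∀ ρ, JoinAdmissible m (e '' A) (e '' B) ρ →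
        modulus p (G k) (joiningCurves A B) ≤
          ((N : ℝ≥0) ^ p * weightMass p (cells n m) ρ : ℝ≥0) := by
  obtain ⟨N, hN⟩ := h.exists_card_touches_le hκ
  refine ⟨N, fun k m hm hm' A B ρ hρ => ?_⟩
  obtain ⟨h₁, h₂⟩ := hN k m (G k) (hG k) hm hm'
  exact h.modulus_le_of_joinAdmissible hp (hG k) h₁ h₂ hρ

theorem exists_modulus_le (h : IsSpongeChart L e) {p : ℝ} (hp : 1 ≤ p) {C : ℝ≥0}
    (hC : ∀ l, crossModulus n p l ≤ C) {κ : ℝ} (hκ : 1 ≤ κ) {G : ℕ → Finset (Set Z)}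
    (hG : IsApproximation κ G) {τ : ℝ} (hτ : 0 < τ) :
    ∃ M : ℝ, ∀ A B k, IsVisiblePair A B k → (relativeDistance A B)⁻¹ ≤ τ →
      modulus p (G k) (joiningCurves A B) ≤ M := by
  have hL : (0 : ℝ) < L := by exact_mod_cast h.one_le
  obtain ⟨N, hN⟩ := h.exists_modulus_le_mul hp hκ hG
  -- Points of the two images are at least `1 / τ` cells of level `j` apart; `t` further levels turn
  -- this into two cells.
  obtain ⟨t, ht⟩ := pow_unbounded_of_one_lt (2 * τ) (show (1 : ℝ) < 3 by norm_num)
  obtain ⟨K, hK⟩ := exists_joinAdmissible hp hC (3 * L + 1) t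
  refine ⟨((N : ℝ≥0) ^ p * K : ℝ≥0), fun A B k hv hAB =>
    h.modulus_le_of_exists (hN k) ?_ hτ hv hAB⟩
  intro j m hjm A B hA ⟨a, ha⟩ hj hj' hd
  refine hK j m hjm _ _ (h.image_subset A) (h.image_subset B) (e a) ⟨a, ha, rfl⟩ ?_ ?_
  · rintro _ ⟨x, hx, rfl⟩
    have h1 : (3 : ℝ) ^ j * dist (e x) (e a) ≤ 3 ^ j * Metric.diam A := by
      gcongr
      exact (h.dist_le x a).trans (Metric.dist_le_diam_of_mem hA.isBounded hx ha)
    push_cast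
    linarith
  · rintro _ ⟨x, hx, rfl⟩ _ ⟨y, hy, rfl⟩
    have h1 : (L : ℝ) * 1 ≤ L * (3 ^ j * (τ * dist (e x) (e y))) :=
      calc (L : ℝ) * 1 ≤ 3 ^ j * Metric.diam A := by rwa [mul_one]
        _ ≤ 3 ^ j * (τ * (L * dist (e x) (e y))) := by
            gcongr
            refine (hd x hx y hy).trans ?_
            gcongr
            exact h.le_dist x y
        _ = _ := by ring
    have h2 := le_of_mul_le_mul_left h1 hL
    rw [div_le_iff₀' (by positivity), pow_add]
    calc (2 : ℝ) ≤ 2 * (3 ^ j * (τ * dist (e x) (e y))) := by linarith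
      _ = 3 ^ j * (2 * τ) * dist (e x) (e y) := by ring
      _ ≤ 3 ^ j * 3 ^ t * dist (e x) (e y) := by gcongr

theorem exists_modulus_le_of_far (h : IsSpongeChart L e) {p : ℝ} (hp : 1 < p) {C : ℝ≥0}
    (hC : ∀ l, crossModulus n p l ≤ C) {κ : ℝ} (hκ : 1 ≤ κ) {G : ℕ → Finset (Set Z)}
    (hG : IsApproximation κ G) {ε : ℝ} (hε : 0 < ε) :
    ∃ τ, 0 < τ ∧ ∀ A B k, IsVisiblePair A B k → (relativeDistance A B)⁻¹ ≤ τ →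
      modulus p (G k) (joiningCurves A B) ≤ ε := by
  have hL : (0 : ℝ) < L := by exact_mod_cast h.one_le
  obtain ⟨N, hN⟩ := h.exists_modulus_le_mul hp.le hκ hG
  lift ε to ℝ≥0 using hε.le
  set η : ℝ≥0 := ε / (N ^ p + 1) with hη
  have hε' : 0 < ε := by exact_mod_cast hε
  have hη0 : 0 < η := by positivity
  -- The choice `i₀ = L` works because the smaller continuum has size at most `3 * L` in cells of
  -- level `j`, and `3 * L ≤ 20 * 3 ^ L`.
  obtain ⟨t, hK⟩ := exists_joinAdmissible_of_far hp hC L hη0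
  have hτ : (0 : ℝ) < (3 ^ t)⁻¹ := by positivity
  refine ⟨(3 ^ t)⁻¹, hτ, fun A B k hv hAB =>
    (h.modulus_le_of_exists (hN k) (K := η) ?_ hτ hv hAB).trans
      (NNReal.coe_le_coe.2 ?_)⟩
  · intro j m hjm A B hA ⟨a, ha⟩ hj hj' hd
    refine hK j m hjm _ _ (h.image_subset A) (h.image_subset B) (e a) ⟨a, ha, rfl⟩ ?_ ?_
    · rintro _ ⟨x, hx, rfl⟩
      have h1 : (3 : ℝ) ^ j * dist (e x) (e a) ≤ 3 ^ j * Metric.diam A := by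
        gcongr
        exact (h.dist_le x a).trans (Metric.dist_le_diam_of_mem hA.isBounded hx ha)
      have h2 : (L : ℝ) ≤ 3 ^ L := by
        exact_mod_cast (Nat.lt_pow_self (by norm_num : 1 < 3)).le
      linarith
    · rintro _ ⟨y, hy, rfl⟩
      have h1 : (L : ℝ) * 3 ^ t ≤ L * (3 ^ j * dist (e y) (e a)) :=
        calc (L : ℝ) * 3 ^ t ≤ 3 ^ j * Metric.diam A * 3 ^ t := by gcongr
          _ ≤ 3 ^ j * ((3 ^ t)⁻¹ * (L * dist (e y) (e a))) * 3 ^ t := by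
              gcongr
              refine (hd a ha y hy).trans ?_
              gcongr
              rw [dist_comm]
              exact h.le_dist y a
          _ = _ := by field_simp
      exact le_of_mul_le_mul_left h1 hL
  · rw [hη, mul_div_assoc', div_le_iff₀' (by positivity)]
    gcongr
    exact le_self_add

/-- A space with a bi-Lipschitz parametrization of the sponge has the Combinatorial Loewner
Property, if the sponge is thick enough. -/
theorem combinatorialLoewnerProperty {k : ℕ} {e : Z → Fin (k + 1) → ℝ} (h : IsSpongeChart L e)
    (hk1 : 1 ≤ k) (hk : ((3 : ℝ≥0) / 2) ^ k < 3) : CombinatorialLoewnerProperty Z := by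
  obtain ⟨p, hp, δ, C, B₀, hδ₀, hall⟩ := exists_criticalExponent hk1 hk
  refine ⟨p, hp, h.compactSpace, h.pathConnectedSpace, h.isDoublingSpace, fun κ hκ G hG => ?_⟩
  obtain ⟨φ, ψ, hφ, hψ, hφm, hψm, hψ0, hb⟩ := exists_loewner_functions
    (ι := {x : Set Z × Set Z × ℕ // IsVisiblePair x.1 x.2.1 x.2.2})
    (fun x => (relativeDistance x.1.1 x.1.2.1)⁻¹)
    (fun x => modulus p (G x.1.2.2) (joiningCurves x.1.1 x.1.2.1))
    (fun x => modulus_nonneg _ _ _)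
    (fun τ hτ => by
      obtain ⟨c, hc, hle⟩ := h.exists_le_modulus (Nat.succ_pos k) hp.le hδ₀ (fun l => (hall l).1)
        (fun l => (hall l).2.2) hκ hG hτ
      exact ⟨c, hc, fun x hx => hle _ _ _ x.2 hx⟩)
    (fun τ hτ => by
      obtain ⟨M, hle⟩ := h.exists_modulus_le hp.le (fun l => (hall l).2.1) hκ hG hτ
      exact ⟨M, fun x hx => hle _ _ _ x.2 hx⟩)
    (fun ε hε => by
      obtain ⟨τ, hτ, hle⟩ := h.exists_modulus_le_of_far hp (fun l => (hall l).2.1) hκ hG hε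
      exact ⟨τ, hτ, fun x hx => hle _ _ _ x.2 hx⟩)
  refine ⟨φ, ψ, hφ, hψ, hφm, hψm, hψ0, fun A B hA hB hAB k hk => ?_⟩
  have hv : IsVisiblePair A B k := ⟨hA, hB, hAB, hk⟩
  exact hb ⟨(A, B, k), hv⟩ hv.relativeDistance_inv_pos

end IsSpongeChart

end Loewner

/-! ### The carpet and the Menger sponge as sponges in dimensions two and three. -/

section Examples

theorem mem_middleSquare_iff {n : ℕ} {x : EuclideanSpace ℝ (Fin 2)} :
    x ∈ ⋃ (a : ℤ) (b : ℤ), middleSquare n a b ↔ x 0 ∈ middleThirds n ∧ x 1 ∈ middleThirds n := by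
  have h3 : (0 : ℝ) < 3 ^ (n + 1) := by positivity
  have key : ∀ (a : ℤ) (t : ℝ), t ∈ Set.Ioo ((3 * a + 1 : ℝ) / 3 ^ (n + 1))
      ((3 * a + 2 : ℝ) / 3 ^ (n + 1)) ↔
      3 * (a : ℝ) + 1 < 3 ^ (n + 1) * t ∧ 3 ^ (n + 1) * t < 3 * a + 2 := fun a t => by
    rw [Set.mem_Ioo, div_lt_iff₀' h3, lt_div_iff₀' h3]
  simp only [Set.mem_iUnion, middleSquare, Set.mem_ofPred_eq, key, middleThirds]
  constructor
  · rintro ⟨a, b, ha, hb⟩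
    exact ⟨⟨a, ha⟩, b, hb⟩
  · rintro ⟨⟨a, ha⟩, b, hb⟩
    exact ⟨a, b, ha, hb⟩

theorem mem_carpetStage_iff {n : ℕ} {x : EuclideanSpace ℝ (Fin 2)} :
    x ∈ carpetStage n ↔ (∀ i, x i ∈ Set.Icc (0 : ℝ) 1) ∧
      ∀ k < n, ¬ (x 0 ∈ middleThirds k ∧ x 1 ∈ middleThirds k) := by
  induction n with
  | zero => simp [carpetStage]
  | succ n ih =>
    rw [carpetStage, Set.mem_sdiff, ih, mem_middleSquare_iff, and_assoc]
    refine and_congr_right fun _ => ⟨fun ⟨h1, h2⟩ k hk => ?_, fun h1 => ⟨fun k hk => h1 k ?_, h1 n ?_⟩⟩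
    · rcases Nat.lt_succ_iff_lt_or_eq.1 hk with hk | rfl
      exacts [h1 k hk, h2]
    · omega
    · omega

theorem mem_sierpinskiCarpet_iff {x : EuclideanSpace ℝ (Fin 2)} :
    x ∈ sierpinskiCarpet ↔ (∀ i, x i ∈ Set.Icc (0 : ℝ) 1) ∧
      ∀ k, ¬ (x 0 ∈ middleThirds k ∧ x 1 ∈ middleThirds k) := by
  simp only [sierpinskiCarpet, Set.mem_iInter, mem_carpetStage_iff]
  exact ⟨fun h => ⟨(h 0).1, fun k => (h (k + 1)).2 k (Nat.lt_succ_self k)⟩,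
    fun h n => ⟨h.1, fun k _ => h.2 k⟩⟩

theorem ofLp_mem_sponge_two_iff {x : EuclideanSpace ℝ (Fin 2)} :
    x.ofLp ∈ sponge 2 ↔ x ∈ sierpinskiCarpet := by
  rw [mem_sierpinskiCarpet_iff]
  refine and_congr_right fun _ => ⟨fun h k => h 0 1 (by decide) k, fun h i j hij k => ?_⟩
  fin_cases i <;> fin_cases j <;> simp at hij ⊢
  · exact fun h0 h1 => h k ⟨h0, h1⟩
  · exact fun h0 h1 => h k ⟨h1, h0⟩

theorem ofLp_mem_sponge_three_iff {x : EuclideanSpace ℝ (Fin 3)} :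
    x.ofLp ∈ sponge 3 ↔ x ∈ mengerSponge := by
  simp only [mengerSponge, Set.mem_iInter, Set.mem_preimage, mem_sierpinskiCarpet_iff, forgetCoord]
  constructor
  · rintro ⟨h1, h2⟩ i
    exact ⟨fun j => h1 _, fun k => h2 _ _ (by simp) k⟩
  · intro h
    refine ⟨fun i => ?_, fun i j hij k => ?_⟩
    · fin_cases i
      · exact (h 2).1 0
      · exact (h 2).1 1
      · exact (h 0).1 1
    · fin_cases i <;> fin_cases j <;> simp at hij ⊢
      · exact fun h0 h1 => (h 2).2 k ⟨h0, h1⟩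
      · exact fun h0 h1 => (h 1).2 k ⟨h0, h1⟩
      · exact fun h0 h1 => (h 2).2 k ⟨h1, h0⟩
      · exact fun h0 h1 => (h 0).2 k ⟨h0, h1⟩
      · exact fun h0 h1 => (h 1).2 k ⟨h1, h0⟩
      · exact fun h0 h1 => (h 0).2 k ⟨h1, h0⟩

/-- The coordinates parametrize a copy of the sponge in Euclidean space. -/
theorem isSpongeChart_ofLp {n : ℕ} (hn : 1 ≤ n) {S : Set (EuclideanSpace ℝ (Fin n))}
    (hS : ∀ x : EuclideanSpace ℝ (Fin n), x.ofLp ∈ sponge n ↔ x ∈ S) :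
    IsSpongeChart n fun x : S => x.1.ofLp where
  one_le := hn
  dist_le x y := by
    rw [dist_pi_le_iff dist_nonneg]
    intro i
    rw [Real.dist_eq, ← Real.norm_eq_abs, Subtype.dist_eq, dist_eq_norm]
    exact PiLp.norm_apply_le (x.1 - y.1) i
  le_dist x y := by
    set d := dist x.1.ofLp y.1.ofLp with hd
    have hn' : (1 : ℝ) ≤ n := by exact_mod_cast hn
    rw [Subtype.dist_eq, EuclideanSpace.dist_eq]
    refine Real.sqrt_le_iff.2 ⟨by positivity, ?_⟩
    calc ∑ i, dist (x.1 i) (y.1 i) ^ 2 ≤ ∑ _i : Fin n, d ^ 2 := by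
          gcongr with i
          exact dist_le_pi_dist x.1.ofLp y.1.ofLp i
      _ = n * d ^ 2 := by simp
      _ ≤ (n * d) ^ 2 := by
          rw [mul_pow]
          have : (0 : ℝ) ≤ d ^ 2 := by positivity
          gcongr
          nlinarith
  range_eq := by
    ext y
    constructor
    · rintro ⟨x, rfl⟩
      exact (hS x.1).2 x.2
    · intro hy
      exact ⟨⟨WithLp.toLp 2 y, (hS _).1 hy⟩, rfl⟩

end Examples
end CombLoewner

/-- The numerical conditions are `3 / 2 < 3` for the carpet and `9 / 4 < 3` for the Menger sponge;
in dimension four `27 / 8` would be too large for this argument. -/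
theorem mainTheorem3 :
    CombLoewner.CombinatorialLoewnerProperty CombLoewner.sierpinskiCarpet ∧
      CombLoewner.CombinatorialLoewnerProperty CombLoewner.mengerSponge := by
  constructor
  · refine (CombLoewner.isSpongeChart_ofLp (n := 2) (by norm_num)
      fun x => CombLoewner.ofLp_mem_sponge_two_iff).combinatorialLoewnerProperty (k := 1) le_rfl ?_
    rw [← NNReal.coe_lt_coe]
    push_cast
    norm_num
  · refine (CombLoewner.isSpongeChart_ofLp (n := 3) (by norm_num)
      fun x => CombLoewner.ofLp_mem_sponge_three_iff).combinatorialLoewnerProperty (k := 2)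
        (by norm_num) ?_
    rw [← NNReal.coe_lt_coe]
    push_cast
    norm_num
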